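/- Consider the derivative nonlinear Schrödinger (DNLS) equation $\mathrm{i}q_t-q_{xx}+\mathrm{i}(|q|^2q)_x=0$ for $q=q(x,t)$, $x,t\in\mathbb{R}$ (an asterisk denotes complex conjugation). Let $a,c\in\mathbb{R}$ with $c\neq 0$ and $c^2<2a$, let $k\ge 1$ be an integer and $n=2k$. Put $b=a(a-c^2)$, $\theta=ax+bt$, and take the periodic seed $q=c\,e^{\mathrm{i}\theta}$. For $\lambda\in\mathbb{C}\setminus\{0\}$ let $$c_1(\lambda)=\tfrac12\sqrt{-a^2-4\lambda^4-4\lambda^2(c^2-a)},$$ and for $C=\pm c_1(\lambda)$ let $$u_\pm(x,t,\lambda)=e^{C(x+2\lambda^2t+(a-c^2)t)+\frac{\mathrm{i}}{2}\theta},\qquad v_\pm(x,t,\lambda)=\frac{\mathrm{i}a-2\mathrm{i}\lambda^2+2C}{2\lambda c}\,e^{C(x+2\lambda^2t+(a-c^2)t)-\frac{\mathrm{i}}{2}\theta}.$$ Define the eigenfunction $\Psi=(f,g)^{T}$ by $$f(x,t,\lambda)=\sum_{\pm}\big(u_\pm(x,t,\lambda)+v_\pm(x,t,-\lambda^*)^*\big),\qquad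 g(x,t,\lambda)=\sum_{\pm}\big(v_\pm(x,t,\lambda)+u_\pm(x,t,-\lambda^*)^*\big).$$ It does not depend on the choice of the square root. Let $\lambda_1=\frac12\sqrt{2a-c^2}-\frac12\mathrm{i}c$ and $\lambda_2=-\lambda_1^*$, and for $i\in\{1,2\}$ and $j,m\ge 0$ let $$f[i,j,m]=\frac1{m!}\frac{\partial^m(\lambda^jf)}{\partial\lambda^m}\Big|_{\lambda=\lambda_i},\qquad g[i,j,m]=\frac1{m!}\frac{\partial^m(\lambda^jg)}{\partial\lambda^m}\Big|_{\lambda=\lambda_i}.$$ Let $\delta_{11},\delta_{12},\delta_{21}$ be the $n\times n$ determinants whose rows are indexed, in this order, by $(i,m)=(1,1),(2,1),(1,2),(2,2),\dots,(1,k),(2,k)$, with rows $$\delta_{11}:\ \big(g[i,n-1,m],\,f[i,n-2,m],\,g[i,n-3,m],\dots,g[i,1,m],\,f[i,0,m]\big),$$ $$\delta_{12}:\ \big(f[i,n,m],\,f[i,n-2,m],\,g[i,n-3,m],\dots,g[i,1,m],\,f[i,0,m]\big),$$ $$\delta_{21}:\ \big(f[i,n-1,m],\,g[i,n-2,m],\,f[i,n-3,m],\dots,f[i,1,m],\,g[i,0,m]\big).$$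 Then: 1. $c_1(\lambda_1)=c_1(\lambda_2)=0$, and the order-$0$ terms vanish: $f[i,j,0]=g[i,j,0]=0$ for $i=1,2$ and all $j\ge 0$, $x,t\in\mathbb{R}$. 2. $\delta_{21}(x,t)\ne 0$ for all $(x,t)\in\mathbb{R}^2$, and $$q^{[n]}=\frac{\delta_{11}^2}{\delta_{21}^2}\,q+2\mathrm{i}\,\frac{\delta_{11}\delta_{12}}{\delta_{21}^2}$$ is a rogue wave solution of the DNLS equation: it is a smooth solution on all of $\mathbb{R}^2$, it is localized in space and time, i.e. $|q^{[n]}(x,t)|\to|c|$ as $|(x,t)|\to\infty$, and it has a single dominant peak, i.e. there is a point at which $|q^{[n]}|$ exceeds $|c|$ and is strictly larger than at every other point of the plane. 3. It is of order $k$, that is, it is the $k$-fold Darboux transform of the seed at the single eigenvalue $\lambda_1$, in the following sense. For $\mu_1,\dots,\mu_k\in\mathbb{C}$ put $\lambda_{2l-1}=\mu_l$, $(f_{2l-1},g_{2l-1})=(f,g)(x,t,\mu_l)$, $\lambda_{2l}=-\mu_l^*$, $(f_{2l},g_{2l})=(g_{2l-1}^*,f_{2l-1}^*)$, let $\Omega_{11},\Omega_{12},\Omega_{21}$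 be the $n\times n$ determinants obtained from $\delta_{11},\delta_{12},\delta_{21}$ by replacing the rows by those for $r=1,\dots,n$ with $\lambda_r^jf_r$, $\lambda_r^jg_r$ in place of $f[i,j,m]$, $g[i,j,m]$, and let $Q_{\mu_1,\dots,\mu_k}=\frac{\Omega_{11}^2}{\Omega_{21}^2}q+2\mathrm{i}\frac{\Omega_{11}\Omega_{12}}{\Omega_{21}^2}$. Then for all pairwise distinct nonzero $d_1,\dots,d_k\in\mathbb{C}$ and all $(x,t)\in\mathbb{R}^2$, $$q^{[n]}(x,t)=\lim_{\substack{\epsilon\to0\\ \epsilon\in\mathbb{C}\setminus\{0\}}}Q_{\lambda_1+d_1\epsilon,\dots,\lambda_1+d_k\epsilon}(x,t).$$ -/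

import Mathlib

namespace DNLS

open Complex ComplexConjugate Filter Topology

noncomputable section

/-! ### The equation and rogue waves -/

/-- `q = q(x, t)` is a smooth solution on the whole `(x, t)`-plane of the derivative nonlinear
Schrödinger equation `i q_t - q_xx + i (|q|² q)_x = 0`. -/
def IsSolution (q : ℝ → ℝ → ℂ) : Prop :=
  ContDiff ℝ (⊤ : ℕ∞) (Function.uncurry q) ∧
  ∀ x t : ℝ,
    I * deriv (fun s => q x s) t - iteratedDeriv 2 (fun y => q y t) x
      + I * deriv (fun y => ((‖q y t‖ ^ 2 : ℝ) : ℂ) * q y t) x = 0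

/-- A rogue wave on a background of constant amplitude `A`: a global smooth solution of the
equation which is localized in both space and time (away from compact parts of the plane it
returns to the background amplitude) and which exhibits one dominant peak. -/
structure IsRogueWave (A : ℝ) (q : ℝ → ℝ → ℂ) : Prop where
  solution : IsSolution q
  localized : Tendsto (fun p : ℝ × ℝ => ‖q p.1 p.2‖) (cocompact (ℝ × ℝ)) (𝓝 A)
  dominant_peak : ∃ p₀ : ℝ × ℝ, A < ‖q p₀.1 p₀.2‖ ∧
    ∀ p : ℝ × ℝ, p ≠ p₀ → ‖q p.1 p.2‖ < ‖q p₀.1 p₀.2‖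

/-! ### The periodic seed and its eigenfunction -/

/-- The periodic seed `q = c exp(i (a x + b t))` with `b = a (a - c²)`. -/
def seed (a c x t : ℝ) : ℂ :=
  c * exp (I * (a * x + a * (a - c ^ 2) * t))

/-- `c₁(λ) = √(-a² - 4 λ⁴ - 4 λ² (c² - a)) / 2`. -/
def c1 (a c : ℝ) (l : ℂ) : ℂ :=
  Complex.sqrt (-(a : ℂ) ^ 2 - 4 * l ^ 4 - 4 * l ^ 2 * (c ^ 2 - a)) / 2

/-- First component of the elementary solution of the spectral problem with exponent `C`. -/
def omegaFst (a c x t : ℝ) (l C : ℂ) : ℂ :=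
  exp (C * (x + 2 * l ^ 2 * t + (a - c ^ 2) * t) + I * (a * x + a * (a - c ^ 2) * t) / 2)

/-- Second component of the elementary solution of the spectral problem with exponent `C`. -/
def omegaSnd (a c x t : ℝ) (l C : ℂ) : ℂ :=
  (I * a - 2 * I * l ^ 2 + 2 * C) / (2 * l * c) *
    exp (C * (x + 2 * l ^ 2 * t + (a - c ^ 2) * t) - I * (a * x + a * (a - c ^ 2) * t) / 2)

/-- First component of the eigenfunction: the two elementary solutions `ω¹` (exponent `c₁`) and
`ω²` (exponent `-c₁`) superposed, with coefficients `D₁ = D₂ = 1`, with their images under the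
symmetry `(u, v)(λ) ↦ (v*, u*)(-λ*)` of the spectral problem. -/
def eigF (a c x t : ℝ) (l : ℂ) : ℂ :=
  omegaFst a c x t l (c1 a c l) + omegaFst a c x t l (-c1 a c l)
    + conj (omegaSnd a c x t (-conj l) (c1 a c (-conj l)))
    + conj (omegaSnd a c x t (-conj l) (-c1 a c (-conj l)))

/-- Second component of the eigenfunction. -/
def eigG (a c x t : ℝ) (l : ℂ) : ℂ :=
  omegaSnd a c x t l (c1 a c l) + omegaSnd a c x t l (-c1 a c l)
    + conj (omegaFst a c x t (-conj l) (c1 a c (-conj l)))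
    + conj (omegaFst a c x t (-conj l) (-c1 a c (-conj l)))

/-- `λ₁ = ½ √(2a - c²) - ½ i c`. -/
def lam1 (a c : ℝ) : ℂ := (Real.sqrt (2 * a - c ^ 2) : ℂ) / 2 - I * c / 2

/-- `λ₂ = -λ₁*`. -/
def lam2 (a c : ℝ) : ℂ := -conj (lam1 a c)

/-! ### Determinants -/

/-- The three `n × n` determinants entering the formula, for rows indexed by `r = 0, …, n - 1`,
where `F r j` and `G r j` are the entries standing for `λʲ f` and `λʲ g` in row `r`.
Columns carry the exponents `j = n-1, n-2, …, 1, 0` from left to right. For even `n`: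
`det11` has `g` at odd and `f` at even exponents. -/
def det11 (n : ℕ) (F G : ℕ → ℕ → ℂ) : ℂ :=
  Matrix.det (Matrix.of fun r s : Fin n =>
    if Odd (n - 1 - (s : ℕ)) then G r (n - 1 - s) else F r (n - 1 - s))

/-- As `det11`, but with the first column replaced by `f` at the exponent `n`. -/
def det12 (n : ℕ) (F G : ℕ → ℕ → ℂ) : ℂ :=
  Matrix.det (Matrix.of fun r s : Fin n =>
    if (s : ℕ) = 0 then F r n
    else if Odd (n - 1 - (s : ℕ)) then G r (n - 1 - s) else F r (n - 1 - s))

/-- As `det11`, but with `f` at odd and `g` at even exponents. -/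
def det21 (n : ℕ) (F G : ℕ → ℕ → ℂ) : ℂ :=
  Matrix.det (Matrix.of fun r s : Fin n =>
    if Odd (n - 1 - (s : ℕ)) then F r (n - 1 - s) else G r (n - 1 - s))

/-- `(D₁₁² / D₂₁²) q + 2 i D₁₁ D₁₂ / D₂₁²`. -/
def newPotential (q D11 D12 D21 : ℂ) : ℂ :=
  D11 ^ 2 / D21 ^ 2 * q + 2 * I * (D11 * D12 / D21 ^ 2)

/-! ### The `k`-fold Darboux transformation at distinct eigenvalues -/

/-- Entries `λ_{r+1}ʲ f_{r+1}`, where `λ_{2l+1} = μ l`, `Ψ_{2l+1} = (f, g)(μ l)`,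
`λ_{2l+2} = -(μ l)*` and `Ψ_{2l+2} = (g*, f*)(μ l)`. -/
def darbouxF (a c x t : ℝ) (μ : ℕ → ℂ) (r j : ℕ) : ℂ :=
  if Even r then μ (r / 2) ^ j * eigF a c x t (μ (r / 2))
  else (-conj (μ (r / 2))) ^ j * conj (eigG a c x t (μ (r / 2)))

/-- Entries `λ_{r+1}ʲ g_{r+1}`. -/
def darbouxG (a c x t : ℝ) (μ : ℕ → ℂ) (r j : ℕ) : ℂ :=
  if Even r then μ (r / 2) ^ j * eigG a c x t (μ (r / 2))
  else (-conj (μ (r / 2))) ^ j * conj (eigF a c x t (μ (r / 2)))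

/-- The `k`-fold Darboux transform of the seed, in determinant form, generated by the
eigenvalues `μ 0, …, μ (k - 1)` and their partners `-(μ l)*`. -/
def darbouxSolution (a c : ℝ) (k : ℕ) (μ : ℕ → ℂ) (x t : ℝ) : ℂ :=
  newPotential (seed a c x t)
    (det11 (2 * k) (darbouxF a c x t μ) (darbouxG a c x t μ))
    (det12 (2 * k) (darbouxF a c x t μ) (darbouxG a c x t μ))
    (det21 (2 * k) (darbouxF a c x t μ) (darbouxG a c x t μ))

/-! ### The formula at the single eigenvalue `λ₁` -/

/-- The Taylor coefficient `(1 / m!) ∂ᵐ (λʲ φ(λ)) / ∂λᵐ` at `λ = l`. -/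
def taylorCoeff (φ : ℂ → ℂ) (l : ℂ) (j m : ℕ) : ℂ :=
  iteratedDeriv m (fun z => z ^ j * φ z) l / (m.factorial : ℂ)

/-- Rows are ordered as `(i, m) = (1,1), (2,1), (1,2), (2,2), …, (1,k), (2,k)`;
this is the entry `f[i, j, m]` of row `r`. -/
def entryF (a c x t : ℝ) (r j : ℕ) : ℂ :=
  taylorCoeff (eigF a c x t) (if Even r then lam1 a c else lam2 a c) j (r / 2 + 1)

/-- The entry `g[i, j, m]` of row `r`. -/
def entryG (a c x t : ℝ) (r j : ℕ) : ℂ :=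
  taylorCoeff (eigG a c x t) (if Even r then lam1 a c else lam2 a c) j (r / 2 + 1)

/-- `δ₁₁` with `n = 2k`. -/
def delta11 (a c : ℝ) (k : ℕ) (x t : ℝ) : ℂ :=
  det11 (2 * k) (entryF a c x t) (entryG a c x t)

/-- `δ₁₂` with `n = 2k`. -/
def delta12 (a c : ℝ) (k : ℕ) (x t : ℝ) : ℂ :=
  det12 (2 * k) (entryF a c x t) (entryG a c x t)

/-- `δ₂₁` with `n = 2k`. -/
def delta21 (a c : ℝ) (k : ℕ) (x t : ℝ) : ℂ :=
  det21 (2 * k) (entryF a c x t) (entryG a c x t)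

/-- `q^{[2k]} = (δ₁₁² / δ₂₁²) q + 2 i δ₁₁ δ₁₂ / δ₂₁²`. -/
def rogueWave (a c : ℝ) (k : ℕ) (x t : ℝ) : ℂ :=
  newPotential (seed a c x t) (delta11 a c k x t) (delta12 a c k x t) (delta21 a c k x t)

end

end DNLS

/-! Write T = x + 2λ²t + (a - c²)t, `quadP` = (λ - λ₁)(λ - λ₂) and `quadM` for its reflection λ ↦
-λ. Since c₁² = -`quadP`·`quadM`, the eigenfunction has a closed form f = κ e^{iθ/2}(A + B), g = κ
e^{-iθ/2}(A - B), where A = cosh(c₁T), B = i·`quadM`·T·sinh(c₁T)/(c₁T) are entire in λ and κ has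
simple zeros at λ₁, λ₂ (`eigF_eq`, `eigG_eq`). Hence the order-0 terms vanish, and a linear relation
between columns of Taylor coefficients says that P(A + B) + R(A - B) is divisible by `quadP`^k, with
P, R polynomials of opposite parity (`annihilates_iff`). Modulo `quadP`^k the functions A and B may
be replaced by polynomials.

The symmetry p(λ) ↦ p(-λ*)* and the coprimality of A with `quadP` force PP* + RR* to be divisible by
(`quadP`·`quadM`)^k, where * conjugates coefficients. On the real line PP* + RR* is |P|² + |R|², so
annihilators of degree below 2k vanish: both δ₁₁ and δ₂₁ are nonzero everywhere. There is a unique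
annihilator with P even and monic of degree 2k and R odd of smaller degree; Cramer's rule gives
q^{[2k]} = (P(0)*/P(0)) e^{iθ}(c - 2i r), with r the coefficient of λ^{2k-1} in R
(`IsMonicAnnihilator.rogueWave_eq`).

Equation: the coefficients of P and R are smooth in (x, t). Differentiating the divisibility
relation with the linear flows of A ± B yields new annihilators; corrected by multiples of (P, R)
and (-R*, P*), they satisfy the normalization that forces them to be zero. The resulting identities
are a Lax pair for the new potential, and its compatibility at lowest order in λ is the DNLS
equation in conservation form.

Peak: annihilators of consecutive orders differ by a quadratic factor (U, V) with UU* + VV* =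
`quadP`·`quadM`, which bounds the change of r by |c|. Thus |q^{[2k]}| ≤ (2k+1)|c|, with equality at
the origin, where P + R = `quadP`^k; equality in the first step already forces x = t = 0.

Localization: the norm identity bounds P and R uniformly, so they converge along ultrafilters going
to infinity. Rescaling λ near λᵢ by T⁻² turns the divisibility into a linear system whose limit is
invertible by a Padé-type argument for the exponential. Consequently P - R tends to
`quadP`^⌈k/2⌉·`quadM`^⌊k/2⌋, and the limiting amplitude is ±c.

Order k: rows at λ₁ + d_l ε are, up to higher order in ε, a fixed interlaced Vandermonde matrix
times powers of ε times the Taylor rows. The determinant of this factor is common to the three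
determinants and cancels in q (`tendsto_confluent_det`). -/

namespace DNLS

open Polynomial ComplexConjugate

noncomputable section

/-! ### The polynomial data of the eigenfunction -/

section Symbols

variable (R : Type*) [CommRing R] [Algebra ℂ R]

/-- `(X - λ₁) (X - λ₂)`. -/
def quadP (a c : ℝ) : R[X] :=
  X ^ 2 + C (algebraMap ℂ R (Complex.I * c)) * X - C (algebraMap ℂ R (a / 2))

/-- `(X + λ₁) (X + λ₂)`. -/
def quadM (a c : ℝ) : R[X] :=
  X ^ 2 - C (algebraMap ℂ R (Complex.I * c)) * X - C (algebraMap ℂ R (a / 2))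

variable {R}

/-- The phase `x + 2 λ² t + (a - c²) t` as a polynomial in `λ`. -/
def phase (a c : ℝ) (x t : R) : R[X] :=
  C x + (2 * X ^ 2 + C (algebraMap ℂ R (a - c ^ 2))) * C t

/-- The square of the exponent `c₁(λ) (x + 2 λ² t + (a - c²) t)`. -/
def sqExp (a c : ℝ) (x t : R) : R[X] :=
  -(quadP R a c * quadM R a c * phase a c x t ^ 2)

/-- Truncation of `cosh √w`. -/
def coshTrunc (K : ℕ) (w : R[X]) : R[X] :=
  ∑ m ∈ Finset.range (K + 1), C (algebraMap ℂ R (1 / ((2 * m).factorial : ℂ))) * w ^ m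

/-- Truncation of `sinh √w / √w`. -/
def sinhcTrunc (K : ℕ) (w : R[X]) : R[X] :=
  ∑ m ∈ Finset.range (K + 1), C (algebraMap ℂ R (1 / ((2 * m + 1).factorial : ℂ))) * w ^ m

/-- Even part of the truncated eigenfunction. -/
def partA (a c : ℝ) (K : ℕ) (x t : R) : R[X] := coshTrunc K (sqExp a c x t)

/-- Odd part of the truncated eigenfunction. -/
def partB (a c : ℝ) (K : ℕ) (x t : R) : R[X] :=
  C (algebraMap ℂ R Complex.I) * quadM R a c * phase a c x t * sinhcTrunc K (sqExp a c x t)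

variable {S : Type*} [CommRing S] [Algebra ℂ S] (f : R →ₐ[ℂ] S)

lemma map_quadP (a c : ℝ) : (quadP R a c).map (f : R →+* S) = quadP S a c := by
  simp [quadP]

lemma map_quadM (a c : ℝ) : (quadM R a c).map (f : R →+* S) = quadM S a c := by
  simp [quadM]

lemma map_phase (a c : ℝ) (x t : R) :
    (phase a c x t).map (f : R →+* S) = phase a c (f x) (f t) := by
  simp [phase]

lemma map_sqExp (a c : ℝ) (x t : R) :
    (sqExp a c x t).map (f : R →+* S) = sqExp a c (f x) (f t) := by
  simp only [sqExp, Polynomial.map_neg, Polynomial.map_mul, Polynomial.map_pow, map_quadP,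
    map_quadM, map_phase]

lemma map_partA (a c : ℝ) (K : ℕ) (x t : R) :
    (partA a c K x t).map (f : R →+* S) = partA a c K (f x) (f t) := by
  simp only [partA, coshTrunc, Polynomial.map_sum, Polynomial.map_mul, Polynomial.map_pow,
    map_sqExp, Polynomial.map_C]
  simp

lemma map_partB (a c : ℝ) (K : ℕ) (x t : R) :
    (partB a c K x t).map (f : R →+* S) = partB a c K (f x) (f t) := by
  simp only [partB, sinhcTrunc, Polynomial.map_sum, Polynomial.map_mul, Polynomial.map_pow,
    map_sqExp, Polynomial.map_C, map_quadM, map_phase]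
  simp

lemma natDegree_quadP [Nontrivial R] (a c : ℝ) : (quadP R a c).natDegree = 2 := by
  rw [quadP]; compute_degree!

lemma natDegree_quadM [Nontrivial R] (a c : ℝ) : (quadM R a c).natDegree = 2 := by
  rw [quadM]; compute_degree!

lemma monic_quadP (a c : ℝ) : (quadP R a c).Monic := by
  nontriviality R
  have h : (quadP R a c).coeff 2 = 1 := by simp [quadP]
  rw [Monic, leadingCoeff, natDegree_quadP, h]

lemma monic_quadM (a c : ℝ) : (quadM R a c).Monic := by
  nontriviality R
  have h : (quadM R a c).coeff 2 = 1 := by simp [quadM]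
  rw [Monic, leadingCoeff, natDegree_quadM, h]

/-- This is why truncation is harmless: the terms dropped from cosh √w and sinh √w / √w carry a high
power of w, hence of `quadP`. -/
lemma quadP_dvd_sqExp (a c : ℝ) (x t : R) : quadP R a c ∣ sqExp a c x t :=
  ⟨-(quadM R a c * phase a c x t ^ 2), by rw [sqExp]; ring⟩

lemma dvd_coshTrunc_sub_one (K : ℕ) (w : R[X]) : w ∣ coshTrunc K w - 1 := by
  rw [coshTrunc, Finset.sum_range_succ']
  simp only [pow_succ, ← mul_assoc]
  simp only [← Finset.sum_mul]
  simp

lemma dvd_sinhcTrunc_sub_one (K : ℕ) (w : R[X]) : w ∣ sinhcTrunc K w - 1 := by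
  rw [sinhcTrunc, Finset.sum_range_succ']
  simp only [pow_succ, ← mul_assoc]
  simp only [← Finset.sum_mul]
  simp

end Symbols

/-! ### Conjugation and reflection of polynomials -/

/-- Conjugation of the coefficients. -/
def conjP : ℂ[X] →+* ℂ[X] := mapRingHom (starRingEnd ℂ)

/-- The substitution `X ↦ -X`. -/
def reflP : ℂ[X] →+* ℂ[X] := compRingHom (-X)

/-- `p ↦ (z ↦ p(-z*)*)`. -/
def sharpP : ℂ[X] →+* ℂ[X] := reflP.comp conjP

@[simp] lemma conjP_C (z : ℂ) : conjP (C z) = C (conj z) := by simp [conjP]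
@[simp] lemma conjP_X : conjP X = X := by simp [conjP]
@[simp] lemma reflP_C (z : ℂ) : reflP (C z) = C z := by simp [reflP]
@[simp] lemma reflP_X : reflP X = -X := by simp [reflP]
@[simp] lemma coeff_conjP (p : ℂ[X]) (m : ℕ) : (conjP p).coeff m = conj (p.coeff m) := by
  simp [conjP, coeff_map]
@[simp] lemma natDegree_conjP (p : ℂ[X]) : (conjP p).natDegree = p.natDegree := by
  simp [conjP]

@[simp] lemma coeff_reflP (p : ℂ[X]) (m : ℕ) : (reflP p).coeff m = (-1) ^ m * p.coeff m := by
  have : (-X : ℂ[X]) = C (-1) * X := by simp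
  simp only [reflP, coe_compRingHom, this, comp_C_mul_X_coeff]
  ring

lemma conjP_conjP (p : ℂ[X]) : conjP (conjP p) = p := by
  ext; simp

lemma reflP_reflP (p : ℂ[X]) : reflP (reflP p) = p := by
  ext m; simp [← mul_assoc, ← mul_pow]

lemma reflP_conjP (p : ℂ[X]) : reflP (conjP p) = conjP (reflP p) := by
  ext m; simp

lemma eval_conjP_ofReal (p : ℂ[X]) (r : ℝ) : (conjP p).eval (r : ℂ) = conj (p.eval (r : ℂ)) := by
  have := Polynomial.eval_map_apply (f := starRingEnd ℂ) (p := p) (r : ℂ)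
  simpa [conjP] using this

lemma sharpP_of_even {p : ℂ[X]} (hp : reflP p = p) : sharpP p = conjP p := by
  simp [sharpP, reflP_conjP, hp]

lemma sharpP_of_odd {p : ℂ[X]} (hp : reflP p = -p) : sharpP p = -conjP p := by
  simp [sharpP, reflP_conjP, hp]

section Fixed

variable (a c : ℝ) (K : ℕ) (x t : ℝ)

lemma reflP_quadP : reflP (quadP ℂ a c) = quadM ℂ a c := by simp [quadP, quadM]; ring
lemma reflP_quadM : reflP (quadM ℂ a c) = quadP ℂ a c := by
  rw [← reflP_quadP, reflP_reflP]
lemma conjP_quadP : conjP (quadP ℂ a c) = quadM ℂ a c := by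
  ext m; simp [quadP, quadM]
  rcases m with _ | _ | _ | m <;> simp [coeff_X, coeff_C, map_ofNat]
lemma conjP_quadM : conjP (quadM ℂ a c) = quadP ℂ a c := by
  rw [← conjP_quadP, conjP_conjP]
lemma sharpP_quadP : sharpP (quadP ℂ a c) = quadP ℂ a c := by
  simp [sharpP, conjP_quadP, reflP_quadM]
lemma sharpP_quadM : sharpP (quadM ℂ a c) = quadM ℂ a c := by
  simp [sharpP, conjP_quadM, reflP_quadP]
lemma sharpP_C (z : ℂ) : sharpP (C z) = C (conj z) := by simp [sharpP]
lemma sharpP_X : sharpP X = -X := by simp [sharpP]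

lemma sharpP_phase : sharpP (phase a c (x : ℂ) (t : ℂ)) = phase a c (x : ℂ) (t : ℂ) := by
  simp [phase, sharpP_C, sharpP_X, map_ofNat]

lemma sharpP_sqExp : sharpP (sqExp a c (x : ℂ) (t : ℂ)) = sqExp a c (x : ℂ) (t : ℂ) := by
  simp only [sqExp, map_neg, map_mul, map_pow, sharpP_quadP, sharpP_quadM, sharpP_phase]

lemma sharpP_partA : sharpP (partA a c K (x : ℂ) (t : ℂ)) = partA a c K (x : ℂ) (t : ℂ) := by
  simp [partA, coshTrunc, sharpP_sqExp, sharpP_C]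

/-- All factors are fixed except the constant i, which conjugation negates. The symmetry therefore
exchanges A + B and A - B. -/
lemma sharpP_partB : sharpP (partB a c K (x : ℂ) (t : ℂ)) = -partB a c K (x : ℂ) (t : ℂ) := by
  simp [partB, sinhcTrunc, sharpP_sqExp, sharpP_C, sharpP_quadM, sharpP_phase]

/-- A ≡ 1 modulo `quadP`, because its argument is divisible by `quadP` and its constant term is 1.
-/
lemma isCoprime_quadP_partA (k : ℕ) :
    IsCoprime (quadP ℂ a c ^ k) (partA a c K (x : ℂ) (t : ℂ)) := by
  apply IsCoprime.pow_left
  obtain ⟨u, hu⟩ := (quadP_dvd_sqExp a c (x : ℂ) (t : ℂ)).trans (dvd_coshTrunc_sub_one K _)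
  exact ⟨-u, 1, by rw [partA]; linear_combination hu⟩

variable {a c}

lemma isCoprime_quadP_quadM (hc : c ≠ 0) (ha : a ≠ 0) :
    IsCoprime (quadP ℂ a c) (quadM ℂ a c) := by
  have hc' : (c : ℂ) ≠ 0 := by exact_mod_cast hc
  have ha' : (a : ℂ) ≠ 0 := by exact_mod_cast ha
  have h1 : (C (1 / (a * Complex.I * c)) : ℂ[X]) * C (2 * (Complex.I * c)) = C (2 / a : ℂ) := by
    rw [← C_mul]; congr 1; field_simp
  have h2 : (C (2 / a : ℂ) : ℂ[X]) * C (a / 2 : ℂ) = 1 := by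
    rw [← C_mul, ← C_1]; congr 1; field_simp
  -- The Bézout coefficients come from `quadP` - `quadM` = 2icX and X(X + ic) = `quadP` + a/2.
  refine ⟨C (1 / (a * Complex.I * c)) * (X + C (Complex.I * c)) - C (2 / a : ℂ),
    -(C (1 / (a * Complex.I * c)) * (X + C (Complex.I * c))), ?_⟩
  have h3 : (C (2 * (Complex.I * c)) : ℂ[X]) = 2 * C (Complex.I * c) := by
    rw [C_mul]; rfl
  rw [h3] at h1
  simp only [quadP, quadM, Algebra.algebraMap_self, RingHom.id_apply]
  linear_combination (X ^ 2 + C (Complex.I * c) * X) * h1 + h2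

/-- Reflection swaps `quadP` and `quadM`, so a polynomial of definite parity inherits divisibility
by the other factor, and the two are coprime. -/
lemma pow_mul_dvd_of_even (hc : c ≠ 0) (ha : a ≠ 0) {k : ℕ} {D : ℂ[X]}
    (hD : reflP D = D ∨ reflP D = -D) (h : quadP ℂ a c ^ k ∣ D) :
    (quadP ℂ a c * quadM ℂ a c) ^ k ∣ D := by
  rw [mul_pow]
  refine IsCoprime.mul_dvd (isCoprime_quadP_quadM hc ha).pow h ?_
  have := map_dvd reflP h
  rw [map_pow, reflP_quadP] at this
  rcases hD with e | e <;> rw [e] at this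
  · exact this
  · exact (dvd_neg.mp this)

/-! ### Annihilators of the eigenfunction -/

variable (a c) in
/-- `P f + R g` vanishes to order `k` at `λ₁` and `λ₂`, up to the common factor of `f` and `g`. -/
def Annihilates (k : ℕ) (P R : ℂ[X]) : Prop :=
  quadP ℂ a c ^ k ∣ P * (partA a c K (x : ℂ) (t : ℂ) + partB a c K (x : ℂ) (t : ℂ))
    + R * (partA a c K (x : ℂ) (t : ℂ) - partB a c K (x : ℂ) (t : ℂ))

variable {K x t} {k : ℕ} {P R : ℂ[X]}

lemma Annihilates.sharp (h : Annihilates a c K x t k P R) :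
    Annihilates a c K x t k (sharpP R) (sharpP P) := by
  have := map_dvd sharpP h
  simp only [map_pow, map_add, map_mul, map_sub, sharpP_quadP, sharpP_partA, sharpP_partB] at this
  refine this.trans (dvd_of_eq ?_)
  ring

/-- Adding the two relations leaves 2UA, and A is coprime to `quadP`. -/
lemma Annihilates.dvd_of_mul {U : ℂ[X]}
    (h1 : quadP ℂ a c ^ k ∣ U * (partA a c K (x : ℂ) (t : ℂ) + partB a c K (x : ℂ) (t : ℂ)))
    (h2 : quadP ℂ a c ^ k ∣ U * (partA a c K (x : ℂ) (t : ℂ) - partB a c K (x : ℂ) (t : ℂ))) :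
    quadP ℂ a c ^ k ∣ U := by
  have h : quadP ℂ a c ^ k ∣ C 2 * (U * partA a c K (x : ℂ) (t : ℂ)) := by
    refine (dvd_add h1 h2).trans (dvd_of_eq ?_)
    rw [show (C 2 : ℂ[X]) = 2 from rfl]; ring
  rw [dvd_C_mul (by norm_num)] at h
  exact (isCoprime_quadP_partA a c K x t k).dvd_of_dvd_mul_right h

/-- The relation and its image under the symmetry are two linear equations in A + B and A - B;
eliminating either unknown produces the determinant of the system. -/
lemma Annihilates.dvd_det (h : Annihilates a c K x t k P R) :
    quadP ℂ a c ^ k ∣ P * sharpP P - R * sharpP R := by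
  have h' := h.sharp
  refine Annihilates.dvd_of_mul (K := K) (x := x) (t := t) ?_ ?_
  · refine (dvd_sub (h.mul_left (sharpP P)) (h'.mul_left R)).trans (dvd_of_eq ?_)
    ring
  · refine (dvd_sub (h'.mul_left P) (h.mul_left (sharpP R))).trans (dvd_of_eq ?_)
    ring

/-- `P` and `R` have opposite parities, `P` even. -/
def EvenOdd (P R : ℂ[X]) : Prop := reflP P = P ∧ reflP R = -R

/-- On polynomials of definite parity the symmetry is conjugation of coefficients up to a sign, and
the opposite parities turn the difference in `dvd_det` into a sum of squares. -/
lemma EvenOdd.dvd_norm (hc : c ≠ 0) (ha : a ≠ 0) (hp : EvenOdd P R)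
    (h : Annihilates a c K x t k P R) :
    (quadP ℂ a c * quadM ℂ a c) ^ k ∣ P * conjP P + R * conjP R := by
  have h1 := h.dvd_det
  rw [sharpP_of_even hp.1, sharpP_of_odd hp.2] at h1
  refine pow_mul_dvd_of_even hc ha (Or.inl ?_) (h1.trans (dvd_of_eq (by ring)))
  simp [reflP_conjP, hp.1, hp.2]

lemma OddEven.dvd_norm (hc : c ≠ 0) (ha : a ≠ 0) (hp : EvenOdd R P)
    (h : Annihilates a c K x t k P R) :
    (quadP ℂ a c * quadM ℂ a c) ^ k ∣ P * conjP P + R * conjP R := by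
  have h1 := h.dvd_det
  rw [sharpP_of_even hp.1, sharpP_of_odd hp.2] at h1
  refine pow_mul_dvd_of_even hc ha (Or.inl ?_) ((dvd_neg.mpr h1).trans (dvd_of_eq (by ring)))
  simp [reflP_conjP, hp.1, hp.2]

/-- At a real point the hypothesis reads |P|² + |R|² = 0, and a polynomial with infinitely many
roots is zero. -/
lemma eq_zero_of_norm_eq_zero (h : P * conjP P + R * conjP R = 0) : P = 0 ∧ R = 0 := by
  have key : ∀ r : ℝ, P.eval (r : ℂ) = 0 ∧ R.eval (r : ℂ) = 0 := fun r => by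
    have := congrArg (eval (r : ℂ)) h
    simp only [eval_add, eval_mul, eval_conjP_ofReal, Complex.mul_conj, eval_zero] at this
    have h2 : Complex.normSq (P.eval (r : ℂ)) + Complex.normSq (R.eval (r : ℂ)) = 0 := by
      exact_mod_cast this
    have h3 := Complex.normSq_nonneg (P.eval (r : ℂ))
    have h4 := Complex.normSq_nonneg (R.eval (r : ℂ))
    exact ⟨Complex.normSq_eq_zero.mp (by linarith), Complex.normSq_eq_zero.mp (by linarith)⟩
  have hinf : (Set.range ((↑) : ℝ → ℂ)).Infinite :=
    Set.infinite_range_of_injective Complex.ofReal_injective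
  constructor
  · refine eq_zero_of_infinite_isRoot _ (hinf.mono ?_)
    rintro _ ⟨r, rfl⟩; exact (key r).1
  · refine eq_zero_of_infinite_isRoot _ (hinf.mono ?_)
    rintro _ ⟨r, rfl⟩; exact (key r).2

lemma monic_quad_pow (k : ℕ) : ((quadP ℂ a c * quadM ℂ a c) ^ k).Monic :=
  ((monic_quadP a c).mul (monic_quadM a c)).pow k

lemma natDegree_quad_pow (k : ℕ) : ((quadP ℂ a c * quadM ℂ a c) ^ k).natDegree = 4 * k := by
  rw [natDegree_pow, (monic_quadP a c).natDegree_mul (monic_quadM a c), natDegree_quadP,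
    natDegree_quadM]
  ring

/-- The divisor already has degree 4k, so the quotient is a constant. -/
lemma norm_eq_C_mul {m : ℕ} (hP : P.natDegree ≤ m) (hR : R.natDegree ≤ m) (hm : 2 * m ≤ 4 * k)
    (h : (quadP ℂ a c * quadM ℂ a c) ^ k ∣ P * conjP P + R * conjP R) :
    P * conjP P + R * conjP R =
      C ((P * conjP P + R * conjP R).coeff (4 * k)) * (quadP ℂ a c * quadM ℂ a c) ^ k := by
  obtain ⟨u, hu⟩ := h
  have hd : (P * conjP P + R * conjP R).natDegree ≤ 4 * k := by
    refine (natDegree_add_le _ _).trans (max_le ?_ ?_) <;> refine natDegree_mul_le.trans ?_ <;>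
      rw [natDegree_conjP] <;> omega
  have hu0 : u.natDegree = 0 := by
    by_cases h0 : u = 0
    · simp [h0]
    have := hu ▸ hd
    rw [(monic_quad_pow k).natDegree_mul' h0, natDegree_quad_pow] at this
    omega
  rw [natDegree_eq_zero] at hu0
  obtain ⟨z, rfl⟩ := hu0
  have h1 := (monic_quad_pow (a := a) (c := c) k).coeff_natDegree
  rw [natDegree_quad_pow] at h1
  rw [hu, coeff_mul_C, h1, one_mul, mul_comm]

/-- There are no annihilators of degree below 2k: the constant of `norm_eq_C_mul` is a coefficient
beyond the degree. This is the source of every nonvanishing determinant below. -/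
lemma eq_zero_of_natDegree_lt {m : ℕ} (hP : P.natDegree ≤ m) (hR : R.natDegree ≤ m)
    (hm : m < 2 * k)
    (h : (quadP ℂ a c * quadM ℂ a c) ^ k ∣ P * conjP P + R * conjP R) : P = 0 ∧ R = 0 := by
  apply eq_zero_of_norm_eq_zero
  rw [norm_eq_C_mul hP hR (by omega) h, coeff_eq_zero_of_natDegree_lt, C_0, zero_mul]
  refine lt_of_le_of_lt (natDegree_add_le _ _) (max_lt ?_ ?_) <;>
    refine natDegree_mul_le.trans_lt ?_ <;> rw [natDegree_conjP] <;> omega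

lemma coeff_zero_of_odd (hR : reflP R = -R) : R.coeff 0 = 0 := by
  have := congrArg (fun p => p.coeff 0) hR
  simp only [coeff_reflP, pow_zero, one_mul, coeff_neg] at this
  linear_combination this / 2

/-- Uniqueness of annihilators normalized at `λ = 0`. -/
lemma EvenOdd.eq_zero_of_coeff_zero (hc : c ≠ 0) (ha : a ≠ 0) (hp : EvenOdd P R)
    (h : Annihilates a c K x t k P R) (hP : P.natDegree ≤ 2 * k) (hR : R.natDegree ≤ 2 * k)
    (h0 : P.coeff 0 = 0) : P = 0 ∧ R = 0 := by
  apply eq_zero_of_norm_eq_zero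
  have e := norm_eq_C_mul hP hR (by omega) (hp.dvd_norm hc ha h)
  have e0 := congrArg (fun p => p.coeff 0) e
  have h1 := coeff_zero_of_odd hp.2
  simp only [coeff_add, mul_coeff_zero, h0, h1, zero_mul, add_zero, coeff_C_zero] at e0
  -- The constant term is (a²/4)^k, so the vanishing of the left side at 0 forces the
  -- proportionality constant to vanish.
  have h2 : ((quadP ℂ a c * quadM ℂ a c) ^ k).coeff 0 ≠ 0 := by
    rw [coeff_zero_eq_eval_zero]
    simp [quadP, quadM, ha]
  rw [e, coeff_add, (mul_eq_zero.mp e0.symm).resolve_right h2, C_0, zero_mul]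

/-- Only PP* reaches degree 4k, with coefficient 1, which fixes the proportionality constant. -/
lemma EvenOdd.norm_eq (hc : c ≠ 0) (ha : a ≠ 0) (hp : EvenOdd P R)
    (h : Annihilates a c K x t k P R) (hP : P.natDegree ≤ 2 * k) (hP1 : P.coeff (2 * k) = 1)
    (hR : R.natDegree < 2 * k ∨ R = 0) :
    P * conjP P + R * conjP R = (quadP ℂ a c * quadM ℂ a c) ^ k := by
  have hR' : R.natDegree ≤ 2 * k := by
    rcases hR with h | h
    · exact h.le
    · simp [h]
  rw [norm_eq_C_mul hP hR' (by omega) (hp.dvd_norm hc ha h)]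
  have h1 : (P * conjP P).coeff (2 * k + 2 * k) = 1 := by
    rw [coeff_mul_add_eq_of_natDegree_le hP (by simpa using hP)]
    simp [hP1]
  have h2 : (R * conjP R).coeff (2 * k + 2 * k) = 0 := by
    rcases hR with h | h
    · apply coeff_eq_zero_of_natDegree_lt
      refine natDegree_mul_le.trans_lt ?_
      rw [natDegree_conjP]; omega
    · simp [h]
  rw [coeff_add, show 4 * k = 2 * k + 2 * k by ring, h1, h2]
  simp

lemma EvenOdd.sub {P' R' : ℂ[X]} (h : EvenOdd P R) (h' : EvenOdd P' R') :
    EvenOdd (P - P') (R - R') :=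
  ⟨by rw [map_sub, h.1, h'.1], by rw [map_sub, h.2, h'.2]; ring⟩

lemma Annihilates.sub {P' R' : ℂ[X]} (h : Annihilates a c K x t k P R)
    (h' : Annihilates a c K x t k P' R') : Annihilates a c K x t k (P - P') (R - R') :=
  (dvd_sub h h').trans (dvd_of_eq (by ring))

end Fixed

end

end DNLS

namespace DNLS

open Polynomial ComplexConjugate

noncomputable section

/-! ### The entire functions behind `cosh √w` and `sinh √w / √w` -/

/-- `∑ₘ wᵐ / (2 m + j)!`. -/
def cseries (j : ℕ) (w : ℂ) : ℂ := ∑' m : ℕ, w ^ m / ((2 * m + j).factorial : ℂ)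

lemma norm_cseries_term_le (j m : ℕ) (w : ℂ) :
    ‖w ^ m / ((2 * m + j).factorial : ℂ)‖ ≤ ‖w‖ ^ m / (m.factorial : ℝ) := by
  rw [norm_div, norm_pow, Complex.norm_natCast]
  have : (m.factorial : ℝ) ≤ ((2 * m + j).factorial : ℝ) := by
    exact_mod_cast Nat.factorial_le (by omega)
  gcongr

lemma summable_cseries (j : ℕ) (w : ℂ) :
    Summable fun m : ℕ => w ^ m / ((2 * m + j).factorial : ℂ) :=
  Summable.of_norm_bounded (Real.summable_pow_div_factorial ‖w‖) (norm_cseries_term_le j · w)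

lemma differentiable_cseries (j : ℕ) : Differentiable ℂ (cseries j) := by
  intro w
  have h : DifferentiableOn ℂ (cseries j) (Metric.ball 0 (‖w‖ + 1)) := by
    refine Complex.differentiableOn_tsum_of_summable_norm
      (Real.summable_pow_div_factorial (‖w‖ + 1)) (fun m => by fun_prop) Metric.isOpen_ball ?_
    intro m z hz
    refine (norm_cseries_term_le j m z).trans ?_
    have : ‖z‖ ≤ ‖w‖ + 1 := by simpa using (mem_ball_zero_iff.mp hz).le
    gcongr
  exact h.differentiableAt (Metric.isOpen_ball.mem_nhds (by simp))

lemma cseries_eq (j : ℕ) (w : ℂ) :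
    cseries j w = 1 / (j.factorial : ℂ) + w * cseries (j + 2) w := by
  rw [cseries, (summable_cseries j w).tsum_eq_zero_add, cseries, ← tsum_mul_left]
  congr 1
  · simp
  · congr 1; ext m
    rw [show 2 * (m + 1) + j = 2 * m + (j + 2) by ring]; ring

lemma cosh_eq_cseries (z : ℂ) : Complex.cosh z = cseries 0 (z ^ 2) := by
  rw [← (Complex.hasSum_cosh z).tsum_eq, cseries]
  simp [pow_mul]

lemma sinh_eq_cseries (z : ℂ) : Complex.sinh z = z * cseries 1 (z ^ 2) := by
  rw [← (Complex.hasSum_sinh z).tsum_eq, cseries, ← tsum_mul_left]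
  congr 1; ext m; rw [pow_succ, pow_mul]; ring

/-- An exact remainder with an entire cofactor, so that the truncation error has a visible order of
vanishing. -/
lemma cseries_eq_sum (j K : ℕ) (w : ℂ) :
    cseries j w = ∑ m ∈ Finset.range (K + 1), 1 / ((2 * m + j).factorial : ℂ) * w ^ m
      + w ^ (K + 1) * cseries (2 * (K + 1) + j) w := by
  induction K with
  | zero => simpa [add_comm] using cseries_eq j w
  | succ K ih =>
    rw [Finset.sum_range_succ, ih, cseries_eq (2 * (K + 1) + j)]
    rw [show 2 * (K + 1) + j + 2 = 2 * (K + 1 + 1) + j by ring]; ring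

/-! ### Closed form of the eigenfunction -/

lemma exp_add_exp_neg_mul (z w : ℂ) :
    Complex.exp (z + w) + Complex.exp (-z + w) = 2 * Complex.cosh z * Complex.exp w := by
  rw [Complex.exp_add, Complex.exp_add, Complex.cosh]; ring

lemma exp_sub_exp_neg_mul (z w : ℂ) :
    Complex.exp (z + w) - Complex.exp (-z + w) = 2 * Complex.sinh z * Complex.exp w := by
  rw [Complex.exp_add, Complex.exp_add, Complex.sinh]; ring

variable (a c x t : ℝ)

/-- `exp (i θ / 2)`. -/
def halfPhase : ℂ := Complex.exp (Complex.I * (a * x + a * (a - c ^ 2) * t) / 2)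

lemma halfPhase_ne_zero : halfPhase a c x t ≠ 0 := Complex.exp_ne_zero _

lemma conj_halfPhase : conj (halfPhase a c x t) = (halfPhase a c x t)⁻¹ := by
  rw [halfPhase, ← Complex.exp_conj, ← Complex.exp_neg]
  congr 1
  simp [map_ofNat, neg_div]

lemma seed_eq : seed a c x t = c * halfPhase a c x t ^ 2 := by
  rw [seed, halfPhase, ← Complex.exp_nat_mul]
  congr 2; push_cast; ring

/-- The common scalar factor of both components of the eigenfunction. -/
def commonFactor (l : ℂ) : ℂ := -2 * Complex.I * (quadP ℂ a c).eval l / (l * c)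

/-- Entire counterpart of `partA`. -/
def fullA (l : ℂ) : ℂ := cseries 0 ((sqExp a c (x : ℂ) (t : ℂ)).eval l)

/-- Entire counterpart of `partB`. -/
def fullB (l : ℂ) : ℂ :=
  Complex.I * (quadM ℂ a c).eval l * (phase a c (x : ℂ) (t : ℂ)).eval l
    * cseries 1 ((sqExp a c (x : ℂ) (t : ℂ)).eval l)

/-- Only this square enters the closed form, which makes the branch of the square root irrelevant.
-/
lemma c1_sq (l : ℂ) :
    c1 a c l ^ 2 = -((quadP ℂ a c).eval l * (quadM ℂ a c).eval l) := by
  rw [c1, div_pow, Complex.sqrt, Complex.cpow_ofNat_inv_pow]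
  simp only [quadP, quadM, eval_add, eval_sub, eval_mul, eval_pow, eval_X, eval_C,
    Algebra.algebraMap_self, RingHom.id_apply]
  linear_combination (-(l ^ 2 * c ^ 2)) * Complex.I_sq

lemma conj_c1_sq (l : ℂ) : conj (c1 a c (-conj l)) ^ 2 = c1 a c l ^ 2 := by
  rw [← map_pow, c1, c1, div_pow, div_pow, Complex.sqrt, Complex.sqrt,
    Complex.cpow_ofNat_inv_pow, Complex.cpow_ofNat_inv_pow]
  simp [map_ofNat, Even.neg_pow (by decide : Even 4)]

lemma eval_phase (l : ℂ) :
    (phase a c (x : ℂ) (t : ℂ)).eval l = x + 2 * l ^ 2 * t + (a - c ^ 2) * t := by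
  simp [phase]; ring

/-- cosh is even, so knowing C² suffices. The freedom in C serves both c₁(λ) and the conjugate of
c₁(-λ*), which agree only up to sign. -/
lemma cosh_exponent {C l : ℂ} (hC : C ^ 2 = c1 a c l ^ 2) :
    Complex.cosh (C * (x + 2 * l ^ 2 * t + (a - c ^ 2) * t)) = fullA a c x t l := by
  rw [cosh_eq_cseries, fullA, mul_pow, hC, c1_sq, ← eval_phase]
  congr 1; simp [sqExp]

lemma sinh_exponent {C l : ℂ} (hC : C ^ 2 = c1 a c l ^ 2) :
    C * Complex.sinh (C * (x + 2 * l ^ 2 * t + (a - c ^ 2) * t)) =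
      Complex.I * (quadP ℂ a c).eval l * fullB a c x t l := by
  have hw : (sqExp a c (x : ℂ) (t : ℂ)).eval l =
      C ^ 2 * (phase a c (x : ℂ) (t : ℂ)).eval l ^ 2 := by
    rw [hC, c1_sq]; simp [sqExp]
  rw [sinh_eq_cseries, fullB, hw, mul_pow, ← eval_phase]
  have := hC.trans (c1_sq a c l)
  linear_combination ((phase a c (x : ℂ) (t : ℂ)).eval l *
    cseries 1 (C ^ 2 * (phase a c (x : ℂ) (t : ℂ)).eval l ^ 2)) * (this -
      (quadP ℂ a c).eval l * (quadM ℂ a c).eval l * Complex.I_sq)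

variable {a c}

lemma omegaFst_add (l C : ℂ) :
    omegaFst a c x t l C + omegaFst a c x t l (-C) =
      2 * Complex.cosh (C * (x + 2 * l ^ 2 * t + (a - c ^ 2) * t)) * halfPhase a c x t := by
  rw [halfPhase, ← exp_add_exp_neg_mul, omegaFst, omegaFst]
  congr 3; ring

lemma omegaSnd_add (l C : ℂ) :
    omegaSnd a c x t l C + omegaSnd a c x t l (-C) =
      (2 * (Complex.I * a - 2 * Complex.I * l ^ 2) *
          Complex.cosh (C * (x + 2 * l ^ 2 * t + (a - c ^ 2) * t))
        + 4 * (C * Complex.sinh (C * (x + 2 * l ^ 2 * t + (a - c ^ 2) * t))))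
        / (2 * l * c) * (halfPhase a c x t)⁻¹ := by
  have h := exp_add_exp_neg_mul (C * (x + 2 * l ^ 2 * t + (a - c ^ 2) * t))
    (-(Complex.I * (a * x + a * (a - c ^ 2) * t) / 2))
  have h' := exp_sub_exp_neg_mul (C * (x + 2 * l ^ 2 * t + (a - c ^ 2) * t))
    (-(Complex.I * (a * x + a * (a - c ^ 2) * t) / 2))
  rw [halfPhase, ← Complex.exp_neg, omegaSnd, omegaSnd, neg_mul]
  simp only [sub_eq_add_neg] at h h' ⊢
  generalize Complex.exp (C * _ + _) = E1 at *
  generalize Complex.exp (-(C * _) + _) = E2 at *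
  generalize Complex.exp _ = E3 at *
  simp only [div_eq_mul_inv]
  linear_combination (Complex.I * a + -(2 * Complex.I * l ^ 2)) * (2 * l * c)⁻¹ * h
    + 2 * C * (2 * l * c)⁻¹ * h'

lemma quadP_eval (l : ℂ) :
    (quadP ℂ a c).eval l = l ^ 2 + Complex.I * c * l - a / 2 := by simp [quadP]

/-- The coefficient of cosh is proportional to ia - 2iλ² + 2λc = -2i·`quadP`, and c₁ sinh(c₁T) also
contains `quadP` (`sinh_exponent`); the simple zeros at λ₁, λ₂ thus split off as a factor shared by
both components. -/
lemma eigG_eq (hc : c ≠ 0) {l : ℂ} (hl : l ≠ 0) :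
    eigG a c x t l = commonFactor a c l * (halfPhase a c x t)⁻¹ *
      (fullA a c x t l - fullB a c x t l) := by
  have hc' : (c : ℂ) ≠ 0 := by exact_mod_cast hc
  rw [eigG, add_assoc, ← map_add, omegaSnd_add, omegaFst_add, map_mul, map_mul, conj_halfPhase,
    ← Complex.cosh_conj]
  have hx : conj (c1 a c (-conj l) * (x + 2 * (-conj l) ^ 2 * t + (a - c ^ 2) * t))
      = conj (c1 a c (-conj l)) * (x + 2 * l ^ 2 * t + (a - c ^ 2) * t) := by
    simp [map_ofNat]
  rw [hx, cosh_exponent _ _ _ _ (conj_c1_sq a c l), cosh_exponent _ _ _ _ rfl,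
    sinh_exponent _ _ _ _ rfl, commonFactor, quadP_eval, map_ofNat]
  field_simp
  ring_nf
  simp only [Complex.I_sq]
  ring

lemma eigF_eq (hc : c ≠ 0) {l : ℂ} (hl : l ≠ 0) :
    eigF a c x t l = commonFactor a c l * halfPhase a c x t *
      (fullA a c x t l + fullB a c x t l) := by
  have hc' : (c : ℂ) ≠ 0 := by exact_mod_cast hc
  rw [eigF, add_assoc, ← map_add, omegaSnd_add, omegaFst_add]
  simp only [map_mul, map_div₀, map_inv₀, map_add, conj_halfPhase, ← Complex.cosh_conj,
    ← Complex.sinh_conj]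
  have hx : conj (c1 a c (-conj l)) * (conj (x : ℂ) + conj 2 * conj ((-conj l) ^ 2) * conj (t : ℂ)
        + conj (a - c ^ 2 : ℂ) * conj (t : ℂ))
      = conj (c1 a c (-conj l)) * (x + 2 * l ^ 2 * t + (a - c ^ 2) * t) := by
    simp [map_ofNat]
  rw [hx, cosh_exponent _ _ _ _ (conj_c1_sq a c l), cosh_exponent _ _ _ _ rfl,
    sinh_exponent _ _ _ _ (conj_c1_sq a c l), commonFactor, quadP_eval]
  simp only [map_ofNat, map_neg, Complex.conj_conj, Complex.conj_I, Complex.conj_ofReal, map_sub,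
    map_mul, map_pow, inv_inv]
  field_simp
  ring_nf
  simp only [Complex.I_sq]
  ring

/-- By this symmetry the partner rows (g*, f*) of the Darboux determinants are the same
eigenfunction evaluated at -λ*. -/
lemma eigF_neg_conj (l : ℂ) : eigF a c x t (-conj l) = conj (eigG a c x t l) := by
  simp only [eigF, eigG, map_add, map_neg, Complex.conj_conj, neg_neg]
  ring

lemma eigG_neg_conj (l : ℂ) : eigG a c x t (-conj l) = conj (eigF a c x t l) := by
  simp only [eigF, eigG, map_add, map_neg, Complex.conj_conj, neg_neg]
  ring

lemma differentiable_fullA : Differentiable ℂ (fullA a c x t) :=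
  (differentiable_cseries 0).comp (sqExp a c (x : ℂ) (t : ℂ)).differentiable

lemma differentiable_fullB : Differentiable ℂ (fullB a c x t) := by
  have := (differentiable_cseries 1).comp (sqExp a c (x : ℂ) (t : ℂ)).differentiable
  have h1 := (quadM ℂ a c).differentiable
  have h2 := (phase a c (x : ℂ) (t : ℂ)).differentiable
  exact ((h1.const_mul _).mul h2).mul this

lemma fullA_eq (K : ℕ) (l : ℂ) :
    fullA a c x t l = (partA a c K (x : ℂ) (t : ℂ)).eval l
      + (sqExp a c (x : ℂ) (t : ℂ)).eval l ^ (K + 1)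
        * cseries (2 * (K + 1)) ((sqExp a c (x : ℂ) (t : ℂ)).eval l) := by
  rw [fullA, cseries_eq_sum 0 K, partA, coshTrunc]
  simp [eval_finsetSum]

lemma fullB_eq (K : ℕ) (l : ℂ) :
    fullB a c x t l = (partB a c K (x : ℂ) (t : ℂ)).eval l
      + (sqExp a c (x : ℂ) (t : ℂ)).eval l ^ (K + 1)
        * (Complex.I * (quadM ℂ a c).eval l * (phase a c (x : ℂ) (t : ℂ)).eval l *
          cseries (2 * (K + 1) + 1) ((sqExp a c (x : ℂ) (t : ℂ)).eval l)) := by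
  rw [fullB, cseries_eq_sum 1 K, partB, sinhcTrunc]
  simp only [eval_mul, eval_C, eval_finsetSum, eval_pow, Algebra.algebraMap_self,
    RingHom.id_apply]
  ring

/-! ### The eigenvalues -/

lemma quadP_eq (hac : c ^ 2 < 2 * a) :
    quadP ℂ a c = (X - C (lam1 a c)) * (X - C (lam2 a c)) := by
  have hs : ((Real.sqrt (2 * a - c ^ 2) : ℝ) : ℂ) ^ 2 = 2 * a - c ^ 2 := by
    rw [← Complex.ofReal_pow, Real.sq_sqrt (by linarith)]; push_cast; ring
  have h1 : lam1 a c + lam2 a c = -(Complex.I * c) := by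
    simp [lam2, lam1, map_ofNat]; ring
  have h2 : lam1 a c * lam2 a c = -(a / 2) := by
    simp [lam2, lam1, map_ofNat]
    linear_combination (-1/4) * hs + (c ^ 2 / 4) * Complex.I_sq
  have h1' : (C (lam1 a c) + C (lam2 a c) : ℂ[X]) = -C (Complex.I * c) := by
    rw [← C_add, h1, C_neg]
  have h2' : (C (lam1 a c) * C (lam2 a c) : ℂ[X]) = -C (a / 2 : ℂ) := by
    rw [← C_mul, h2, C_neg]
  simp only [quadP, Algebra.algebraMap_self, RingHom.id_apply]
  linear_combination X * h1' - h2'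

lemma lam1_mul_lam2 (hac : c ^ 2 < 2 * a) : lam1 a c * lam2 a c = -(a / 2) := by
  have := congrArg (eval 0) (quadP_eq hac)
  simp [quadP] at this
  exact this.symm

lemma lam1_ne_lam2 (hac : c ^ 2 < 2 * a) : lam1 a c ≠ lam2 a c := by
  intro h
  have := congrArg Complex.re h
  simp [lam1, lam2, map_ofNat] at this
  have h2 : 0 < Real.sqrt (2 * a - c ^ 2) := Real.sqrt_pos.mpr (by linarith)
  linarith

lemma pos_of_lt (hac : c ^ 2 < 2 * a) : 0 < a := by nlinarith [sq_nonneg c]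

lemma lam1_ne_zero (hac : c ^ 2 < 2 * a) : lam1 a c ≠ 0 := by
  intro h
  have h1 := lam1_mul_lam2 hac
  have h2 := pos_of_lt hac
  rw [h, zero_mul] at h1
  have : (a : ℂ) = 0 := by linear_combination 2 * h1
  exact h2.ne' (by exact_mod_cast this)

lemma lam2_ne_zero (hac : c ^ 2 < 2 * a) : lam2 a c ≠ 0 := by
  intro h
  have h1 := lam1_mul_lam2 hac
  have h2 := pos_of_lt hac
  rw [h, mul_zero] at h1
  have : (a : ℂ) = 0 := by linear_combination 2 * h1
  exact h2.ne' (by exact_mod_cast this)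

/-- `λ₁` for even rows and `λ₂` for odd rows. -/
def lamRow (a c : ℝ) (r : ℕ) : ℂ := if Even r then lam1 a c else lam2 a c

lemma lamRow_ne_zero (hac : c ^ 2 < 2 * a) (r : ℕ) : lamRow a c r ≠ 0 := by
  rw [lamRow]; split_ifs
  · exact lam1_ne_zero hac
  · exact lam2_ne_zero hac

lemma quadP_eval_lamRow (hac : c ^ 2 < 2 * a) (r : ℕ) : (quadP ℂ a c).eval (lamRow a c r) = 0 := by
  rw [lamRow, quadP_eq hac]; split_ifs <;> simp

lemma c1_eq_zero (hac : c ^ 2 < 2 * a) (r : ℕ) : c1 a c (lamRow a c r) = 0 := by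
  have := c1_sq a c (lamRow a c r)
  rw [quadP_eval_lamRow hac, zero_mul, neg_zero] at this
  exact pow_eq_zero_iff (by norm_num) |>.mp this

lemma eigF_eq_zero (hc : c ≠ 0) (hac : c ^ 2 < 2 * a) (r : ℕ) :
    eigF a c x t (lamRow a c r) = 0 := by
  rw [eigF_eq x t hc (lamRow_ne_zero hac r), commonFactor, quadP_eval_lamRow hac]; simp

lemma eigG_eq_zero (hc : c ≠ 0) (hac : c ^ 2 < 2 * a) (r : ℕ) :
    eigG a c x t (lamRow a c r) = 0 := by
  rw [eigG_eq x t hc (lamRow_ne_zero hac r), commonFactor, quadP_eval_lamRow hac]; simp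

lemma taylorCoeff_zero (φ : ℂ → ℂ) (l : ℂ) (j : ℕ) : taylorCoeff φ l j 0 = l ^ j * φ l := by
  simp [taylorCoeff]

end

end DNLS

namespace DNLS

open Polynomial ComplexConjugate

noncomputable section

/-! ### Orders of vanishing and divisibility -/

lemma analyticAt_eval (p : ℂ[X]) (z : ℂ) : AnalyticAt ℂ (fun l => p.eval l) z :=
  p.differentiable.analyticAt z

lemma le_order_pow_mul {g : ℂ → ℂ} {z : ℂ} (hg : AnalyticAt ℂ g z) (k m : ℕ) :
    ((k + m : ℕ) : ℕ∞) ≤ analyticOrderAt (fun l => (l - z) ^ m * g l) z ↔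
      (k : ℕ∞) ≤ analyticOrderAt g z := by
  have h1 : AnalyticAt ℂ (fun l : ℂ => (l - z) ^ m) z := by fun_prop
  have h2 : analyticOrderAt (fun l : ℂ => (l - z) ^ m) z = m := analyticOrderAt_centeredMonomial
  have : analyticOrderAt (fun l => (l - z) ^ m * g l) z = m + analyticOrderAt g z := by
    rw [← h2, ← analyticOrderAt_mul h1 hg]; rfl
  rw [this, Nat.cast_add, add_comm (k : ℕ∞)]
  exact WithTop.add_le_add_iff_left (WithTop.coe_ne_top)

lemma pow_dvd_iff_le_order (p : ℂ[X]) (z : ℂ) (k : ℕ) :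
    (X - C z) ^ k ∣ p ↔ (k : ℕ∞) ≤ analyticOrderAt (fun l => p.eval l) z := by
  constructor
  · rintro ⟨q, rfl⟩
    rw [natCast_le_analyticOrderAt (analyticAt_eval _ z)]
    exact ⟨fun l => q.eval l, analyticAt_eval q z, Filter.Eventually.of_forall fun l => by simp⟩
  · intro h
    by_cases hp : p = 0
    · simp [hp]
    obtain ⟨q, hq, hq'⟩ := exists_eq_pow_rootMultiplicity_mul_and_not_dvd p hp z
    have h0 : analyticOrderAt (fun l => q.eval l) z = 0 := by
      rw [analyticOrderAt_eq_zero]; right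
      rwa [dvd_iff_isRoot] at hq'
    set m := rootMultiplicity z p
    have hk : k ≤ m := by
      by_contra hlt
      push Not at hlt
      obtain ⟨j, rfl⟩ := Nat.exists_eq_add_of_lt hlt
      have e : (fun l => p.eval l) = fun l => (l - z) ^ m * q.eval l := by
        ext l; rw [hq]; simp
      rw [e, show m + j + 1 = (j + 1) + m by ring, le_order_pow_mul (analyticAt_eval q z), h0] at h
      exact absurd h (by simp)
    rw [hq]
    exact Dvd.dvd.mul_right (pow_dvd_pow _ hk) _

lemma order_le_iff_of_sub {f g h : ℂ → ℂ} {z : ℂ} {k : ℕ} (hh : AnalyticAt ℂ h z)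
    (hfg : ∀ l, f l = g l + (l - z) ^ k * h l) :
    (k : ℕ∞) ≤ analyticOrderAt f z ↔ (k : ℕ∞) ≤ analyticOrderAt g z := by
  have hk : (k : ℕ∞) ≤ analyticOrderAt (fun l => (l - z) ^ k * h l) z := by
    have := (le_order_pow_mul hh 0 k).mpr (by simp)
    simpa using this
  have hf : f = g + fun l => (l - z) ^ k * h l := by ext l; exact hfg l
  have hg : g = f - fun l => (l - z) ^ k * h l := by rw [hf]; simp
  constructor
  · intro h'
    rw [hg]
    exact (le_min h' hk).trans le_analyticOrderAt_sub
  · intro h'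
    rw [hf]
    exact (le_min h' hk).trans le_analyticOrderAt_add

/-! ### Annihilators in terms of Taylor coefficients -/

variable {a c : ℝ} (x t : ℝ) {K k : ℕ}

lemma exists_quadP_factor (hac : c ^ 2 < 2 * a) (r : ℕ) :
    ∃ z' : ℂ, lamRow a c r ≠ z' ∧ quadP ℂ a c = (X - C (lamRow a c r)) * (X - C z') := by
  rw [quadP_eq hac, lamRow]
  split_ifs
  · exact ⟨_, lam1_ne_lam2 hac, rfl⟩
  · exact ⟨_, (lam1_ne_lam2 hac).symm, mul_comm _ _⟩

lemma analyticAt_halfPhase_factor {z : ℂ} (z' : ℂ) (hz : z ≠ 0) (hc : c ≠ 0) :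
    AnalyticAt ℂ (fun l => -2 * Complex.I * (l - z') / (l * c) * halfPhase a c x t) z := by
  have hc' : (c : ℂ) ≠ 0 := by exact_mod_cast hc
  have : z * c ≠ 0 := mul_ne_zero hz hc'
  fun_prop (disch := assumption)

lemma analyticAt_eigF (hc : c ≠ 0) {z : ℂ} (hz : z ≠ 0) : AnalyticAt ℂ (eigF a c x t) z := by
  have hc' : (c : ℂ) ≠ 0 := by exact_mod_cast hc
  have h0 : z * c ≠ 0 := mul_ne_zero hz hc'
  have h1 := (differentiable_fullA (a := a) (c := c) x t).analyticAt z
  have h2 := (differentiable_fullB (a := a) (c := c) x t).analyticAt z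
  have h3 := analyticAt_eval (quadP ℂ a c) z
  have : AnalyticAt ℂ (fun l => commonFactor a c l * halfPhase a c x t *
      (fullA a c x t l + fullB a c x t l)) z := by
    unfold commonFactor
    fun_prop (disch := assumption)
  refine this.congr ?_
  filter_upwards [eventually_ne_nhds hz] with l hl
  rw [eigF_eq x t hc hl]

lemma analyticAt_eigG (hc : c ≠ 0) {z : ℂ} (hz : z ≠ 0) : AnalyticAt ℂ (eigG a c x t) z := by
  have hc' : (c : ℂ) ≠ 0 := by exact_mod_cast hc
  have h0 : z * c ≠ 0 := mul_ne_zero hz hc'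
  have h1 := (differentiable_fullA (a := a) (c := c) x t).analyticAt z
  have h2 := (differentiable_fullB (a := a) (c := c) x t).analyticAt z
  have h3 := analyticAt_eval (quadP ℂ a c) z
  have : AnalyticAt ℂ (fun l => commonFactor a c l * (halfPhase a c x t)⁻¹ *
      (fullA a c x t l - fullB a c x t l)) z := by
    unfold commonFactor
    fun_prop (disch := assumption)
  refine this.congr ?_
  filter_upwards [eventually_ne_nhds hz] with l hl
  rw [eigG_eq x t hc hl]

/-- The shift from k + 1 to k is the simple zero of the common factor. After its removal A and B may
be truncated, since the discarded terms vanish to order K + 1 ≥ k. -/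
lemma order_comb_iff (hc : c ≠ 0) (hac : c ^ 2 < 2 * a) (hk : k ≤ K + 1) (r : ℕ) (P R : ℂ[X]) :
    ((k + 1 : ℕ) : ℕ∞) ≤
        analyticOrderAt (fun l => P.eval l * eigF a c x t l + R.eval l * eigG a c x t l)
          (lamRow a c r) ↔
      (X - C (lamRow a c r)) ^ k ∣
        P * (partA a c K (x : ℂ) (t : ℂ) + partB a c K (x : ℂ) (t : ℂ))
        + (C ((halfPhase a c x t)⁻¹ ^ 2) * R) *
          (partA a c K (x : ℂ) (t : ℂ) - partB a c K (x : ℂ) (t : ℂ)) := by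
  have hz := lamRow_ne_zero hac r
  obtain ⟨z', hzz', hq⟩ := exists_quadP_factor hac r
  set z := lamRow a c r
  set h := halfPhase a c x t
  have hh : h ≠ 0 := halfPhase_ne_zero a c x t
  have hc' : (c : ℂ) ≠ 0 := by exact_mod_cast hc
  have hzc : z * c ≠ 0 := mul_ne_zero hz hc'
  -- The common factor with l - z removed: it is analytic and nonzero at z, so it does not affect
  -- the order.
  set U : ℂ → ℂ := fun l => -2 * Complex.I * (l - z') / (l * c) * h with hU
  set N : ℂ → ℂ := fun l => P.eval l * (fullA a c x t l + fullB a c x t l)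
    + h⁻¹ ^ 2 * R.eval l * (fullA a c x t l - fullB a c x t l) with hN
  have hUa : AnalyticAt ℂ U z := analyticAt_halfPhase_factor x t z' hz hc
  have hUz : U z ≠ 0 := by
    have : z - z' ≠ 0 := sub_ne_zero.mpr hzz'
    have h2 : (-2 * Complex.I : ℂ) ≠ 0 := by simp
    exact mul_ne_zero (div_ne_zero (mul_ne_zero h2 this) hzc) hh
  have hA := (differentiable_fullA (a := a) (c := c) x t).analyticAt z
  have hB := (differentiable_fullB (a := a) (c := c) x t).analyticAt z
  have hP := analyticAt_eval P z
  have hR := analyticAt_eval R z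
  have hNa : AnalyticAt ℂ N z := by simp only [hN]; fun_prop
  have e1 : analyticOrderAt (fun l => P.eval l * eigF a c x t l + R.eval l * eigG a c x t l) z =
      analyticOrderAt (fun l => (l - z) ^ 1 * (U * N) l) z := by
    apply analyticOrderAt_congr
    filter_upwards [eventually_ne_nhds hz] with l hl
    rw [eigF_eq x t hc hl, eigG_eq x t hc hl, commonFactor, hq]
    simp only [hU, hN, Pi.mul_apply, eval_mul, eval_sub, eval_X, eval_C]
    have : halfPhase a c x t = h := rfl
    rw [this]
    field_simp
    ring
  rw [e1, le_order_pow_mul (hUa.mul hNa), analyticOrderAt_mul hUa hNa,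
    (hUa.analyticOrderAt_eq_zero).mpr hUz, zero_add, pow_dvd_iff_le_order]
  set w := sqExp a c (x : ℂ) (t : ℂ)
  obtain ⟨s, hs⟩ : (X - C z) ∣ w := (Dvd.intro _ hq.symm).trans (quadP_dvd_sqExp a c _ _)
  have hw : ∀ l, w.eval l ^ (K + 1) = (l - z) ^ k * ((l - z) ^ (K + 1 - k) *
      s.eval l ^ (K + 1)) := by
    intro l
    rw [hs, eval_mul, mul_pow, ← mul_assoc, ← pow_add, show k + (K + 1 - k) = K + 1 by omega]
    simp
  set TA : ℂ → ℂ := fun l => cseries (2 * (K + 1)) (w.eval l) with hTA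
  set TB : ℂ → ℂ := fun l => Complex.I * (quadM ℂ a c).eval l *
    (phase a c (x : ℂ) (t : ℂ)).eval l * cseries (2 * (K + 1) + 1) (w.eval l) with hTB
  have hTAa : AnalyticAt ℂ TA z :=
    ((differentiable_cseries _).comp w.differentiable).analyticAt z
  have hTBa : AnalyticAt ℂ TB z := by
    have h1 := analyticAt_eval (quadM ℂ a c) z
    have h2 := analyticAt_eval (phase a c (x : ℂ) (t : ℂ)) z
    have h3 : AnalyticAt ℂ (fun l => cseries (2 * (K + 1) + 1) (w.eval l)) z :=
      ((differentiable_cseries _).comp w.differentiable).analyticAt z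
    simp only [hTB]; fun_prop
  have hsa := analyticAt_eval s z
  refine order_le_iff_of_sub (h := fun l => (l - z) ^ (K + 1 - k) * s.eval l ^ (K + 1) *
    (P.eval l * (TA l + TB l) + h⁻¹ ^ 2 * R.eval l * (TA l - TB l))) (by fun_prop) ?_
  intro l
  simp only [hN, eval_add, eval_mul, eval_sub, eval_C]
  rw [fullA_eq x t K l, fullB_eq x t K l]
  have hw' := hw l
  simp only [hTA, hTB]
  linear_combination (P.eval l * (cseries (2 * (K + 1)) (w.eval l) + Complex.I *
    (quadM ℂ a c).eval l * (phase a c (x : ℂ) (t : ℂ)).eval l *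
    cseries (2 * (K + 1) + 1) (w.eval l)) + h⁻¹ ^ 2 * R.eval l *
    (cseries (2 * (K + 1)) (w.eval l) - Complex.I * (quadM ℂ a c).eval l *
    (phase a c (x : ℂ) (t : ℂ)).eval l * cseries (2 * (K + 1) + 1) (w.eval l))) * hw'

lemma quadP_pow_dvd_iff (hac : c ^ 2 < 2 * a) (W : ℂ[X]) :
    quadP ℂ a c ^ k ∣ W ↔ ∀ r, (X - C (lamRow a c r)) ^ k ∣ W := by
  rw [quadP_eq hac, mul_pow]
  have hcop : IsCoprime ((X - C (lam1 a c)) ^ k) ((X - C (lam2 a c)) ^ k) :=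
    (isCoprime_X_sub_C_of_isUnit_sub (sub_ne_zero.mpr (lam1_ne_lam2 hac)).isUnit).pow
  constructor
  · intro h r
    rw [lamRow]; split_ifs
    · exact (dvd_mul_right _ _).trans h
    · exact (dvd_mul_left _ _).trans h
  · intro h
    exact hcop.mul_dvd (by simpa [lamRow] using h 0) (by simpa [lamRow] using h 1)

lemma taylorCoeff_comb {φ ψ : ℂ → ℂ} {z : ℂ} (hφ : AnalyticAt ℂ φ z) (hψ : AnalyticAt ℂ ψ z)
    {n : ℕ} {P R : ℂ[X]} (hP : P.natDegree < n) (hR : R.natDegree < n) (m : ℕ) :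
    iteratedDeriv m (fun l => P.eval l * φ l + R.eval l * ψ l) z / (m.factorial : ℂ) =
      ∑ j ∈ Finset.range n,
        (P.coeff j * taylorCoeff φ z j m + R.coeff j * taylorCoeff ψ z j m) := by
  have e : (fun l => P.eval l * φ l + R.eval l * ψ l) = fun l => ∑ j ∈ Finset.range n,
      (P.coeff j * (l ^ j * φ l) + R.coeff j * (l ^ j * ψ l)) := by
    ext l
    rw [eval_eq_sum_range' hP, eval_eq_sum_range' hR, Finset.sum_mul, Finset.sum_mul,
      ← Finset.sum_add_distrib]
    refine Finset.sum_congr rfl fun j _ => by ring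
  have h1 : ∀ j, ContDiffAt ℂ (m : WithTop ℕ∞) (fun l => P.coeff j * (l ^ j * φ l)) z := fun j =>
    AnalyticAt.contDiffAt (by fun_prop)
  have h2 : ∀ j, ContDiffAt ℂ (m : WithTop ℕ∞) (fun l => R.coeff j * (l ^ j * ψ l)) z := fun j =>
    AnalyticAt.contDiffAt (by fun_prop)
  rw [e, iteratedDeriv_fun_sum fun j _ => (h1 j).add (h2 j), Finset.sum_div]
  refine Finset.sum_congr rfl fun j _ => ?_
  rw [iteratedDeriv_fun_add (h1 j) (h2 j), iteratedDeriv_const_mul_field,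
    iteratedDeriv_const_mul_field, taylorCoeff, taylorCoeff]
  ring

lemma lamRow_mod (r m : ℕ) : lamRow a c (2 * m + r) = lamRow a c r := by
  simp [lamRow, Nat.even_add]

lemma entryF_eq (r j : ℕ) :
    entryF a c x t r j = taylorCoeff (eigF a c x t) (lamRow a c r) j (r / 2 + 1) := rfl

lemma entryG_eq (r j : ℕ) :
    entryG a c x t r j = taylorCoeff (eigG a c x t) (lamRow a c r) j (r / 2 + 1) := rfl

/-- Annihilators are the solutions of the linear system with the Taylor coefficients. -/
lemma annihilates_iff (hc : c ≠ 0) (hac : c ^ 2 < 2 * a) (hk : k ≤ K + 1) {n : ℕ} {P R : ℂ[X]}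
    (hP : P.natDegree < n) (hR : R.natDegree < n) :
    Annihilates a c K x t k P (C ((halfPhase a c x t)⁻¹ ^ 2) * R) ↔
      ∀ r < 2 * k, ∑ j ∈ Finset.range n,
        (P.coeff j * entryF a c x t r j + R.coeff j * entryG a c x t r j) = 0 := by
  have hF := fun r => analyticAt_eigF (a := a) x t hc (lamRow_ne_zero hac r)
  have hG := fun r => analyticAt_eigG (a := a) x t hc (lamRow_ne_zero hac r)
  have hT := fun r m => taylorCoeff_comb (hF r) (hG r) hP hR m
  rw [Annihilates, quadP_pow_dvd_iff hac]
  have hcomb : ∀ r, AnalyticAt ℂ (fun l => P.eval l * eigF a c x t l + R.eval l * eigG a c x t l)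
      (lamRow a c r) := fun r => by
    have h1 := hF r
    have h2 := hG r
    have hP := analyticAt_eval P (lamRow a c r)
    have hR := analyticAt_eval R (lamRow a c r)
    fun_prop
  simp only [← order_comb_iff x t hc hac hk]
  constructor
  · intro h r hr
    have := (natCast_le_analyticOrderAt_iff_iteratedDeriv_eq_zero (hcomb r)).mp (h r)
      (r / 2 + 1) (by omega)
    have h2 := hT r (r / 2 + 1)
    rw [this, zero_div] at h2
    exact h2.symm
  · intro h r
    rw [natCast_le_analyticOrderAt_iff_iteratedDeriv_eq_zero (hcomb r)]
    intro i hi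
    rcases i with _ | m
    -- The condition at order 0 is automatic, so vanishing to order k + 1 costs exactly the k
    -- conditions listed as rows.
    · rw [iteratedDeriv_zero, eigF_eq_zero x t hc hac, eigG_eq_zero x t hc hac]; simp
    · have h2 := hT r (m + 1)
      have h3 := h (2 * m + r % 2) (by omega)
      have e1 : (2 * m + r % 2) / 2 = m := by omega
      have e2 : lamRow a c (2 * m + r % 2) = lamRow a c r := by
        rw [lamRow_mod, lamRow, lamRow]
        simp only [Nat.even_iff, Nat.mod_mod]
      simp only [entryF_eq, entryG_eq, e1, e2] at h3
      rw [h3, div_eq_zero_iff] at h2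
      exact h2.resolve_right (by exact_mod_cast (Nat.factorial_ne_zero _))

end

end DNLS

namespace DNLS

open Polynomial ComplexConjugate

noncomputable section

/-! ### Even and odd polynomials with given coefficients -/

section Select

variable {A : Type*} [Semiring A]

/-- The part of `∑ w j X ^ j` with the exponents satisfying `e`. -/
def selectPoly (e : ℕ → Prop) [DecidablePred e] (n : ℕ) (w : ℕ → A) : A[X] :=
  ∑ j ∈ Finset.range n, C (if e j then w j else 0) * X ^ j

lemma coeff_selectPoly (e : ℕ → Prop) [DecidablePred e] (n : ℕ) (w : ℕ → A) (j : ℕ) :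
    (selectPoly e n w).coeff j = if j < n ∧ e j then w j else 0 := by
  rw [selectPoly, finsetSum_coeff]
  simp only [coeff_C_mul, coeff_X_pow, mul_ite, mul_one, mul_zero]
  rw [Finset.sum_ite_eq]
  by_cases h : j < n <;> simp [h]

lemma natDegree_selectPoly_lt (e : ℕ → Prop) [DecidablePred e] {n : ℕ} (hn : 0 < n) (w : ℕ → A) :
    (selectPoly e n w).natDegree < n := by
  rw [Nat.lt_iff_le_pred hn, natDegree_le_iff_coeff_eq_zero]
  intro j hj
  rw [coeff_selectPoly, if_neg (by omega)]

end Select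

lemma evenOdd_selectPoly (n : ℕ) (w : ℕ → ℂ) :
    EvenOdd (selectPoly (fun j => ¬Odd j) n w) (selectPoly Odd n w) := by
  constructor <;> ext j <;> simp only [coeff_reflP, coeff_selectPoly, coeff_neg]
  · by_cases h : Odd j
    · simp [h]
    · simp [(Nat.not_odd_iff_even.mp h).neg_one_pow]
  · by_cases h : Odd j
    · rw [h.neg_one_pow]; split_ifs <;> simp
    · simp [h]

variable {n : ℕ}

/-- The matrix with the entries `H r j`, the exponents `j` decreasing from left to right. -/
def descMatrix (n : ℕ) (H : ℕ → ℕ → ℂ) : Matrix (Fin n) (Fin n) ℂ :=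
  Matrix.of fun r s => H r (n - 1 - s)

lemma descMatrix_mulVec (H : ℕ → ℕ → ℂ) (w : ℕ → ℂ) (r : Fin n) :
    (descMatrix n H).mulVec (fun s => w (n - 1 - s)) r =
      ∑ j ∈ Finset.range n, H r j * w j := by
  rw [← Finset.sum_range_reflect (fun j => H r j * w j) n, Matrix.mulVec, dotProduct,
    ← Fin.sum_univ_eq_sum_range (fun j => H r (n - 1 - j) * w (n - 1 - j))]
  rfl

lemma descMatrix_det_ne_zero (H : ℕ → ℕ → ℂ)
    (h : ∀ w : ℕ → ℂ, (∀ r < n, ∑ j ∈ Finset.range n, H r j * w j = 0) → ∀ j < n, w j = 0) :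
    (descMatrix n H).det ≠ 0 := by
  intro h0
  obtain ⟨v, hv, hv0⟩ := Matrix.exists_mulVec_eq_zero_iff.mpr h0
  set w : ℕ → ℂ := fun j => if hj : j < n then v ⟨n - 1 - j, by omega⟩ else 0 with hw
  have hvw : v = fun s : Fin n => w (n - 1 - s) := by
    ext s
    have h1 : n - 1 - (s : ℕ) < n := by omega
    simp only [hw, h1, dif_pos]
    congr 1
    ext; simp; omega
  apply hv
  rw [hvw] at hv0 ⊢
  ext s
  have hs := s.isLt
  refine h w (fun r hr => ?_) _ (by omega)
  have := congrFun hv0 ⟨r, hr⟩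
  rwa [descMatrix_mulVec] at this

variable {a c : ℝ} (x t : ℝ) {K k : ℕ}

/-- Entries of `δ₁₁`. -/
def rowH (F G : ℕ → ℕ → ℂ) (r j : ℕ) : ℂ := if Odd j then G r j else F r j

lemma det11_eq (F G : ℕ → ℕ → ℂ) : det11 n F G = (descMatrix n (rowH F G)).det := rfl
lemma det21_eq (F G : ℕ → ℕ → ℂ) : det21 n F G = (descMatrix n (rowH G F)).det := rfl

lemma det12_eq [NeZero n] (F G : ℕ → ℕ → ℂ) :
    det12 n F G = ((descMatrix n (rowH F G)).updateCol 0 fun r => F r n).det := by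
  rw [det12]
  congr 1
  ext r s
  simp only [Matrix.of_apply, Matrix.updateCol_apply, descMatrix, rowH]
  have : s = 0 ↔ (s : ℕ) = 0 := by rw [Fin.ext_iff]; simp
  simp only [this]

lemma sum_selectPoly {N : ℕ} (w : ℕ → ℂ) (F G : ℕ → ℂ) :
    ∑ j ∈ Finset.range N, ((selectPoly (fun j => ¬Odd j) N w).coeff j * F j
      + (selectPoly Odd N w).coeff j * G j) =
      ∑ j ∈ Finset.range N, (if Odd j then G j else F j) * w j := by
  refine Finset.sum_congr rfl fun j hj => ?_
  rw [coeff_selectPoly, coeff_selectPoly]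
  have := Finset.mem_range.mp hj
  by_cases h : Odd j <;> simp [h, this, mul_comm]

lemma selectPoly_eq_zero {w : ℕ → ℂ} (h1 : selectPoly (fun j => ¬Odd j) n w = 0)
    (h2 : selectPoly Odd n w = 0) : ∀ j < n, w j = 0 := by
  intro j hj
  by_cases h : Odd j
  · have := congrArg (fun p => p.coeff j) h2
    rwa [coeff_selectPoly, if_pos ⟨hj, h⟩, coeff_zero] at this
  · have := congrArg (fun p => p.coeff j) h1
    rwa [coeff_selectPoly, if_pos ⟨hj, h⟩, coeff_zero] at this

lemma halfPhase_sq_ne_zero : (halfPhase a c x t)⁻¹ ^ 2 ≠ 0 :=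
  pow_ne_zero _ (inv_ne_zero (halfPhase_ne_zero a c x t))

lemma reflP_C_mul (z : ℂ) (p : ℂ[X]) : reflP (C z * p) = C z * reflP p := by simp

/-- A kernel vector, split by the parity of the exponent, is an annihilator of degree below 2k and
therefore zero. -/
lemma delta11_ne_zero (hc : c ≠ 0) (hac : c ^ 2 < 2 * a) (hk : 1 ≤ k) :
    delta11 a c k x t ≠ 0 := by
  rw [delta11, det11_eq]
  refine descMatrix_det_ne_zero _ fun w hw => ?_
  have hd := natDegree_selectPoly_lt (fun j => ¬Odd j) (n := 2 * k) (by omega) w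
  have hd' := natDegree_selectPoly_lt Odd (n := 2 * k) (by omega) w
  have hann := (annihilates_iff x t hc hac (K := k) (k := k) (by omega) hd hd').mpr fun r hr => by
    rw [sum_selectPoly]; exact hw r hr
  have hp := evenOdd_selectPoly (2 * k) w
  have hp' : EvenOdd (selectPoly (fun j => ¬Odd j) (2 * k) w)
      (C ((halfPhase a c x t)⁻¹ ^ 2) * selectPoly Odd (2 * k) w) :=
    ⟨hp.1, by rw [reflP_C_mul, hp.2]; ring⟩
  have ha := (pos_of_lt hac).ne'
  obtain ⟨h1, h2⟩ := eq_zero_of_natDegree_lt (m := 2 * k - 1) (by omega)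
    ((natDegree_C_mul_le _ _).trans (by omega)) (by omega) (hp'.dvd_norm hc ha hann)
  rw [mul_eq_zero, C_eq_zero] at h2
  exact selectPoly_eq_zero h1 (h2.resolve_left (halfPhase_sq_ne_zero x t))

lemma delta21_ne_zero (hc : c ≠ 0) (hac : c ^ 2 < 2 * a) (hk : 1 ≤ k) :
    delta21 a c k x t ≠ 0 := by
  rw [delta21, det21_eq]
  refine descMatrix_det_ne_zero _ fun w hw => ?_
  have hd := natDegree_selectPoly_lt (fun j => ¬Odd j) (n := 2 * k) (by omega) w
  have hd' := natDegree_selectPoly_lt Odd (n := 2 * k) (by omega) w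
  have hann := (annihilates_iff x t hc hac (K := k) (k := k) (by omega) hd' hd).mpr fun r hr => by
    simp only [add_comm (_ * entryF a c x t r _)]
    rw [sum_selectPoly]; exact hw r hr
  have hp := evenOdd_selectPoly (2 * k) w
  have hp' : EvenOdd (C ((halfPhase a c x t)⁻¹ ^ 2) * selectPoly (fun j => ¬Odd j) (2 * k) w)
      (selectPoly Odd (2 * k) w) :=
    ⟨by rw [reflP_C_mul, hp.1], hp.2⟩
  have ha := (pos_of_lt hac).ne'
  obtain ⟨h2, h1⟩ := eq_zero_of_natDegree_lt (m := 2 * k - 1) (by omega)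
    -- Here f carries the odd exponents and g the even ones, so the parities of P and R are
    -- exchanged compared with δ₁₁.
    ((natDegree_C_mul_le _ _).trans (by omega)) (by omega) (OddEven.dvd_norm hc ha hp' hann)
  rw [mul_eq_zero, C_eq_zero] at h1
  exact selectPoly_eq_zero (h1.resolve_left (halfPhase_sq_ne_zero x t)) h2

/-! ### The shift of all exponents by one -/

/-- Multiplication by λ = z + (λ - z): the second summand lowers the Taylor index by one. Here this
is read off from the Leibniz rule. -/
lemma taylorCoeff_succ {φ : ℂ → ℂ} {z : ℂ} (hφ : AnalyticAt ℂ φ z) (j m : ℕ) :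
    taylorCoeff φ z (j + 1) (m + 1) = z * taylorCoeff φ z j (m + 1) + taylorCoeff φ z j m := by
  have e : (fun l => l ^ (j + 1) * φ l) = fun l => l * (l ^ j * φ l) := by ext l; ring
  have h1 : ∀ n : ℕ, ContDiffAt ℂ (n : WithTop ℕ∞) (fun l => l ^ j * φ l) z := fun n =>
    AnalyticAt.contDiffAt (by fun_prop)
  rw [taylorCoeff, e, iteratedDeriv_fun_mul contDiffAt_fun_id (h1 _), Finset.sum_range_succ',
    Finset.sum_range_succ']
  have h0 : ∀ i ∈ Finset.range m, ((m + 1).choose (i + 1 + 1) : ℂ) *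
      iteratedDeriv (i + 1 + 1) (fun l : ℂ => l) z *
      iteratedDeriv (m + 1 - (i + 1 + 1)) (fun l => l ^ j * φ l) z = 0 := by
    intro i _
    have : iteratedDeriv (i + 1 + 1) (fun l : ℂ => l) z = 0 :=
      (iteratedDeriv_id (n := i + 1 + 1) (x := z)).trans (by simp)
    rw [this]; ring
  rw [Finset.sum_eq_zero h0]
  have hd : deriv (fun l : ℂ => l) z = 1 := deriv_id z
  have hm : (m.factorial : ℂ) ≠ 0 := by exact_mod_cast m.factorial_ne_zero
  have hm1 : (m : ℂ) + 1 ≠ 0 := by exact_mod_cast m.succ_ne_zero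
  simp only [taylorCoeff, zero_add, Nat.choose_one_right, iteratedDeriv_one, hd, Nat.add_sub_cancel,
    iteratedDeriv_zero, Nat.choose_zero_right, Nat.factorial_succ, Nat.sub_zero]
  push_cast
  field_simp
  ring

/-- The effect of the multiplication by `λ` on the Taylor coefficients. -/
def shiftMatrix (a c : ℝ) (n : ℕ) : Matrix (Fin n) (Fin n) ℂ :=
  Matrix.of fun r r' => if r' = r then lamRow a c r else if (r' : ℕ) + 2 = r then 1 else 0

lemma prod_lamRow (hac : c ^ 2 < 2 * a) (k : ℕ) :
    ∏ r ∈ Finset.range (2 * k), lamRow a c r = (-(a / 2) : ℂ) ^ k := by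
  induction k with
  | zero => simp
  | succ k ih =>
    rw [show 2 * (k + 1) = 2 * k + 1 + 1 by ring, Finset.prod_range_succ, Finset.prod_range_succ,
      ih, pow_succ, mul_assoc, ← lam1_mul_lam2 hac]
    simp [lamRow]

lemma shiftMatrix_det (hac : c ^ 2 < 2 * a) (k : ℕ) :
    (shiftMatrix a c (2 * k)).det = (-(a / 2) : ℂ) ^ k := by
  rw [Matrix.det_of_isLowerTriangular, ← prod_lamRow hac, ← Fin.prod_univ_eq_prod_range]
  · simp [shiftMatrix]
  · intro i j hij
    have : i < j := hij
    have h1 : j ≠ i := ne_of_gt this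
    have h2 : ¬((j : ℕ) + 2 = i) := by have := Fin.lt_def.mp this; omega
    simp [shiftMatrix, h1, h2]

lemma shiftMatrix_mul (n : ℕ) (M : Matrix (Fin n) (Fin n) ℂ) (r s : Fin n) :
    (shiftMatrix a c n * M) r s = lamRow a c r * M r s +
      if h : 2 ≤ (r : ℕ) then M ⟨r - 2, by omega⟩ s else 0 := by
  rw [Matrix.mul_apply]
  have : ∀ r', shiftMatrix a c n r r' * M r' s =
      (if r' = r then lamRow a c r * M r s else 0) +
      (if (r' : ℕ) + 2 = r then M r' s else 0) := by
    intro r'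
    simp only [shiftMatrix, Matrix.of_apply]
    by_cases h : r' = r
    · subst h; simp
    · by_cases h' : (r' : ℕ) + 2 = r <;> simp [h, h']
  simp only [this, Finset.sum_add_distrib, Finset.sum_ite_eq', Finset.mem_univ, if_true]
  congr 1
  split_ifs with h
  · rw [Finset.sum_eq_single ⟨(r : ℕ) - 2, by omega⟩]
    · rw [if_pos]; simp; omega
    · intro b _ hb
      rw [if_neg]
      intro h'; apply hb; ext; simp; omega
    · simp
  · refine Finset.sum_eq_zero fun b _ => ?_
    rw [if_neg (by omega)]

lemma entryF_succ (hc : c ≠ 0) (hac : c ^ 2 < 2 * a) (r j : ℕ) :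
    entryF a c x t r (j + 1) = lamRow a c r * entryF a c x t r j +
      if 2 ≤ r then entryF a c x t (r - 2) j else 0 := by
  rw [entryF_eq, entryF_eq, entryF_eq,
    taylorCoeff_succ (analyticAt_eigF x t hc (lamRow_ne_zero hac r))]
  congr 1
  split_ifs with h
  · obtain ⟨r, rfl⟩ := Nat.exists_eq_add_of_le h
    have : lamRow a c (2 + r) = lamRow a c r := by simpa using lamRow_mod (a := a) (c := c) r 1
    rw [this, show 2 + r - 2 = r by omega, show (2 + r) / 2 = r / 2 + 1 by omega]
  · rw [show r / 2 = 0 by omega, taylorCoeff_zero, eigF_eq_zero x t hc hac, mul_zero]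

lemma entryG_succ (hc : c ≠ 0) (hac : c ^ 2 < 2 * a) (r j : ℕ) :
    entryG a c x t r (j + 1) = lamRow a c r * entryG a c x t r j +
      if 2 ≤ r then entryG a c x t (r - 2) j else 0 := by
  rw [entryG_eq, entryG_eq, entryG_eq,
    taylorCoeff_succ (analyticAt_eigG x t hc (lamRow_ne_zero hac r))]
  congr 1
  split_ifs with h
  · obtain ⟨r, rfl⟩ := Nat.exists_eq_add_of_le h
    have : lamRow a c (2 + r) = lamRow a c r := by simpa using lamRow_mod (a := a) (c := c) r 1
    rw [this, show 2 + r - 2 = r by omega, show (2 + r) / 2 = r / 2 + 1 by omega]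
  · rw [show r / 2 = 0 by omega, taylorCoeff_zero, eigG_eq_zero x t hc hac, mul_zero]

/-- Raising the exponent reverses its parity, so multiplication by λ carries the columns of δ₂₁ to
columns of δ₁₁. The missing predecessor of the first two rows is the vanishing order-0 term. -/
lemma rowH_shift (hc : c ≠ 0) (hac : c ^ 2 < 2 * a) (r j : ℕ) :
    rowH (entryF a c x t) (entryG a c x t) r (j + 1) =
      lamRow a c r * rowH (entryG a c x t) (entryF a c x t) r j +
      if 2 ≤ r then rowH (entryG a c x t) (entryF a c x t) (r - 2) j else 0 := by
  by_cases h : Odd j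
  · have h' : ¬Odd (j + 1) := by rw [Nat.not_odd_iff_even]; exact h.add_one
    simp only [rowH, h, h', if_true, if_false]
    exact entryF_succ x t hc hac r j
  · have h' : Odd (j + 1) := (Nat.not_odd_iff_even.mp h).add_one
    simp only [rowH, h, h', if_true, if_false]
    exact entryG_succ x t hc hac r j

/-- Replacing exponent 0 by exponent n leaves the exponents 1, …, n, that is, the shifted columns of
δ₂₁ in cyclic order. The shift contributes (λ₁λ₂)^{k+1} and the rotation of an even number of
columns contributes -1. -/
lemma updateCol_last_det (hc : c ≠ 0) (hac : c ^ 2 < 2 * a) (k : ℕ) :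
    ((descMatrix (2 * k + 2) (rowH (entryF a c x t) (entryG a c x t))).updateCol (Fin.last _)
      fun r => entryF a c x t r (2 * k + 2)).det =
      -((-(a / 2) : ℂ) ^ (k + 1) * delta21 a c (k + 1) x t) := by
  set M := (descMatrix (2 * k + 2) (rowH (entryF a c x t) (entryG a c x t))).updateCol
    (Fin.last _) fun r => entryF a c x t r (2 * k + 2)
  have e : M = (shiftMatrix a c (2 * k + 2) *
      descMatrix (2 * k + 2) (rowH (entryG a c x t) (entryF a c x t))).submatrix id
        (finRotate (2 * k + 2)) := by
    ext r s
    have hsh : ∀ (r s : Fin (2 * k + 2)), (shiftMatrix a c (2 * k + 2) *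
        descMatrix (2 * k + 2) (rowH (entryG a c x t) (entryF a c x t))) r s =
        rowH (entryF a c x t) (entryG a c x t) r (2 * k + 1 - s + 1) := by
      intro r s
      rw [shiftMatrix_mul, rowH_shift x t hc hac]
      simp only [descMatrix, Matrix.of_apply]
      congr 1
    simp only [M, Matrix.submatrix_apply, id, hsh, Matrix.updateCol_apply]
    by_cases hs : s = Fin.last (2 * k + 1)
    · subst hs
      rw [if_pos rfl, finRotate_last]
      have : ¬Odd (2 * k + 2) := by rw [Nat.not_odd_iff_even]; exact ⟨k + 1, by ring⟩
      simp [rowH, this]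
    · rw [if_neg hs]
      have hlt : (s : ℕ) < 2 * k + 1 := by
        have h1 := s.isLt
        have h2 : (s : ℕ) ≠ 2 * k + 1 := fun h => hs (Fin.ext (by simpa using h))
        omega
      rw [coe_finRotate_of_ne_last hs]
      simp only [descMatrix, Matrix.of_apply]
      congr 1
      omega
  rw [e, Matrix.det_permute', sign_finRotate, Matrix.det_mul,
    show shiftMatrix a c (2 * k + 2) = shiftMatrix a c (2 * (k + 1)) from rfl,
    shiftMatrix_det hac, delta21, det21_eq]
  have : (2 * k + 2 - 1) = 2 * k + 1 := by omega
  rw [this, Odd.neg_one_pow ⟨k, rfl⟩]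
  simp only [Units.val_neg, Units.val_one, Int.cast_neg, Int.cast_one, neg_mul, one_mul]
  rfl

/-! ### The formula in terms of the annihilator -/

/-- `(P, R)` is the monic annihilator of degree `2 k`. -/
structure IsMonicAnnihilator (a c : ℝ) (K : ℕ) (x t : ℝ) (k : ℕ) (P R : ℂ[X]) : Prop where
  annihilates : Annihilates a c K x t k P R
  evenOdd : EvenOdd P R
  natDegree_fst : P.natDegree ≤ 2 * k
  natDegree_snd : R.natDegree < 2 * k ∨ R = 0
  coeff_fst : P.coeff (2 * k) = 1

variable {x t} {P R : ℂ[X]}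

lemma coeff_of_even (h : reflP P = P) {j : ℕ} (hj : Odd j) : P.coeff j = 0 := by
  have := congrArg (fun p => p.coeff j) h
  simp only [coeff_reflP, hj.neg_one_pow] at this
  linear_combination -this / 2

lemma coeff_of_odd (h : reflP R = -R) {j : ℕ} (hj : ¬Odd j) : R.coeff j = 0 := by
  have := congrArg (fun p => p.coeff j) h
  simp only [coeff_reflP, (Nat.not_odd_iff_even.mp hj).neg_one_pow, coeff_neg] at this
  linear_combination this / 2

/-- Coefficients of the monic annihilator as the unknowns of a linear system. -/
lemma IsMonicAnnihilator.system (hc : c ≠ 0) (hac : c ^ 2 < 2 * a) (hk : 1 ≤ k) (hK : k ≤ K + 1)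
    (h : IsMonicAnnihilator a c K x t k P R) :
    (descMatrix (2 * k) (rowH (entryF a c x t) (entryG a c x t))).mulVec
      (fun s => (fun j => if Odd j then halfPhase a c x t ^ 2 * R.coeff j else P.coeff j)
        (2 * k - 1 - s)) = -fun r : Fin (2 * k) => entryF a c x t r (2 * k) := by
  set e := halfPhase a c x t with he
  have he0 : e ≠ 0 := halfPhase_ne_zero a c x t
  -- The components f and g carry the opposite phases e^{±iθ/2}, so the coefficients of R have to be
  -- multiplied by e^{iθ} to solve the system in the entries.
  have hR : R = C (e⁻¹ ^ 2) * (C (e ^ 2) * R) := by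
    rw [← mul_assoc, ← C_mul, ← mul_pow, inv_mul_cancel₀ he0]; simp
  have hann := h.annihilates
  have hRd : R.natDegree < 2 * k := by
    rcases h.natDegree_snd with h | h
    · exact h
    · rw [h, natDegree_zero]; omega
  rw [hR, annihilates_iff x t hc hac hK (n := 2 * k + 1) (by have := h.natDegree_fst; omega)
    ((natDegree_C_mul_le _ _).trans_lt (by omega))] at hann
  ext r
  rw [descMatrix_mulVec _ (fun j => if Odd j then e ^ 2 * R.coeff j else P.coeff j)]
  have := hann r r.isLt
  rw [Finset.sum_range_succ, h.coeff_fst, coeff_C_mul,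
    coeff_eq_zero_of_natDegree_lt hRd] at this
  simp only [Pi.neg_apply]
  rw [eq_neg_iff_add_eq_zero, ← this]
  simp only [one_mul, mul_zero, zero_mul, add_zero]
  congr 1
  refine Finset.sum_congr rfl fun j _ => ?_
  rw [coeff_C_mul]
  by_cases hj : Odd j
  · simp [rowH, hj, coeff_of_even h.evenOdd.1 hj, mul_comm]
  · simp [rowH, hj, coeff_of_odd h.evenOdd.2 hj, mul_comm]

/-- Cramer's rule in the form that needs no invertibility. -/
lemma det_updateCol_mulVec {n : ℕ} (M : Matrix (Fin n) (Fin n) ℂ) (v : Fin n → ℂ) (s : Fin n) :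
    (M.updateCol s (M.mulVec v)).det = M.det * v s := by
  rw [← Matrix.cramer_apply, Matrix.cramer_eq_adjugate_mulVec, Matrix.mulVec_mulVec,
    Matrix.adjugate_mul, Matrix.smul_mulVec, Matrix.one_mulVec]
  rfl

/-- Cramer's rule for the first unknown, which is attached to the odd exponent 2k - 1 and hence to
R. -/
lemma IsMonicAnnihilator.delta12 (hc : c ≠ 0) (hac : c ^ 2 < 2 * a) (hk : 1 ≤ k) (hK : k ≤ K + 1)
    (h : IsMonicAnnihilator a c K x t k P R) :
    delta12 a c k x t =
      -(delta11 a c k x t * (halfPhase a c x t ^ 2 * R.coeff (2 * k - 1))) := by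
  have : NeZero (2 * k) := ⟨by omega⟩
  have := det_updateCol_mulVec (descMatrix (2 * k) (rowH (entryF a c x t) (entryG a c x t)))
    (fun s => (fun j => if Odd j then halfPhase a c x t ^ 2 * R.coeff j else P.coeff j)
        (2 * k - 1 - s)) 0
  rw [h.system hc hac hk hK] at this
  have hodd : Odd (2 * k - 1) := ⟨k - 1, by omega⟩
  have hneg : (-fun r : Fin (2 * k) => entryF a c x t r (2 * k)) =
    (-1 : ℂ) • fun r : Fin (2 * k) => entryF a c x t r (2 * k) := by ext; simp
  rw [hneg, Matrix.det_updateCol_smul] at this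
  rw [DNLS.delta12, det12_eq, DNLS.delta11, det11_eq]
  simp only [Fin.val_zero, Nat.sub_zero, hodd, if_true] at this
  linear_combination -this

/-- Cramer's rule for the last unknown, the constant term of P, combined with the column shift that
recognizes δ₂₁. -/
lemma IsMonicAnnihilator.delta21 (hc : c ≠ 0) (hac : c ^ 2 < 2 * a) (hk : 1 ≤ k) (hK : k ≤ K + 1)
    (h : IsMonicAnnihilator a c K x t k P R) :
    (-(a / 2) : ℂ) ^ k * delta21 a c k x t = delta11 a c k x t * P.coeff 0 := by
  obtain ⟨k, rfl⟩ := Nat.exists_eq_add_of_le' hk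
  have := det_updateCol_mulVec (descMatrix (2 * (k + 1)) (rowH (entryF a c x t) (entryG a c x t)))
    (fun s => (fun j => if Odd j then halfPhase a c x t ^ 2 * R.coeff j else P.coeff j)
        (2 * (k + 1) - 1 - s)) (Fin.last (2 * k + 1))
  rw [h.system hc hac hk hK] at this
  have hneg : (-fun r : Fin (2 * (k + 1)) => entryF a c x t r (2 * (k + 1))) =
    (-1 : ℂ) • fun r : Fin (2 * (k + 1)) => entryF a c x t r (2 * (k + 1)) := by ext; simp
  have h2 := updateCol_last_det x t hc hac k
  have hl : 2 * (k + 1) - 1 - ((Fin.last (2 * k + 1) : Fin (2 * (k + 1))) : ℕ) = 0 := by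
    simp; omega
  rw [hneg, Matrix.det_updateCol_smul, hl] at this
  rw [DNLS.delta11, det11_eq]
  simp only [Nat.odd_iff, Nat.zero_mod, zero_ne_one, if_false] at this
  have e2 : (descMatrix (2 * (k + 1)) (rowH (entryF a c x t) (entryG a c x t))).updateCol
    (Fin.last (2 * k + 1)) (fun r => entryF a c x t r (2 * (k + 1))) =
    (descMatrix (2 * k + 2) (rowH (entryF a c x t) (entryG a c x t))).updateCol
    (Fin.last _) (fun r => entryF a c x t r (2 * k + 2)) := rfl
  rw [e2] at this
  linear_combination this + h2

lemma IsMonicAnnihilator.normSq_coeff_zero (hc : c ≠ 0) (hac : c ^ 2 < 2 * a)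
    (h : IsMonicAnnihilator a c K x t k P R) :
    P.coeff 0 * conj (P.coeff 0) = ((a / 2) ^ k) ^ 2 := by
  have := congrArg (fun p => p.coeff 0) (h.evenOdd.norm_eq hc (pos_of_lt hac).ne' h.annihilates
    h.natDegree_fst h.coeff_fst h.natDegree_snd)
  simp only [coeff_add, mul_coeff_zero, coeff_conjP, coeff_zero_of_odd h.evenOdd.2, zero_mul,
    add_zero] at this
  have h1 : (quadP ℂ a c).eval 0 = -(a / 2) := by simp [quadP]
  have h2 : (quadM ℂ a c).eval 0 = -(a / 2) := by simp [quadM]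
  rw [this, coeff_zero_eq_eval_zero, eval_pow, eval_mul, h1, h2, ← pow_mul, mul_comm k 2, pow_mul]
  congr 1
  ring

/-- The ratio δ₁₁/δ₂₁ is (-a/2)^k / P(0), and |P(0)| = (a/2)^k makes its square the unimodular
number P(0)*/P(0). -/
lemma IsMonicAnnihilator.rogueWave_eq (hc : c ≠ 0) (hac : c ^ 2 < 2 * a) (hk : 1 ≤ k)
    (hK : k ≤ K + 1) (h : IsMonicAnnihilator a c K x t k P R) :
    rogueWave a c k x t = (conj (P.coeff 0) / P.coeff 0) *
      (halfPhase a c x t ^ 2 * (c - 2 * Complex.I * R.coeff (2 * k - 1))) := by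
  have h11 := delta11_ne_zero x t hc hac hk
  have h21 := delta21_ne_zero x t hc hac hk
  have e12 := h.delta12 hc hac hk hK
  have e21 := h.delta21 hc hac hk hK
  have e0 := h.normSq_coeff_zero hc hac
  have ha : (a : ℂ) ≠ 0 := by exact_mod_cast (pos_of_lt hac).ne'
  have hP : P.coeff 0 ≠ 0 := by
    intro h0
    rw [h0, zero_mul] at e0
    exact pow_ne_zero 2 (pow_ne_zero k (div_ne_zero ha two_ne_zero)) e0.symm
  have hsq : ((-(a / 2) : ℂ) ^ k) ^ 2 = ((a / 2) ^ k) ^ 2 := by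
    rw [← pow_mul, ← pow_mul, mul_comm k 2, pow_mul, pow_mul, neg_sq]
  have hr : delta11 a c k x t ^ 2 / DNLS.delta21 a c k x t ^ 2 =
      conj (P.coeff 0) / P.coeff 0 := by
    rw [div_eq_div_iff (pow_ne_zero 2 h21) hP]
    apply mul_right_cancel₀ hP
    linear_combination (DNLS.delta21 a c k x t ^ 2) * (hsq - e0) -
      ((-(a / 2) : ℂ) ^ k * DNLS.delta21 a c k x t + delta11 a c k x t * P.coeff 0) * e21
  rw [rogueWave, newPotential, e12, seed_eq, ← hr]
  ring

lemma IsMonicAnnihilator.norm_rogueWave (hc : c ≠ 0) (hac : c ^ 2 < 2 * a) (hk : 1 ≤ k)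
    (hK : k ≤ K + 1) (h : IsMonicAnnihilator a c K x t k P R) :
    ‖rogueWave a c k x t‖ = ‖(c : ℂ) - 2 * Complex.I * R.coeff (2 * k - 1)‖ := by
  have e0 := h.normSq_coeff_zero hc hac
  have ha : (a : ℂ) ≠ 0 := by exact_mod_cast (pos_of_lt hac).ne'
  have hP : P.coeff 0 ≠ 0 := by
    intro h0
    rw [h0, zero_mul] at e0
    exact pow_ne_zero 2 (pow_ne_zero k (div_ne_zero ha two_ne_zero)) e0.symm
  have h1 : ‖halfPhase a c x t‖ = 1 := by
    have := Complex.mul_conj (halfPhase a c x t)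
    rw [conj_halfPhase, mul_inv_cancel₀ (halfPhase_ne_zero a c x t)] at this
    have h2 : Complex.normSq (halfPhase a c x t) = 1 := by exact_mod_cast this.symm
    rw [Complex.normSq_eq_norm_sq] at h2
    nlinarith [norm_nonneg (halfPhase a c x t)]
  rw [h.rogueWave_eq hc hac hk hK, norm_mul, norm_mul, norm_div, norm_pow, h1, RCLike.norm_conj,
    div_self (norm_ne_zero_iff.mpr hP)]
  simp

end

end DNLS

namespace DNLS

open Polynomial ComplexConjugate Filter Topology

noncomputable section

/-! ### Confluence of the eigenvalues -/

lemma sum_range_two_mul {M : Type*} [AddCommMonoid M] (k : ℕ) (g : ℕ → M) :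
    ∑ j ∈ Finset.range (2 * k), g j = ∑ m ∈ Finset.range k, (g (2 * m) + g (2 * m + 1)) := by
  induction k with
  | zero => simp
  | succ k ih =>
    rw [show 2 * (k + 1) = 2 * k + 1 + 1 by ring, Finset.sum_range_succ, Finset.sum_range_succ, ih,
      Finset.sum_range_succ, add_assoc]

lemma sum_range_parity (k r : ℕ) (g : ℕ → ℂ) :
    ∑ j ∈ Finset.range (2 * k), (if j % 2 = r % 2 then g j else 0) =
      ∑ m ∈ Finset.range k, g (2 * m + r % 2) := by
  rw [sum_range_two_mul]
  refine Finset.sum_congr rfl fun m _ => ?_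
  have h1 : (2 * m) % 2 = 0 := by omega
  have h2 : (2 * m + 1) % 2 = 1 := by omega
  rcases Nat.mod_two_eq_zero_or_one r with h | h <;> simp [h1, h2, h]

/-- `ε` in even rows and its conjugate in odd rows. -/
def rowScale (ε : ℂ) (r : ℕ) : ℂ := if Even r then ε else conj ε

/-- The direction in which the eigenvalue of row `r` leaves its limit. -/
def rowNode (d : ℕ → ℂ) (r : ℕ) : ℂ := if Even r then d (r / 2) else -conj (d (r / 2))

/-- Two interlaced Vandermonde matrices. -/
def nodeMatrix (d : ℕ → ℂ) (k : ℕ) : Matrix (Fin (2 * k)) (Fin (2 * k)) ℂ :=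
  Matrix.of fun r r' => if (r' : ℕ) % 2 = r % 2 then rowNode d r ^ ((r' : ℕ) / 2 + 1) else 0

/-- The change of basis from the rows at distinct eigenvalues to Taylor coefficients. -/
def confluentMatrix (d : ℕ → ℂ) (k : ℕ) (ε : ℂ) : Matrix (Fin (2 * k)) (Fin (2 * k)) ℂ :=
  nodeMatrix d k * Matrix.diagonal fun r' : Fin (2 * k) => rowScale ε r' ^ ((r' : ℕ) / 2 + 1)

variable {d : ℕ → ℂ} {k : ℕ}

lemma nodeMatrix_mulVec (v : ℕ → ℂ) (r : Fin (2 * k)) :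
    (nodeMatrix d k).mulVec (fun r' => v r') r =
      ∑ m ∈ Finset.range k, rowNode d r ^ (m + 1) * v (2 * m + r % 2) := by
  have := sum_range_parity k r fun j => rowNode d r ^ (j / 2 + 1) * v j
  have e : ∀ m, (2 * m + (r : ℕ) % 2) / 2 = m := fun m => by omega
  simp only [e] at this
  rw [← this, Matrix.mulVec, dotProduct, ← Fin.sum_univ_eq_sum_range
    (fun j => if j % 2 = (r : ℕ) % 2 then rowNode d r ^ (j / 2 + 1) * v j else 0)]
  refine Finset.sum_congr rfl fun j _ => ?_
  simp only [nodeMatrix, Matrix.of_apply]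
  split_ifs <;> simp

/-- Even and odd rows decouple into two Vandermonde systems with distinct nodes. The exponents start
at 1, which is why the nodes must also be nonzero. -/
lemma nodeMatrix_det_ne_zero (hd : Set.InjOn d (Set.Iio k)) (hd0 : ∀ l < k, d l ≠ 0) :
    (nodeMatrix d k).det ≠ 0 := by
  intro h0
  obtain ⟨v, hv, hv0⟩ := Matrix.exists_mulVec_eq_zero_iff.mpr h0
  set w : ℕ → ℂ := fun j => if hj : j < 2 * k then v ⟨j, hj⟩ else 0 with hw
  have hvw : v = fun s : Fin (2 * k) => w s := by ext s; simp [hw]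
  apply hv
  rw [hvw] at hv0 ⊢
  have key : ∀ i < 2, ∀ m < k, w (2 * m + i) = 0 := by
    intro i hi
    have hnode : ∀ l : Fin k, rowNode d (2 * l + i) ≠ 0 := fun l => by
      have h1 : (2 * (l : ℕ) + i) / 2 = l := by omega
      simp only [rowNode, h1]
      split_ifs
      · exact hd0 l l.isLt
      · simpa using hd0 l l.isLt
    have hinj : Function.Injective fun l : Fin k => rowNode d (2 * l + i) := by
      intro l l' hll
      have h1 : (2 * (l : ℕ) + i) / 2 = l := by omega
      have h2 : (2 * (l' : ℕ) + i) / 2 = l' := by omega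
      have h3 : Even (2 * (l : ℕ) + i) ↔ Even (2 * (l' : ℕ) + i) := by simp [Nat.even_add]
      simp only [rowNode, h1, h2, h3] at hll
      have : d l = d l' := by
        split_ifs at hll
        · exact hll
        · exact (starRingEnd ℂ).injective (neg_injective hll)
      exact Fin.ext (hd l.isLt l'.isLt this)
    have := Matrix.eq_zero_of_forall_index_sum_mul_pow_eq_zero hinj
      (v := fun m : Fin k => w (2 * m + i)) fun l => by
        have h1 := congrFun hv0 ⟨2 * l + i, by omega⟩
        rw [nodeMatrix_mulVec] at h1
        have h2 : (2 * (l : ℕ) + i) % 2 = i := by omega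
        simp only [h2, Pi.zero_apply] at h1
        have h3 : rowNode d (2 * l + i) * ∑ m ∈ Finset.range k,
            w (2 * m + i) * rowNode d (2 * l + i) ^ m = 0 := by
          rw [← h1, Finset.mul_sum]
          exact Finset.sum_congr rfl fun m _ => by ring
        rw [← Fin.sum_univ_eq_sum_range (fun m => w (2 * m + i) * rowNode d (2 * l + i) ^ m)] at h3
        exact (mul_eq_zero.mp h3).resolve_left (hnode l)
    intro m hm
    exact congrFun this ⟨m, hm⟩
  ext s
  have := key (s % 2) (by omega) (s / 2) (by omega)
  rwa [Nat.div_add_mod] at this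

lemma rowScale_ne_zero {ε : ℂ} (hε : ε ≠ 0) (r : ℕ) : rowScale ε r ≠ 0 := by
  rw [rowScale]; split_ifs
  · exact hε
  · simpa using hε

lemma norm_rowScale (ε : ℂ) (r : ℕ) : ‖rowScale ε r‖ = ‖ε‖ := by
  rw [rowScale]; split_ifs <;> simp

lemma rowScale_mod (ε : ℂ) (m r : ℕ) : rowScale ε (2 * m + r % 2) = rowScale ε r := by
  simp [rowScale, Nat.even_iff]

lemma confluentMatrix_det_ne_zero (hd : Set.InjOn d (Set.Iio k)) (hd0 : ∀ l < k, d l ≠ 0)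
    {ε : ℂ} (hε : ε ≠ 0) : (confluentMatrix d k ε).det ≠ 0 := by
  rw [confluentMatrix, Matrix.det_mul, Matrix.det_diagonal]
  exact mul_ne_zero (nodeMatrix_det_ne_zero hd hd0)
    (Finset.prod_ne_zero_iff.mpr fun r _ => pow_ne_zero _ (rowScale_ne_zero hε r))

/-- The step from the limit eigenvalue of row `r`. -/
def rowStep (d : ℕ → ℂ) (ε : ℂ) (r : ℕ) : ℂ := rowNode d r * rowScale ε r

lemma tendsto_rowStep (r : ℕ) : Tendsto (fun ε => rowStep d ε r) (𝓝[≠] 0) (𝓝 0) := by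
  rw [tendsto_zero_iff_norm_tendsto_zero]
  simp only [rowStep, norm_mul, norm_rowScale]
  have : Tendsto (fun ε : ℂ => ‖rowNode d r‖ * ‖ε‖) (𝓝 0) (𝓝 (‖rowNode d r‖ * ‖(0 : ℂ)‖)) :=
    (by fun_prop : Continuous fun ε : ℂ => ‖rowNode d r‖ * ‖ε‖).tendsto 0
  simpa using this.mono_left nhdsWithin_le_nhds

/-- Taylor expansion of a function vanishing at `z`. -/
lemma exists_taylor_remainder {H : ℂ → ℂ} {z : ℂ} (hH : AnalyticAt ℂ H z) (h0 : H z = 0) (k : ℕ) :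
    ∃ ρ : ℂ → ℂ, ContinuousAt ρ 0 ∧ ∀ s, H (z + s) =
      ∑ m ∈ Finset.range k, s ^ (m + 1) *
        (iteratedDeriv (m + 1) H z / ((m + 1).factorial : ℂ)) + s ^ (k + 1) * ρ s := by
  have h1 : AnalyticAt ℂ (fun s => H (z + s)) 0 := by
    have : AnalyticAt ℂ H (z + 0) := by simpa using hH
    exact this.fun_comp (by fun_prop : AnalyticAt ℂ (fun s => z + s) 0)
  obtain ⟨ρ, hρ, e⟩ := h1.exists_eq_sum_add_pow_mul (k + 1)
  refine ⟨ρ, hρ.continuousAt, fun s => ?_⟩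
  rw [e s, Finset.sum_range_succ']
  simp only [iteratedDeriv_comp_const_add, add_zero, iteratedDeriv_zero, h0, smul_eq_mul, mul_zero]
  congr 1
  exact Finset.sum_congr rfl fun m _ => by ring

variable {a c : ℝ}

/-- Determinants with rows at merging eigenvalues, divided by the factor common to all of them,
tend to the determinant of the Taylor coefficients. -/
lemma tendsto_confluent_det (hd : Set.InjOn d (Set.Iio k)) (hd0 : ∀ l < k, d l ≠ 0)
    (H : Fin (2 * k) → ℂ → ℂ) (hH : ∀ s r, AnalyticAt ℂ (H s) (lamRow a c r))
    (hH0 : ∀ s r, H s (lamRow a c r) = 0) :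
    Tendsto (fun ε => (Matrix.of fun r s : Fin (2 * k) =>
        H s (lamRow a c r + rowStep d ε r)).det / (confluentMatrix d k ε).det) (𝓝[≠] 0)
      (𝓝 (Matrix.of fun r s : Fin (2 * k) =>
        iteratedDeriv ((r : ℕ) / 2 + 1) (H s) (lamRow a c r) /
          (((r : ℕ) / 2 + 1).factorial : ℂ)).det) := by
  choose ρ hρ hT using fun s r => exists_taylor_remainder (hH s r) (hH0 s r) k
  set N : Matrix (Fin (2 * k)) (Fin (2 * k)) ℂ := Matrix.of fun r s =>
    iteratedDeriv ((r : ℕ) / 2 + 1) (H s) (lamRow a c r) / (((r : ℕ) / 2 + 1).factorial : ℂ) with hN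
  set M : ℂ → Matrix (Fin (2 * k)) (Fin (2 * k)) ℂ := fun ε => Matrix.of fun r s =>
    H s (lamRow a c r + rowStep d ε r) with hM
  set E : ℂ → Matrix (Fin (2 * k)) (Fin (2 * k)) ℂ := fun ε => Matrix.of fun r s =>
    rowStep d ε r ^ (k + 1) * ρ s r (rowStep d ε r) with hE
  have hME : ∀ ε, M ε = confluentMatrix d k ε * N + E ε := by
    intro ε
    ext r s
    simp only [hM, hE, Matrix.of_apply, Matrix.add_apply, hT]
    congr 1
    rw [confluentMatrix, Matrix.mul_assoc]
    have hv : (nodeMatrix d k * (Matrix.diagonal (fun r' : Fin (2 * k) =>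
        rowScale ε r' ^ ((r' : ℕ) / 2 + 1)) * N)) r s =
        (nodeMatrix d k).mulVec (fun r' : Fin (2 * k) => (fun j : ℕ => rowScale ε j ^ (j / 2 + 1) *
          (iteratedDeriv (j / 2 + 1) (H s) (lamRow a c j) / ((j / 2 + 1).factorial : ℂ))) r') r := by
      rw [Matrix.mul_apply, Matrix.mulVec, dotProduct]
      refine Finset.sum_congr rfl fun j _ => ?_
      rw [Matrix.diagonal_mul, hN, Matrix.of_apply]
    rw [hv, nodeMatrix_mulVec (fun j : ℕ => rowScale ε j ^ (j / 2 + 1) *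
          (iteratedDeriv (j / 2 + 1) (H s) (lamRow a c j) / ((j / 2 + 1).factorial : ℂ)))]
    refine Finset.sum_congr rfl fun m _ => ?_
    have e : (2 * m + (r : ℕ) % 2) / 2 = m := by omega
    have e2 : lamRow a c (2 * m + (r : ℕ) % 2) = lamRow a c r := by
      rw [lamRow_mod, lamRow, lamRow]
      simp only [Nat.even_iff, Nat.mod_mod]
    rw [e, e2, rowScale_mod, rowStep, mul_pow]
    ring
  set W := (nodeMatrix d k)⁻¹
  have hW : W * nodeMatrix d k = 1 :=
    Matrix.nonsing_inv_mul _ (nodeMatrix_det_ne_zero hd hd0).isUnit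
  -- Q is the inverse of the confluent matrix applied to E, so the normalized determinant is det(N +
  -- Q).
  set Q : ℂ → Matrix (Fin (2 * k)) (Fin (2 * k)) ℂ := fun ε => Matrix.of fun r s =>
    ∑ r', W r r' * ((rowScale ε r ^ ((r : ℕ) / 2 + 1))⁻¹ * E ε r' s) with hQ
  have hdet : ∀ ε, ε ≠ 0 → (M ε).det / (confluentMatrix d k ε).det = (N + Q ε).det := by
    intro ε hε
    rw [div_eq_iff (confluentMatrix_det_ne_zero hd hd0 hε), mul_comm (N + Q ε).det, ← Matrix.det_mul, hME,
      Matrix.mul_add]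
    congr 2
    have h1 : Q ε = Matrix.diagonal (fun r : Fin (2 * k) =>
        (rowScale ε r ^ ((r : ℕ) / 2 + 1))⁻¹) * (W * E ε) := by
      ext r s
      rw [Matrix.diagonal_mul, Matrix.mul_apply, Finset.mul_sum]
      simp only [hQ, Matrix.of_apply]
      exact Finset.sum_congr rfl fun j _ => by ring
    rw [h1, confluentMatrix, Matrix.mul_assoc, ← Matrix.mul_assoc (Matrix.diagonal _),
      Matrix.diagonal_mul_diagonal]
    have h2 : (fun r : Fin (2 * k) => rowScale ε r ^ ((r : ℕ) / 2 + 1) *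
        (rowScale ε r ^ ((r : ℕ) / 2 + 1))⁻¹) = fun _ => 1 := by
      ext r
      exact mul_inv_cancel₀ (pow_ne_zero _ (rowScale_ne_zero hε r))
    rw [h2, Matrix.diagonal_one, Matrix.one_mul, ← Matrix.mul_assoc,
      Matrix.mul_nonsing_inv _ (nodeMatrix_det_ne_zero hd hd0).isUnit, Matrix.one_mul]
  have hQ0 : ∀ r s, Tendsto (fun ε => Q ε r s) (𝓝[≠] 0) (𝓝 0) := by
    intro r s
    simp only [hQ, Matrix.of_apply]
    have h0 : (∑ r' : Fin (2 * k), W r r' * 0) = 0 := by simp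
    rw [← congrArg 𝓝 h0]
    refine tendsto_finsetSum _ fun r' _ => Tendsto.const_mul _ ?_
    have hb : Tendsto (fun ε => rowNode d r' ^ (k + 1) * ρ s r' (rowStep d ε r')) (𝓝[≠] 0)
        (𝓝 (rowNode d r' ^ (k + 1) * ρ s r' 0)) :=
      Tendsto.const_mul _ ((hρ s r').tendsto.comp (tendsto_rowStep r'))
    -- The modulus is |ε| to the power k - ⌊r/2⌋, which is positive because r < 2k.
    have hz : Tendsto (fun ε => (rowScale ε r ^ ((r : ℕ) / 2 + 1))⁻¹ * rowScale ε r' ^ (k + 1))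
        (𝓝[≠] 0) (𝓝 0) := by
      rw [tendsto_zero_iff_norm_tendsto_zero]
      have hr := r.isLt
      obtain ⟨j, hj⟩ := Nat.exists_eq_add_of_le (show (r : ℕ) / 2 + 1 ≤ k by omega)
      have h1 : Tendsto (fun ε : ℂ => ‖ε‖ ^ (j + 1)) (𝓝[≠] 0) (𝓝 0) := by
        have : Tendsto (fun ε : ℂ => ‖ε‖ ^ (j + 1)) (𝓝 0) (𝓝 (‖(0 : ℂ)‖ ^ (j + 1))) :=
          (by fun_prop : Continuous fun ε : ℂ => ‖ε‖ ^ (j + 1)).tendsto 0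
        simpa using this.mono_left nhdsWithin_le_nhds
      refine h1.congr' ?_
      filter_upwards [self_mem_nhdsWithin] with ε hε
      have hε' : ‖ε‖ ≠ 0 := norm_ne_zero_iff.mpr hε
      rw [norm_mul, norm_inv, norm_pow, norm_pow, norm_rowScale, norm_rowScale,
        show k + 1 = ((r : ℕ) / 2 + 1) + (j + 1) by omega,
        pow_add _ ((r : ℕ) / 2 + 1), inv_mul_cancel_left₀ (pow_ne_zero _ hε')]
    have := hz.mul hb
    rw [zero_mul] at this
    refine this.congr fun ε => ?_
    simp only [hE, Matrix.of_apply, rowStep, mul_pow]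
    ring
  have hlim : Tendsto (fun ε => (N + Q ε).det) (𝓝[≠] 0) (𝓝 N.det) := by
    have : Tendsto (fun ε => N + Q ε) (𝓝[≠] 0) (𝓝 N) := by
      refine tendsto_pi_nhds.mpr fun r => tendsto_pi_nhds.mpr fun s => ?_
      have := (tendsto_const_nhds (x := N r s)).add (hQ0 r s)
      simpa using this
    exact ((continuous_id.matrix_det).tendsto N).comp this
  refine hlim.congr' ?_
  filter_upwards [self_mem_nhdsWithin] with ε hε
  exact (hdet ε hε).symm

variable (x t : ℝ)

/-- The partner eigenvalue moves with the conjugate of ε; this is the reason for the row-dependent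
scale and node. -/
lemma neg_conj_node (ε : ℂ) (r : ℕ) :
    (if Even r then lam1 a c + d (r / 2) * ε else -conj (lam1 a c + d (r / 2) * ε)) =
      lamRow a c r + rowStep d ε r := by
  rw [lamRow, rowStep, rowNode, rowScale]
  split_ifs
  · rfl
  · rw [lam2, map_add, map_mul]; ring

lemma darbouxF_eq (ε : ℂ) (r j : ℕ) :
    darbouxF a c x t (fun l => lam1 a c + d l * ε) r j =
      (lamRow a c r + rowStep d ε r) ^ j * eigF a c x t (lamRow a c r + rowStep d ε r) := by
  rw [← neg_conj_node, darbouxF]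
  split_ifs
  · rfl
  · rw [eigF_neg_conj]

lemma darbouxG_eq (ε : ℂ) (r j : ℕ) :
    darbouxG a c x t (fun l => lam1 a c + d l * ε) r j =
      (lamRow a c r + rowStep d ε r) ^ j * eigG a c x t (lamRow a c r + rowStep d ε r) := by
  rw [← neg_conj_node, darbouxG]
  split_ifs
  · rfl
  · rw [eigG_neg_conj]

/-- The formula is homogeneous of degree 0 in the determinants, so the factor that tends to zero in
the confluence drops out. For z = 0 both sides are 0 by the convention for division. -/
lemma newPotential_div (q x y z s : ℂ) (hs : s ≠ 0) :
    newPotential q (x / s) (y / s) (z / s) = newPotential q x y z := by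
  rw [newPotential, newPotential]
  by_cases hz : z = 0
  · simp [hz]
  · field_simp

/-- The rogue wave is the limit of Darboux transforms with merging eigenvalues. -/
lemma tendsto_darbouxSolution (hc : c ≠ 0) (hac : c ^ 2 < 2 * a) (hk : 1 ≤ k)
    (hd : Set.InjOn d (Set.Iio k)) (hd0 : ∀ l < k, d l ≠ 0) :
    Tendsto (fun ε : ℂ => darbouxSolution a c k (fun l => lam1 a c + d l * ε) x t)
      (𝓝[≠] 0) (𝓝 (rogueWave a c k x t)) := by
  have hF : ∀ j r, AnalyticAt ℂ (fun l => l ^ j * eigF a c x t l) (lamRow a c r) := fun j r => by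
    have := analyticAt_eigF (a := a) x t hc (lamRow_ne_zero hac r)
    fun_prop
  have hG : ∀ j r, AnalyticAt ℂ (fun l => l ^ j * eigG a c x t l) (lamRow a c r) := fun j r => by
    have := analyticAt_eigG (a := a) x t hc (lamRow_ne_zero hac r)
    fun_prop
  have hF0 : ∀ j r, (fun l => l ^ j * eigF a c x t l) (lamRow a c r) = 0 := fun j r => by
    simp [eigF_eq_zero x t hc hac]
  have hG0 : ∀ j r, (fun l => l ^ j * eigG a c x t l) (lamRow a c r) = 0 := fun j r => by
    simp [eigG_eq_zero x t hc hac]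
  have h11 : Tendsto (fun ε : ℂ => det11 (2 * k)
      (darbouxF a c x t (fun l => lam1 a c + d l * ε))
      (darbouxG a c x t (fun l => lam1 a c + d l * ε)) / (confluentMatrix d k ε).det) (𝓝[≠] 0)
      (𝓝 (delta11 a c k x t)) := by
    convert tendsto_confluent_det (a := a) (c := c) hd hd0
      (fun s => if Odd (2 * k - 1 - (s : ℕ)) then fun l => l ^ (2 * k - 1 - (s : ℕ)) * eigG a c x t l
        else fun l => l ^ (2 * k - 1 - (s : ℕ)) * eigF a c x t l)
      (fun s r => by split_ifs; exacts [hG _ r, hF _ r])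
      (fun s r => by split_ifs; exacts [hG0 _ r, hF0 _ r]) using 2
    · rw [det11]
      congr 2
      ext r s
      simp only [Matrix.of_apply, darbouxF_eq, darbouxG_eq]
      split_ifs <;> rfl
    · rw [delta11, det11]
      congr 1
      ext r s
      simp only [Matrix.of_apply, entryF_eq, entryG_eq, taylorCoeff]
      split_ifs <;> rfl
  have h21 : Tendsto (fun ε : ℂ => det21 (2 * k)
      (darbouxF a c x t (fun l => lam1 a c + d l * ε))
      (darbouxG a c x t (fun l => lam1 a c + d l * ε)) / (confluentMatrix d k ε).det) (𝓝[≠] 0)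
      (𝓝 (delta21 a c k x t)) := by
    convert tendsto_confluent_det (a := a) (c := c) hd hd0
      (fun s => if Odd (2 * k - 1 - (s : ℕ)) then fun l => l ^ (2 * k - 1 - (s : ℕ)) * eigF a c x t l
        else fun l => l ^ (2 * k - 1 - (s : ℕ)) * eigG a c x t l)
      (fun s r => by split_ifs; exacts [hF _ r, hG _ r])
      (fun s r => by split_ifs; exacts [hF0 _ r, hG0 _ r]) using 2
    · rw [det21]
      congr 2
      ext r s
      simp only [Matrix.of_apply, darbouxF_eq, darbouxG_eq]
      split_ifs <;> rfl
    · rw [delta21, det21]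
      congr 1
      ext r s
      simp only [Matrix.of_apply, entryF_eq, entryG_eq, taylorCoeff]
      split_ifs <;> rfl
  have h12 : Tendsto (fun ε : ℂ => det12 (2 * k)
      (darbouxF a c x t (fun l => lam1 a c + d l * ε))
      (darbouxG a c x t (fun l => lam1 a c + d l * ε)) / (confluentMatrix d k ε).det) (𝓝[≠] 0)
      (𝓝 (delta12 a c k x t)) := by
    convert tendsto_confluent_det (a := a) (c := c) hd hd0
      (fun s => if (s : ℕ) = 0 then fun l => l ^ (2 * k) * eigF a c x t l else
        if Odd (2 * k - 1 - (s : ℕ)) then fun l => l ^ (2 * k - 1 - (s : ℕ)) * eigG a c x t l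
        else fun l => l ^ (2 * k - 1 - (s : ℕ)) * eigF a c x t l)
      (fun s r => by split_ifs; exacts [hF _ r, hG _ r, hF _ r])
      (fun s r => by split_ifs; exacts [hF0 _ r, hG0 _ r, hF0 _ r]) using 2
    · rw [det12]
      congr 2
      ext r s
      simp only [Matrix.of_apply, darbouxF_eq, darbouxG_eq]
      split_ifs <;> rfl
    · rw [delta12, det12]
      congr 1
      ext r s
      simp only [Matrix.of_apply, entryF_eq, entryG_eq, taylorCoeff]
      split_ifs <;> rfl
  have hδ := delta21_ne_zero x t hc hac hk
  have := (((h11.pow 2).div (h21.pow 2) (pow_ne_zero 2 hδ)).mul_const (seed a c x t)).add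
    (Tendsto.const_mul (2 * Complex.I) ((h11.mul h12).div (h21.pow 2) (pow_ne_zero 2 hδ)))
  refine this.congr' ?_
  filter_upwards [self_mem_nhdsWithin] with ε hε
  rw [darbouxSolution, ← newPotential_div _ _ _ _ _ (confluentMatrix_det_ne_zero hd hd0 hε)]
  rfl

end

end DNLS

namespace DNLS

open Polynomial ComplexConjugate

noncomputable section

/-! ### The ring of smooth functions on the plane -/

/-- Smooth complex-valued functions on the `(x, t)`-plane. -/
def smoothSubalgebra : StarSubalgebra ℂ (ℝ × ℝ → ℂ) where
  carrier := {f | ContDiff ℝ (⊤ : ℕ∞) f}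
  mul_mem' {f g} hf hg := by
    have hf' : ContDiff ℝ (⊤ : ℕ∞) f := hf
    have hg' : ContDiff ℝ (⊤ : ℕ∞) g := hg
    have h : ContDiff ℝ (⊤ : ℕ∞) (f * g) := hf'.mul hg'
    exact h
  one_mem' := by
    have h : ContDiff ℝ (⊤ : ℕ∞) (1 : ℝ × ℝ → ℂ) := contDiff_const
    exact h
  add_mem' {f g} hf hg := by
    have hf' : ContDiff ℝ (⊤ : ℕ∞) f := hf
    have hg' : ContDiff ℝ (⊤ : ℕ∞) g := hg
    have h : ContDiff ℝ (⊤ : ℕ∞) (f + g) := hf'.add hg'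
    exact h
  zero_mem' := by
    have h : ContDiff ℝ (⊤ : ℕ∞) (0 : ℝ × ℝ → ℂ) := contDiff_const
    exact h
  algebraMap_mem' z := by
    have h : ContDiff ℝ (⊤ : ℕ∞) (algebraMap ℂ (ℝ × ℝ → ℂ) z) := contDiff_const
    exact h
  star_mem' {f} hf := by
    have hf' : ContDiff ℝ (⊤ : ℕ∞) f := hf
    have h : ContDiff ℝ (⊤ : ℕ∞) (star f) := Complex.conjCLE.contDiff.comp hf'
    exact h

/-- The ring of smooth complex-valued functions on the `(x, t)`-plane. -/
def smoothFn : Type := smoothSubalgebra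

instance : CommRing smoothFn := inferInstanceAs (CommRing smoothSubalgebra)
instance : Algebra ℂ smoothFn := inferInstanceAs (Algebra ℂ smoothSubalgebra)
instance : StarRing smoothFn := inferInstanceAs (StarRing smoothSubalgebra)
instance : CoeOut smoothFn (ℝ × ℝ → ℂ) := ⟨Subtype.val⟩

/-- A smooth function as an element of the ring. -/
def smoothFn.mk (f : ℝ × ℝ → ℂ) (h : ContDiff ℝ (⊤ : ℕ∞) f) : smoothFn := Subtype.mk f h

/-- Evaluation at a point. -/
def evalAt (p : ℝ × ℝ) : smoothFn →ₐ[ℂ] ℂ :=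
  (Pi.evalAlgHom ℂ (fun _ : ℝ × ℝ => ℂ) p).comp smoothSubalgebra.toSubalgebra.val

lemma evalAt_apply (p : ℝ × ℝ) (f : smoothFn) : evalAt p f = (f : ℝ × ℝ → ℂ) p := rfl

lemma evalAt_star (p : ℝ × ℝ) (f : smoothFn) : evalAt p (star f) = conj (evalAt p f) := rfl

lemma smoothFn_ext {f g : smoothFn} (h : ∀ p, evalAt p f = evalAt p g) : f = g :=
  Subtype.ext (funext h)

lemma contDiff_smoothFn (f : smoothFn) : ContDiff ℝ (⊤ : ℕ∞) (f : ℝ × ℝ → ℂ) := f.2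

lemma differentiable_smoothFn (f : smoothFn) : Differentiable ℝ (f : ℝ × ℝ → ℂ) :=
  (contDiff_smoothFn f).differentiable (by simp)

lemma isUnit_smoothFn {f : smoothFn} (h : ∀ p, evalAt p f ≠ 0) : IsUnit f := by
  refine IsUnit.of_mul_eq_one (smoothFn.mk _ ((contDiff_smoothFn f).inv h)) (smoothFn_ext fun p => ?_)
  rw [map_mul, map_one]
  exact mul_inv_cancel₀ (h p)

/-- The derivative in the direction `v`. -/
def dirDeriv (v : ℝ × ℝ) : Derivation ℂ smoothFn smoothFn where
  toFun f := smoothFn.mk (fun p => fderiv ℝ (f : ℝ × ℝ → ℂ) p v)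
    (((contDiff_smoothFn f).fderiv_right (m := (⊤ : ℕ∞)) (by simp)).clm_apply contDiff_const)
  map_add' f g := by
    refine smoothFn_ext fun p => ?_
    have := fderiv_add (differentiable_smoothFn f p) (differentiable_smoothFn g p)
    exact congrArg (fun L => L v) this
  map_smul' z f := by
    refine smoothFn_ext fun p => ?_
    have := fderiv_const_smul (differentiable_smoothFn f p) z
    exact congrArg (fun L => L v) this
  map_one_eq_zero' := by
    refine smoothFn_ext fun p => ?_
    have : fderiv ℝ (fun _ : ℝ × ℝ => (1 : ℂ)) p = 0 := fderiv_const_apply _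
    exact congrArg (fun L => L v) this
  leibniz' f g := by
    refine smoothFn_ext fun p => ?_
    have := fderiv_mul (differentiable_smoothFn f p) (differentiable_smoothFn g p)
    have h2 := congrArg (fun L => L v) this
    exact h2

lemma evalAt_dirDeriv (v p : ℝ × ℝ) (f : smoothFn) :
    evalAt p (dirDeriv v f) = fderiv ℝ (f : ℝ × ℝ → ℂ) p v := rfl

/-- Symmetry of the second derivative; it supplies the compatibility condition of the x- and
t-flows. -/
lemma dirDeriv_comm (v w : ℝ × ℝ) (f : smoothFn) :
    dirDeriv v (dirDeriv w f) = dirDeriv w (dirDeriv v f) := by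
  refine smoothFn_ext fun p => ?_
  have h : ContDiff ℝ (⊤ : ℕ∞) (f : ℝ × ℝ → ℂ) := contDiff_smoothFn f
  have hd : DifferentiableAt ℝ (fderiv ℝ (f : ℝ × ℝ → ℂ)) p :=
    (h.fderiv_right (m := (⊤ : ℕ∞)) (by simp)).differentiable (by simp) p
  have key : ∀ u u' : ℝ × ℝ, evalAt p (dirDeriv u (dirDeriv u' f)) =
      fderiv ℝ (fderiv ℝ (f : ℝ × ℝ → ℂ)) p u u' := fun u u' => by
    rw [evalAt_dirDeriv]
    have : ((dirDeriv u' f : smoothFn) : ℝ × ℝ → ℂ) =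
        fun y => fderiv ℝ (f : ℝ × ℝ → ℂ) y u' := rfl
    rw [this, fderiv_clm_apply hd (differentiableAt_const u')]
    simp
  rw [key, key]
  exact second_derivative_symmetric (fun y => (differentiable_smoothFn f y).hasFDerivAt)
    hd.hasFDerivAt v w

lemma dirDeriv_star (v : ℝ × ℝ) (f : smoothFn) : dirDeriv v (star f) = star (dirDeriv v f) := by
  refine smoothFn_ext fun p => ?_
  rw [evalAt_star, evalAt_dirDeriv, evalAt_dirDeriv]
  have h : HasFDerivAt ((star f : smoothFn) : ℝ × ℝ → ℂ) _ p :=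
    Complex.conjCLE.hasFDerivAt.comp p (differentiable_smoothFn f p).hasFDerivAt
  rw [h.fderiv]
  rfl

/-- Extension of a derivation to polynomials, acting on the coefficients. -/
def polyDeriv (D : Derivation ℂ smoothFn smoothFn) : Derivation ℤ smoothFn[X] smoothFn[X] :=
  @Differential.mapCoeffs smoothFn _ ⟨D.restrictScalars ℤ⟩

lemma coeff_polyDeriv (D : Derivation ℂ smoothFn smoothFn) (p : smoothFn[X]) (i : ℕ) :
    (polyDeriv D p).coeff i = D (p.coeff i) := rfl

lemma polyDeriv_C (D : Derivation ℂ smoothFn smoothFn) (f : smoothFn) :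
    polyDeriv D (C f) = C (D f) := by
  ext i
  rw [coeff_polyDeriv, coeff_C, coeff_C]
  split_ifs <;> simp

lemma polyDeriv_X (D : Derivation ℂ smoothFn smoothFn) : polyDeriv D X = 0 := by
  ext i
  rw [coeff_polyDeriv, coeff_X]
  split_ifs <;> simp

/-- The coordinate `x`. -/
def coordX : smoothFn :=
  smoothFn.mk (fun p => (p.1 : ℂ)) (Complex.ofRealCLM.contDiff.comp contDiff_fst)

/-- The coordinate `t`. -/
def coordT : smoothFn :=
  smoothFn.mk (fun p => (p.2 : ℂ)) (Complex.ofRealCLM.contDiff.comp contDiff_snd)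

lemma dirDeriv_coordX (v : ℝ × ℝ) : dirDeriv v coordX = algebraMap ℂ smoothFn v.1 := by
  refine smoothFn_ext fun p => ?_
  have h : HasFDerivAt (coordX : ℝ × ℝ → ℂ)
      (Complex.ofRealCLM.comp (ContinuousLinearMap.fst ℝ ℝ ℝ)) p :=
    Complex.ofRealCLM.hasFDerivAt.comp p hasFDerivAt_fst
  rw [evalAt_dirDeriv, h.fderiv, AlgHom.commutes]
  rfl

lemma dirDeriv_coordT (v : ℝ × ℝ) : dirDeriv v coordT = algebraMap ℂ smoothFn v.2 := by
  refine smoothFn_ext fun p => ?_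
  have h : HasFDerivAt (coordT : ℝ × ℝ → ℂ)
      (Complex.ofRealCLM.comp (ContinuousLinearMap.snd ℝ ℝ ℝ)) p :=
    Complex.ofRealCLM.hasFDerivAt.comp p hasFDerivAt_snd
  rw [evalAt_dirDeriv, h.fderiv, AlgHom.commutes]
  rfl

lemma contDiff_halfPhase (a c : ℝ) :
    ContDiff ℝ (⊤ : ℕ∞) fun p : ℝ × ℝ => halfPhase a c p.1 p.2 := by
  unfold halfPhase
  have h1 : ContDiff ℝ (⊤ : ℕ∞) fun p : ℝ × ℝ => (p.1 : ℂ) := contDiff_smoothFn coordX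
  have h2 : ContDiff ℝ (⊤ : ℕ∞) fun p : ℝ × ℝ => (p.2 : ℂ) := contDiff_smoothFn coordT
  exact ContDiff.cexp (by fun_prop)

/-- `exp (i θ / 2)` as a smooth function. -/
def halfPhaseFn (a c : ℝ) : smoothFn := smoothFn.mk _ (contDiff_halfPhase a c)

lemma evalAt_halfPhaseFn (a c : ℝ) (p : ℝ × ℝ) :
    evalAt p (halfPhaseFn a c) = halfPhase a c p.1 p.2 := rfl

lemma star_halfPhaseFn_mul (a c : ℝ) : star (halfPhaseFn a c) * halfPhaseFn a c = 1 := by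
  refine smoothFn_ext fun p => ?_
  rw [map_mul, evalAt_star, evalAt_halfPhaseFn, conj_halfPhase,
    inv_mul_cancel₀ (halfPhase_ne_zero a c _ _), map_one]

lemma dirDeriv_halfPhaseFn (a c : ℝ) (v : ℝ × ℝ) :
    dirDeriv v (halfPhaseFn a c) =
      algebraMap ℂ smoothFn (Complex.I * (a * v.1 + a * (a - c ^ 2) * v.2) / 2)
        * halfPhaseFn a c := by
  refine smoothFn_ext fun p => ?_
  have h1 : HasFDerivAt (fun p : ℝ × ℝ => (p.1 : ℂ))
      (Complex.ofRealCLM.comp (ContinuousLinearMap.fst ℝ ℝ ℝ)) p :=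
    Complex.ofRealCLM.hasFDerivAt.comp p hasFDerivAt_fst
  have h2 : HasFDerivAt (fun p : ℝ × ℝ => (p.2 : ℂ))
      (Complex.ofRealCLM.comp (ContinuousLinearMap.snd ℝ ℝ ℝ)) p :=
    Complex.ofRealCLM.hasFDerivAt.comp p hasFDerivAt_snd
  have h3 := (((h1.const_mul (Complex.I * a / 2)).add
    (h2.const_mul (Complex.I * (a * (a - c ^ 2)) / 2)))).cexp
  have e : ((halfPhaseFn a c : smoothFn) : ℝ × ℝ → ℂ) = fun p : ℝ × ℝ =>
      Complex.exp (Complex.I * a / 2 * (p.1 : ℂ) + Complex.I * (a * (a - c ^ 2)) / 2 * (p.2 : ℂ)) := by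
    ext y
    change halfPhase a c y.1 y.2 = _
    rw [halfPhase]; congr 1; ring
  have h4 : HasFDerivAt ((halfPhaseFn a c : smoothFn) : ℝ × ℝ → ℂ) _ p := e ▸ h3
  rw [evalAt_dirDeriv, h4.fderiv, map_mul, AlgHom.commutes, evalAt_apply, e]
  simp
  ring

/-! ### Linear systems modulo `quadP ^ k` -/

section RemainderSystem

variable {A : Type*} [CommRing A] [Algebra ℂ A]

/-- Remainders of `X ^ j F` (`j` even) and `X ^ j G` (`j` odd). -/
def remainderMatrix (a c : ℝ) (k : ℕ) (F G : A[X]) : Matrix (Fin (2 * k)) (Fin (2 * k)) A :=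
  Matrix.of fun i j => ((X ^ (j : ℕ) * if Odd (j : ℕ) then G else F) %ₘ quadP A a c ^ k).coeff i

omit [Algebra ℂ A] in
lemma selectPoly_mul_add (n : ℕ) (w : ℕ → A) (F G : A[X]) :
    selectPoly (fun j => ¬Odd j) n w * F + selectPoly Odd n w * G =
      ∑ j ∈ Finset.range n, w j • (X ^ j * if Odd j then G else F) := by
  rw [selectPoly, selectPoly, Finset.sum_mul, Finset.sum_mul, ← Finset.sum_add_distrib]
  refine Finset.sum_congr rfl fun j _ => ?_
  by_cases h : Odd j <;> simp [h, smul_eq_C_mul, mul_assoc]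

lemma remainderMatrix_mulVec (a c : ℝ) (k : ℕ) (F G : A[X]) (w : ℕ → A) (i : Fin (2 * k)) :
    (remainderMatrix a c k F G).mulVec (fun j => w j) i =
      ((selectPoly (fun j => ¬Odd j) (2 * k) w * F + selectPoly Odd (2 * k) w * G) %ₘ
        quadP A a c ^ k).coeff i := by
  rw [selectPoly_mul_add, ← modByMonicHom_apply, map_sum, finsetSum_coeff, Matrix.mulVec,
    dotProduct, ← Fin.sum_univ_eq_sum_range (fun j => (modByMonicHom (quadP A a c ^ k)
      (w j • (X ^ j * if Odd j then G else F))).coeff i)]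
  refine Finset.sum_congr rfl fun j _ => ?_
  rw [map_smul, coeff_smul, modByMonicHom_apply, smul_eq_mul, mul_comm]
  rfl

lemma monic_quadP_pow (a c : ℝ) (k : ℕ) : (quadP A a c ^ k).Monic := (monic_quadP a c).pow k

lemma modByMonic_eq_zero_of_coeff (a c : ℝ) (k : ℕ) (p : A[X])
    (h : ∀ i < 2 * k, (p %ₘ quadP A a c ^ k).coeff i = 0) : quadP A a c ^ k ∣ p := by
  nontriviality A
  rw [← modByMonic_eq_zero_iff_dvd (monic_quadP_pow a c k)]
  ext i
  rcases lt_or_ge i (2 * k) with hi | hi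
  · exact h i hi
  · rw [coeff_zero, coeff_eq_zero_of_degree_lt]
    refine (degree_modByMonic_lt _ (monic_quadP_pow a c k)).trans_le ?_
    rw [degree_eq_natDegree (monic_quadP_pow a c k).ne_zero,
      (monic_quadP a c).natDegree_pow, natDegree_quadP]
    exact_mod_cast (by omega : k * 2 ≤ i)

/-- Solution of the linear system for the monic annihilator. -/
lemma exists_monic_annihilator {a c : ℝ} {k : ℕ} {F G : A[X]}
    (h : IsUnit (remainderMatrix a c k F G).det) :
    ∃ w : ℕ → A, quadP A a c ^ k ∣
      (X ^ (2 * k) + selectPoly (fun j => ¬Odd j) (2 * k) w) * F + selectPoly Odd (2 * k) w * G := by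
  set M := remainderMatrix a c k F G
  set b : Fin (2 * k) → A := fun i => -((X ^ (2 * k) * F) %ₘ quadP A a c ^ k).coeff i with hb
  set v := M⁻¹.mulVec b with hv
  set w : ℕ → A := fun j => if hj : j < 2 * k then v ⟨j, hj⟩ else 0 with hw
  have hvw : v = fun s : Fin (2 * k) => w s := by ext s; simp [hw]
  have hMv : M.mulVec v = b := by
    rw [hv, Matrix.mulVec_mulVec, Matrix.mul_nonsing_inv _ h, Matrix.one_mulVec]
  refine ⟨w, modByMonic_eq_zero_of_coeff a c k _ fun i hi => ?_⟩
  have h1 := congrFun hMv ⟨i, hi⟩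
  rw [hvw, remainderMatrix_mulVec] at h1
  rw [add_mul, add_assoc, add_modByMonic, coeff_add, h1, hb]
  simp

end RemainderSystem

variable {a c : ℝ} {k : ℕ}

/-- A kernel vector is again an annihilator of degree below 2k. Expressing the system through
remainders modulo `quadP`^k makes its entries polynomial expressions in x and t. -/
lemma remainderMatrix_det_ne_zero (hc : c ≠ 0) (hac : c ^ 2 < 2 * a) (hk : 1 ≤ k) (K : ℕ)
    (x t : ℝ) :
    (remainderMatrix a c k (partA a c K (x : ℂ) (t : ℂ) + partB a c K (x : ℂ) (t : ℂ))
      (partA a c K (x : ℂ) (t : ℂ) - partB a c K (x : ℂ) (t : ℂ))).det ≠ 0 := by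
  intro h0
  obtain ⟨v, hv, hv0⟩ := Matrix.exists_mulVec_eq_zero_iff.mpr h0
  set w : ℕ → ℂ := fun j => if hj : j < 2 * k then v ⟨j, hj⟩ else 0 with hw
  have hvw : v = fun s : Fin (2 * k) => w s := by ext s; simp [hw]
  apply hv
  rw [hvw] at hv0 ⊢
  have hann : Annihilates a c K x t k (selectPoly (fun j => ¬Odd j) (2 * k) w)
      (selectPoly Odd (2 * k) w) := by
    refine modByMonic_eq_zero_of_coeff a c k _ fun i hi => ?_
    have := congrFun hv0 ⟨i, hi⟩
    rwa [remainderMatrix_mulVec] at this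
  have hd := natDegree_selectPoly_lt (fun j => ¬Odd j) (n := 2 * k) (by omega) w
  have hd' := natDegree_selectPoly_lt Odd (n := 2 * k) (by omega) w
  obtain ⟨h1, h2⟩ := eq_zero_of_natDegree_lt (m := 2 * k - 1) (by omega) (by omega) (by omega)
    ((evenOdd_selectPoly (2 * k) w).dvd_norm hc (pos_of_lt hac).ne' hann)
  ext s
  exact selectPoly_eq_zero h1 h2 s s.isLt

lemma map_selectPoly {A B : Type*} [CommRing A] [CommRing B] (f : A →+* B) (e : ℕ → Prop)
    [DecidablePred e] (n : ℕ) (w : ℕ → A) :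
    (selectPoly e n w).map f = selectPoly e n (fun j => f (w j)) := by
  ext j
  rw [coeff_map, coeff_selectPoly, coeff_selectPoly]
  split_ifs <;> simp

/-- The truncated eigenfunction over the ring of smooth functions. -/
abbrev fnA (a c : ℝ) (K : ℕ) : smoothFn[X] := partA a c K coordX coordT
/-- The truncated eigenfunction over the ring of smooth functions. -/
abbrev fnB (a c : ℝ) (K : ℕ) : smoothFn[X] := partB a c K coordX coordT

lemma map_fnA_add (a c : ℝ) (K : ℕ) (p : ℝ × ℝ) :
    (fnA a c K + fnB a c K).map (evalAt p : smoothFn →+* ℂ) =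
      partA a c K (p.1 : ℂ) (p.2 : ℂ) + partB a c K (p.1 : ℂ) (p.2 : ℂ) := by
  rw [Polynomial.map_add, map_partA, map_partB]; rfl

lemma map_fnA_sub (a c : ℝ) (K : ℕ) (p : ℝ × ℝ) :
    (fnA a c K - fnB a c K).map (evalAt p : smoothFn →+* ℂ) =
      partA a c K (p.1 : ℂ) (p.2 : ℂ) - partB a c K (p.1 : ℂ) (p.2 : ℂ) := by
  rw [Polynomial.map_sub, map_partA, map_partB]; rfl

lemma annihilates_map {K : ℕ} {P R : smoothFn[X]}
    (h : quadP smoothFn a c ^ k ∣ P * (fnA a c K + fnB a c K) + R * (fnA a c K - fnB a c K))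
    (p : ℝ × ℝ) :
    Annihilates a c K p.1 p.2 k (P.map (evalAt p : smoothFn →+* ℂ))
      (R.map (evalAt p : smoothFn →+* ℂ)) := by
  have hm := map_dvd (mapRingHom (evalAt p : smoothFn →+* ℂ)) h
  rw [map_pow, map_add, map_mul, map_mul] at hm
  simp only [coe_mapRingHom] at hm
  rwa [map_fnA_add, map_fnA_sub, map_quadP] at hm

/-- The coefficients of the monic annihilator are smooth. -/
lemma exists_smooth_annihilator (hc : c ≠ 0) (hac : c ^ 2 < 2 * a) (hk : 1 ≤ k) (K : ℕ) :
    ∃ P R : smoothFn[X], quadP smoothFn a c ^ k ∣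
        P * (fnA a c K + fnB a c K) + R * (fnA a c K - fnB a c K) ∧
      P.natDegree ≤ 2 * k ∧ P.coeff (2 * k) = 1 ∧ R.natDegree < 2 * k ∧
      ∀ p : ℝ × ℝ, IsMonicAnnihilator a c K p.1 p.2 k (P.map (evalAt p : smoothFn →+* ℂ))
        (R.map (evalAt p : smoothFn →+* ℂ)) := by
  -- A smooth function without zeros is invertible, so the system can be solved over the ring of
  -- smooth functions and its solution depends smoothly on (x, t).
  have hunit : IsUnit (remainderMatrix a c k (fnA a c K + fnB a c K)
      (fnA a c K - fnB a c K)).det := by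
    refine isUnit_smoothFn fun p => ?_
    have h1 : evalAt p (remainderMatrix a c k (fnA a c K + fnB a c K)
        (fnA a c K - fnB a c K)).det = _ := RingHom.map_det (evalAt p : smoothFn →+* ℂ) _
    rw [h1]
    convert remainderMatrix_det_ne_zero hc hac hk K p.1 p.2 using 3
    ext i j
    simp only [RingHom.mapMatrix_apply, Matrix.map_apply, remainderMatrix, Matrix.of_apply]
    rw [← coeff_map, map_modByMonic _ (monic_quadP_pow a c k), Polynomial.map_pow, map_quadP,
      Polynomial.map_mul, Polynomial.map_pow, map_X]
    split_ifs
    · rw [map_fnA_sub]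
    · rw [map_fnA_add]
  obtain ⟨w, hw⟩ := exists_monic_annihilator hunit
  have hd := natDegree_selectPoly_lt (fun j => ¬Odd j) (n := 2 * k) (by omega) w
  have hd' := natDegree_selectPoly_lt Odd (n := 2 * k) (by omega) w
  have hP : (X ^ (2 * k) + selectPoly (fun j => ¬Odd j) (2 * k) w).natDegree ≤ 2 * k :=
    (natDegree_add_le _ _).trans (max_le (natDegree_X_pow_le _) hd.le)
  have hP1 : (X ^ (2 * k) + selectPoly (fun j => ¬Odd j) (2 * k) w).coeff (2 * k) = 1 := by
    rw [coeff_add, coeff_X_pow, if_pos rfl, coeff_selectPoly, if_neg (by omega), add_zero]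
  refine ⟨_, _, hw, hP, hP1, hd', fun p => ?_⟩
  refine ⟨annihilates_map hw p, ⟨?_, ?_⟩, natDegree_map_le.trans hP, Or.inl (natDegree_map_le.trans_lt hd'), ?_⟩
  · rw [Polynomial.map_add, Polynomial.map_pow, map_X, map_selectPoly, map_add,
      (evenOdd_selectPoly _ _).1, map_pow, reflP_X, (even_two_mul k).neg_pow]
  · rw [map_selectPoly, (evenOdd_selectPoly _ _).2]
  · rw [coeff_map, hP1, map_one]

end

end DNLS

namespace DNLS

open Polynomial ComplexConjugate

noncomputable section

/-! ### The linear flows of the truncated eigenfunction -/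

lemma C_algebraMap_two : (C (algebraMap ℂ smoothFn 2) : smoothFn[X]) = 2 := by
  rw [show (2 : ℂ) = 1 + 1 by norm_num, map_add, map_one, C_add, C_1, one_add_one_eq_two]

section Flow

variable (D : Derivation ℂ smoothFn smoothFn)

lemma polyDeriv_const (z : ℂ) : polyDeriv D (C (algebraMap ℂ smoothFn z)) = 0 := by
  rw [polyDeriv_C, D.map_algebraMap, C_0]

lemma polyDeriv_const_mul_pow_succ (z : ℂ) (w : smoothFn[X]) (m : ℕ) :
    polyDeriv D (C (algebraMap ℂ smoothFn z) * w ^ (m + 1)) =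
      C (algebraMap ℂ smoothFn (z * (m + 1))) * w ^ m * polyDeriv D w := by
  rw [Derivation.leibniz, polyDeriv_const, Derivation.leibniz_pow]
  simp only [Nat.add_sub_cancel, nsmul_eq_mul, smul_eq_mul, mul_zero, add_zero, map_mul, map_add,
    map_natCast, map_one, Nat.cast_add, Nat.cast_one]
  ring

/-- The derivative of cosh √w in w is ½ sinh √w / √w; truncation loses one term. -/
lemma polyDeriv_coshTrunc (K : ℕ) (w : smoothFn[X]) :
    polyDeriv D (coshTrunc (K + 1) w) =
      C (algebraMap ℂ smoothFn (1 / 2)) * sinhcTrunc K w * polyDeriv D w := by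
  rw [coshTrunc, Finset.sum_range_succ', map_add, map_sum]
  simp only [polyDeriv_const_mul_pow_succ, pow_zero, mul_one, polyDeriv_const, add_zero]
  rw [sinhcTrunc, Finset.mul_sum, Finset.sum_mul]
  refine Finset.sum_congr rfl fun m _ => ?_
  have h : (1 / ((2 * (m + 1)).factorial : ℂ) * (m + 1)) =
      1 / 2 * (1 / ((2 * m + 1).factorial : ℂ)) := by
    rw [show 2 * (m + 1) = 2 * m + 1 + 1 by ring, Nat.factorial_succ]
    have h1 : ((2 * m + 1).factorial : ℂ) ≠ 0 := by exact_mod_cast Nat.factorial_ne_zero _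
    have h2 : ((m : ℂ) + 1) ≠ 0 := by exact_mod_cast Nat.succ_ne_zero m
    have h3 : ((2 * m + 1 + 1 : ℕ) : ℂ) = 2 * (m + 1) := by push_cast; ring
    rw [Nat.cast_mul, h3]
    field_simp
  rw [h, map_mul, C_mul]
  ring

/-- For S = sinh √w / √w one has 2w S'(w) = cosh √w - S, and this holds term by term, hence exactly
after truncation. The factor X₀ (the phase, with w quadratic in it) replaces a division by w. -/
lemma mul_polyDeriv_sinhcTrunc (K : ℕ) {w X₀ τ : smoothFn[X]}
    (h : X₀ * polyDeriv D w = 2 * w * τ) :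
    X₀ * polyDeriv D (sinhcTrunc K w) = τ * (coshTrunc K w - sinhcTrunc K w) := by
  rw [sinhcTrunc, coshTrunc, ← Finset.sum_sub_distrib, map_sum, Finset.mul_sum, Finset.mul_sum]
  refine Finset.sum_congr rfl fun m _ => ?_
  rcases m with _ | m
  · simp
  · rw [polyDeriv_const_mul_pow_succ]
    have e : 1 / ((2 * (m + 1) + 1).factorial : ℂ) * (m + 1) * 2 =
        1 / ((2 * (m + 1)).factorial : ℂ) - 1 / ((2 * (m + 1) + 1).factorial : ℂ) := by
      rw [Nat.factorial_succ (2 * (m + 1))]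
      have h1 : ((2 * (m + 1)).factorial : ℂ) ≠ 0 := by exact_mod_cast Nat.factorial_ne_zero _
      have h2 : ((2 * (m + 1) + 1 : ℕ) : ℂ) ≠ 0 := by exact_mod_cast Nat.succ_ne_zero (2 * (m + 1))
      have h3 : ((2 * (m + 1) + 1 : ℕ) : ℂ) = 2 * (m + 1) + 1 := by push_cast; ring
      rw [Nat.cast_mul]
      rw [h3] at h2 ⊢
      field_simp
      ring
    have e2 := congrArg (fun z => (C (algebraMap ℂ smoothFn z) : smoothFn[X])) e
    simp only [map_mul, map_sub] at e2
    rw [C_algebraMap_two] at e2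
    rw [map_mul, C_mul]
    linear_combination (C (algebraMap ℂ smoothFn (1 / ((2 * (m + 1) + 1).factorial : ℂ))) *
      C (algebraMap ℂ smoothFn (m + 1)) * w ^ m) * h + w ^ (m + 1) * τ * e2

variable (a c : ℝ) (K : ℕ) (v : ℝ × ℝ)

lemma polyDeriv_quadP : polyDeriv D (quadP smoothFn a c) = 0 := by
  simp [quadP, polyDeriv_X, polyDeriv_const, Derivation.leibniz, Derivation.leibniz_pow,
    -Complex.ofReal_mul, -map_mul, -map_div₀]

lemma polyDeriv_quadM : polyDeriv D (quadM smoothFn a c) = 0 := by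
  simp [quadM, polyDeriv_X, polyDeriv_const, Derivation.leibniz, Derivation.leibniz_pow,
    -Complex.ofReal_mul, -map_mul, -map_div₀]

/-- The derivative of the phase in the direction `v`. -/
def flowFactor : smoothFn[X] :=
  C (algebraMap ℂ smoothFn v.1) +
    (2 * X ^ 2 + C (algebraMap ℂ smoothFn (a - c ^ 2))) * C (algebraMap ℂ smoothFn v.2)

lemma polyDeriv_phase :
    polyDeriv (dirDeriv v) (phase a c coordX coordT) = flowFactor a c v := by
  rw [phase, flowFactor, ← C_algebraMap_two, map_add, Derivation.leibniz, map_add, Derivation.leibniz,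
    Derivation.leibniz_pow, polyDeriv_X, polyDeriv_const, polyDeriv_const, polyDeriv_C, polyDeriv_C,
    dirDeriv_coordX, dirDeriv_coordT]
  simp

lemma polyDeriv_sqExp :
    polyDeriv (dirDeriv v) (sqExp a c coordX coordT) =
      -(2 * quadP smoothFn a c * quadM smoothFn a c * phase a c coordX coordT
        * flowFactor a c v) := by
  rw [sqExp, map_neg, Derivation.leibniz, Derivation.leibniz, Derivation.leibniz_pow,
    polyDeriv_phase, polyDeriv_quadP, polyDeriv_quadM]
  simp only [smul_eq_mul, nsmul_eq_mul, mul_zero, add_zero, Nat.cast_ofNat, Nat.add_one_sub_one,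
    pow_one]
  ring

/-- The truncated cosh differentiates to a sinh series one term shorter. The missing term has
w^{K+1}, and the derivative of w gives another `quadP`, so the error is divisible by `quadP`^{K+2}.
-/
lemma polyDeriv_fnA :
    quadP smoothFn a c ^ (K + 2) ∣ polyDeriv (dirDeriv v) (fnA a c (K + 1)) -
      flowFactor a c v * (C (algebraMap ℂ smoothFn Complex.I) * quadP smoothFn a c
        * fnB a c (K + 1)) := by
  have hI : (C (algebraMap ℂ smoothFn Complex.I) : smoothFn[X]) ^ 2 = -1 := by
    rw [← C_pow, ← map_pow, Complex.I_sq]; simp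
  have h2 : (C (algebraMap ℂ smoothFn (1 / 2)) : smoothFn[X]) * 2 = 1 := by
    rw [← C_algebraMap_two, ← C_mul, ← map_mul]
    norm_num
  have h3 : sinhcTrunc (K + 1) (sqExp a c coordX coordT) =
      sinhcTrunc K (sqExp a c coordX coordT) +
        C (algebraMap ℂ smoothFn (1 / ((2 * (K + 1) + 1).factorial : ℂ))) *
          sqExp a c coordX coordT ^ (K + 1) := by
    rw [sinhcTrunc, Finset.sum_range_succ]; rfl
  obtain ⟨u, hu⟩ := pow_dvd_pow_of_dvd (quadP_dvd_sqExp a c coordX coordT) (K + 1)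
  rw [fnA, partA, polyDeriv_coshTrunc, polyDeriv_sqExp, fnB, partB, h3, hu]
  refine ⟨flowFactor a c v * quadM smoothFn a c * phase a c coordX coordT *
    C (algebraMap ℂ smoothFn (1 / ((2 * (K + 1) + 1).factorial : ℂ))) * u, ?_⟩
  linear_combination (-(sinhcTrunc K (sqExp a c coordX coordT) * quadP smoothFn a c *
    quadM smoothFn a c * phase a c coordX coordT * flowFactor a c v)) * h2 -
    (flowFactor a c v * quadP smoothFn a c * quadM smoothFn a c * phase a c coordX coordT *
      (sinhcTrunc K (sqExp a c coordX coordT) +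
        C (algebraMap ℂ smoothFn (1 / ((2 * (K + 1) + 1).factorial : ℂ))) *
          (quadP smoothFn a c ^ (K + 1) * u))) * hI

lemma polyDeriv_fnB :
    polyDeriv (dirDeriv v) (fnB a c K) =
      flowFactor a c v * (C (algebraMap ℂ smoothFn Complex.I) * quadM smoothFn a c * fnA a c K) := by
  have h := mul_polyDeriv_sinhcTrunc (dirDeriv v) K (w := sqExp a c coordX coordT)
    (X₀ := phase a c coordX coordT) (τ := flowFactor a c v) (by
      rw [polyDeriv_sqExp, sqExp]; ring)
  rw [fnB, partB, Derivation.leibniz, Derivation.leibniz, Derivation.leibniz, polyDeriv_const,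
    polyDeriv_quadM, polyDeriv_phase, fnA, partA]
  simp only [smul_eq_mul, mul_zero, add_zero]
  linear_combination C (algebraMap ℂ smoothFn Complex.I) * quadM smoothFn a c * h

end Flow

end

end DNLS

namespace DNLS

open Polynomial ComplexConjugate

noncomputable section

variable {a c : ℝ} {k : ℕ}

/-! ### Divisibility by `quadP ^ k` over the ring of smooth functions -/

/-- The divisor is monic, so taking remainders commutes with evaluation at a point. -/
lemma dvd_of_forall_map {W : smoothFn[X]}
    (h : ∀ p : ℝ × ℝ, quadP ℂ a c ^ k ∣ W.map (evalAt p : smoothFn →+* ℂ)) :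
    quadP smoothFn a c ^ k ∣ W := by
  refine modByMonic_eq_zero_of_coeff a c k _ fun i _ => smoothFn_ext fun p => ?_
  have h1 := (modByMonic_eq_zero_iff_dvd (monic_quadP_pow a c k)).mpr (h p)
  have h2 : (W %ₘ quadP smoothFn a c ^ k).map (evalAt p : smoothFn →+* ℂ) = 0 := by
    rw [map_modByMonic _ (monic_quadP_pow a c k), Polynomial.map_pow, map_quadP, h1]
  rw [map_zero]
  have := congrArg (fun q => q.coeff i) h2
  rwa [coeff_map, coeff_zero] at this

/-- Even polynomials of degree at most `2 k`. -/
def evenPart (k : ℕ) : Submodule smoothFn smoothFn[X] where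
  carrier := {q | (∀ j, Odd j → q.coeff j = 0) ∧ ∀ j, 2 * k < j → q.coeff j = 0}
  add_mem' hp hq := ⟨fun j hj => by rw [coeff_add, hp.1 j hj, hq.1 j hj, add_zero],
    fun j hj => by rw [coeff_add, hp.2 j hj, hq.2 j hj, add_zero]⟩
  zero_mem' := ⟨fun _ _ => coeff_zero _, fun _ _ => coeff_zero _⟩
  smul_mem' z q hq := ⟨fun j hj => by rw [coeff_smul, hq.1 j hj, smul_zero],
    fun j hj => by rw [coeff_smul, hq.2 j hj, smul_zero]⟩

/-- Odd polynomials of degree less than `2 k`. -/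
def oddPart (k : ℕ) : Submodule smoothFn smoothFn[X] where
  carrier := {q | (∀ j, ¬Odd j → q.coeff j = 0) ∧ ∀ j, 2 * k ≤ j → q.coeff j = 0}
  add_mem' hp hq := ⟨fun j hj => by rw [coeff_add, hp.1 j hj, hq.1 j hj, add_zero],
    fun j hj => by rw [coeff_add, hp.2 j hj, hq.2 j hj, add_zero]⟩
  zero_mem' := ⟨fun _ _ => coeff_zero _, fun _ _ => coeff_zero _⟩
  smul_mem' z q hq := ⟨fun j hj => by rw [coeff_smul, hq.1 j hj, smul_zero],
    fun j hj => by rw [coeff_smul, hq.2 j hj, smul_zero]⟩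

lemma C_mul_mem {M : Submodule smoothFn smoothFn[X]} (z : smoothFn) {q : smoothFn[X]} (h : q ∈ M) :
    C z * q ∈ M := by
  rw [← smul_eq_C_mul]; exact M.smul_mem z h

lemma polyDeriv_mem_evenPart (D : Derivation ℂ smoothFn smoothFn) {q : smoothFn[X]}
    (h : q ∈ evenPart k) : polyDeriv D q ∈ evenPart k :=
  ⟨fun j hj => by rw [coeff_polyDeriv, h.1 j hj, map_zero],
    fun j hj => by rw [coeff_polyDeriv, h.2 j hj, map_zero]⟩

lemma polyDeriv_mem_oddPart (D : Derivation ℂ smoothFn smoothFn) {q : smoothFn[X]}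
    (h : q ∈ oddPart k) : polyDeriv D q ∈ oddPart k :=
  ⟨fun j hj => by rw [coeff_polyDeriv, h.1 j hj, map_zero],
    fun j hj => by rw [coeff_polyDeriv, h.2 j hj, map_zero]⟩

/-- Conjugation of the coefficients. -/
def starPoly : smoothFn[X] →+* smoothFn[X] := mapRingHom (starRingEnd smoothFn)

lemma coeff_starPoly (q : smoothFn[X]) (j : ℕ) : (starPoly q).coeff j = star (q.coeff j) := by
  rw [starPoly, coe_mapRingHom, coeff_map]; rfl

lemma starPoly_mem_evenPart {q : smoothFn[X]} (h : q ∈ evenPart k) : starPoly q ∈ evenPart k :=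
  ⟨fun j hj => by rw [coeff_starPoly, h.1 j hj, star_zero],
    fun j hj => by rw [coeff_starPoly, h.2 j hj, star_zero]⟩

lemma starPoly_mem_oddPart {q : smoothFn[X]} (h : q ∈ oddPart k) : starPoly q ∈ oddPart k :=
  ⟨fun j hj => by rw [coeff_starPoly, h.1 j hj, star_zero],
    fun j hj => by rw [coeff_starPoly, h.2 j hj, star_zero]⟩

lemma map_starPoly (p : ℝ × ℝ) (q : smoothFn[X]) :
    (starPoly q).map (evalAt p : smoothFn →+* ℂ) = conjP (q.map (evalAt p : smoothFn →+* ℂ)) := by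
  ext j
  rw [coeff_map, coeff_starPoly, coeff_conjP, coeff_map]
  exact evalAt_star p _

lemma reflP_map_of_even {q : smoothFn[X]} (h : ∀ j, Odd j → q.coeff j = 0) (p : ℝ × ℝ) :
    reflP (q.map (evalAt p : smoothFn →+* ℂ)) = q.map (evalAt p : smoothFn →+* ℂ) := by
  ext j
  rw [coeff_reflP, coeff_map]
  rcases Nat.even_or_odd j with hj | hj
  · rw [hj.neg_one_pow, one_mul]
  · rw [h j hj, map_zero, mul_zero]

lemma reflP_map_of_odd {q : smoothFn[X]} (h : ∀ j, ¬Odd j → q.coeff j = 0) (p : ℝ × ℝ) :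
    reflP (q.map (evalAt p : smoothFn →+* ℂ)) = -q.map (evalAt p : smoothFn →+* ℂ) := by
  ext j
  rw [coeff_reflP, coeff_neg, coeff_map]
  by_cases hj : Odd j
  · rw [hj.neg_one_pow, neg_one_mul]
  · rw [h j hj, map_zero, mul_zero, neg_zero]

lemma eq_zero_of_forall_map {q : smoothFn[X]}
    (h : ∀ p : ℝ × ℝ, q.map (evalAt p : smoothFn →+* ℂ) = 0) : q = 0 := by
  ext j
  refine smoothFn_ext fun p => ?_
  have := congrArg (fun q => q.coeff j) (h p)
  rw [coeff_map, coeff_zero] at this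
  rw [coeff_zero, map_zero]
  exact this

/-- A polynomial annihilator of slightly too large formal degree whose leading and constant
coefficients vanish is zero. -/
lemma eq_zero_of_dvd (hc : c ≠ 0) (hac : c ^ 2 < 2 * a) (hk : 1 ≤ k) {K : ℕ}
    {T₀ T₁ T₂ S₀ S₁ S₂ : smoothFn[X]} (hT₀ : T₀ ∈ evenPart k) (hT₁ : T₁ ∈ oddPart k)
    (hT₂ : T₂ ∈ evenPart k) (hS₀ : S₀ ∈ oddPart k) (hS₁ : S₁ ∈ evenPart k) (hS₂ : S₂ ∈ oddPart k)
    (h0 : T₀.coeff 0 = 0) (hT : T₂.coeff (2 * k) = 0)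
    (hS : S₁.coeff (2 * k) + S₂.coeff (2 * k - 1) = 0)
    (h : quadP smoothFn a c ^ k ∣ (T₀ + X * T₁ + X ^ 2 * T₂) * (fnA a c K + fnB a c K) +
      (S₀ + X * S₁ + X ^ 2 * S₂) * (fnA a c K - fnB a c K)) :
    T₀ + X * T₁ + X ^ 2 * T₂ = 0 ∧ S₀ + X * S₁ + X ^ 2 * S₂ = 0 := by
  have cT : ∀ n, (T₀ + X * T₁ + X ^ 2 * T₂).coeff (n + 2) =
      T₀.coeff (n + 2) + T₁.coeff (n + 1) + T₂.coeff n := fun n => by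
    rw [coeff_add, coeff_add, coeff_X_mul, coeff_X_pow_mul]
  have cS : ∀ n, (S₀ + X * S₁ + X ^ 2 * S₂).coeff (n + 2) =
      S₀.coeff (n + 2) + S₁.coeff (n + 1) + S₂.coeff n := fun n => by
    rw [coeff_add, coeff_add, coeff_X_mul, coeff_X_pow_mul]
  have cT0 : (T₀ + X * T₁ + X ^ 2 * T₂).coeff 0 = 0 := by simp [h0]
  have cT1 : (T₀ + X * T₁ + X ^ 2 * T₂).coeff 1 = 0 := by
    rw [coeff_add, coeff_add, coeff_X_mul, coeff_X_pow_mul', hT₀.1 1 odd_one, hT₁.1 0 (by simp)]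
    simp
  have cS0 : (S₀ + X * S₁ + X ^ 2 * S₂).coeff 0 = 0 := by simp [hS₀.1 0 (by simp)]
  have eT : ∀ j, Odd j → (T₀ + X * T₁ + X ^ 2 * T₂).coeff j = 0 := by
    rintro (_ | _ | n) hn
    · simp at hn
    · exact cT1
    · have hn' : Odd n := by simpa [Nat.odd_add, parity_simps] using hn
      rw [cT, hT₀.1 _ hn, hT₁.1 _ (by simpa [parity_simps] using hn'), hT₂.1 _ hn']
      simp
  have eS : ∀ j, ¬Odd j → (S₀ + X * S₁ + X ^ 2 * S₂).coeff j = 0 := by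
    rintro (_ | _ | n) hn
    · exact cS0
    · simp at hn
    · have hn' : ¬Odd n := by simpa [Nat.odd_add, parity_simps] using hn
      rw [cS, hS₀.1 _ hn, hS₁.1 _ (by simpa [parity_simps] using hn'), hS₂.1 _ hn']
      simp
  have dT : (T₀ + X * T₁ + X ^ 2 * T₂).natDegree ≤ 2 * k := by
    rw [natDegree_le_iff_coeff_eq_zero]
    intro N hN
    obtain ⟨n, rfl⟩ := Nat.exists_eq_add_of_le' (show 2 ≤ N by omega)
    rw [cT, hT₀.2 _ hN, hT₁.2 _ (by omega)]
    rcases Nat.lt_or_ge (2 * k) n with h1 | h1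
    · rw [hT₂.2 _ h1]; simp
    · rcases h1.eq_or_lt with rfl | h2
      · rw [hT]; simp
      -- In the remaining case n = 2k - 1, and evenness of T₂ removes the coefficient.
      · rw [hT₂.1 n ⟨k - 1, by omega⟩]; simp
  have dS : (S₀ + X * S₁ + X ^ 2 * S₂).natDegree ≤ 2 * k := by
    rw [natDegree_le_iff_coeff_eq_zero]
    intro N hN
    obtain ⟨n, rfl⟩ := Nat.exists_eq_add_of_le' (show 2 ≤ N by omega)
    rw [cS, hS₀.2 _ (by omega)]
    rcases Nat.lt_or_ge (2 * k) (n + 1) with h1 | h1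
    · rw [hS₁.2 _ h1, hS₂.2 _ (by omega)]; simp
    · have h2 : n = 2 * k - 1 := by omega
      rw [show n + 1 = 2 * k by omega, h2, zero_add, hS]
  -- The three coefficient hypotheses restore the degree bound 2k and the zero at λ = 0, so
  -- uniqueness applies at every point.
  have key : ∀ p : ℝ × ℝ, _ := fun p =>
    EvenOdd.eq_zero_of_coeff_zero hc (pos_of_lt hac).ne'
      ⟨reflP_map_of_even eT p, reflP_map_of_odd eS p⟩ (annihilates_map h p)
      (natDegree_map_le.trans dT) (natDegree_map_le.trans dS) (by rw [coeff_map, cT0, map_zero])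
  exact ⟨eq_zero_of_forall_map fun p => (key p).1, eq_zero_of_forall_map fun p => (key p).2⟩

/-! ### Normalized annihilators -/

/-- Annihilators of the eigenfunction, normalized at `λ = 0`. -/
structure IsNormalAnnihilator (a c : ℝ) (K k : ℕ) (P R : smoothFn[X]) : Prop where
  dvd : quadP smoothFn a c ^ k ∣ P * (fnA a c K + fnB a c K) + R * (fnA a c K - fnB a c K)
  mem_fst : P ∈ evenPart k
  mem_snd : R ∈ oddPart k
  coeff_zero : P.coeff 0 = 1
  norm_coeff : algebraMap ℂ smoothFn ((a / 2) ^ (2 * k)) * (P.coeff (2 * k) *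
    star (P.coeff (2 * k))) = 1

lemma exists_normal_annihilator (hc : c ≠ 0) (hac : c ^ 2 < 2 * a) (hk : 1 ≤ k) {K : ℕ}
    (hK : k ≤ K + 1) :
    ∃ P R : smoothFn[X], IsNormalAnnihilator a c K k P R ∧
      ∀ p : ℝ × ℝ, rogueWave a c k p.1 p.2 = evalAt p (halfPhaseFn a c ^ 2 *
        (algebraMap ℂ smoothFn ((a / 2) ^ (2 * k)) * (P.coeff (2 * k) *
          (algebraMap ℂ smoothFn c * P.coeff (2 * k) -
            2 * algebraMap ℂ smoothFn Complex.I * R.coeff (2 * k - 1))))) := by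
  obtain ⟨P, R, hdvd, hP, hP1, hR, hm⟩ := exists_smooth_annihilator hc hac hk K
  have ha : ((a : ℂ) / 2) ^ (2 * k) ≠ 0 :=
    pow_ne_zero _ (div_ne_zero (by exact_mod_cast (pos_of_lt hac).ne') two_ne_zero)
  -- This is 1/P(0), since |P(0)|² = (a/2)^{2k}; in this form its smoothness is evident.
  set u : smoothFn := algebraMap ℂ smoothFn (((a / 2) ^ (2 * k))⁻¹) * star (P.coeff 0) with hu
  have hnorm : ∀ p : ℝ × ℝ, evalAt p (P.coeff 0) * conj (evalAt p (P.coeff 0)) =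
      (a / 2) ^ (2 * k) := fun p => by
    have := (hm p).normSq_coeff_zero hc hac
    rw [coeff_map] at this
    rw [mul_comm 2 k, pow_mul]
    exact this
  have hev : ∀ p, evalAt p u = (((a : ℂ) / 2) ^ (2 * k))⁻¹ * conj (evalAt p (P.coeff 0)) := fun p => by
    rw [hu, map_mul, AlgHom.commutes, evalAt_star]; rfl
  refine ⟨C u * P, C u * R, ⟨?_, C_mul_mem u ⟨fun j hj => ?_, fun j hj => ?_⟩,
    C_mul_mem u ⟨fun j hj => ?_, fun j hj => ?_⟩, ?_, ?_⟩, fun p => ?_⟩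
  · exact (hdvd.mul_left (C u)).trans (dvd_of_eq (by ring))
  · refine smoothFn_ext fun p => ?_
    have := coeff_of_even (hm p).evenOdd.1 hj
    rw [coeff_map] at this
    rw [map_zero]; exact this
  · exact coeff_eq_zero_of_natDegree_lt (by omega)
  · refine smoothFn_ext fun p => ?_
    have := coeff_of_odd (hm p).evenOdd.2 hj
    rw [coeff_map] at this
    rw [map_zero]; exact this
  · exact coeff_eq_zero_of_natDegree_lt (by omega)
  · refine smoothFn_ext fun p => ?_
    rw [coeff_C_mul, map_mul, hev, map_one, mul_assoc, mul_comm (conj _), hnorm,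
      inv_mul_cancel₀ ha]
  · refine smoothFn_ext fun p => ?_
    rw [coeff_C_mul, hP1, mul_one, map_mul, map_mul, evalAt_star, hev, AlgHom.commutes, map_one,
      map_mul, Complex.conj_conj, map_inv₀]
    have h1 : conj (((a : ℂ) / 2) ^ (2 * k)) = (a / 2) ^ (2 * k) := by simp [map_ofNat]
    rw [h1]
    have h2 := hnorm p
    rw [Algebra.algebraMap_self, RingHom.id_apply]
    field_simp
    linear_combination h2
  · rw [(hm p).rogueWave_eq hc hac hk hK, coeff_map, coeff_map, coeff_C_mul, coeff_C_mul, hP1,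
      mul_one]
    simp only [map_mul, map_sub, map_pow, AlgHom.commutes, hev, map_ofNat, evalAt_halfPhaseFn,
      Algebra.algebraMap_self, RingHom.id_apply, RingHom.coe_coe]
    have h2 := hnorm p
    have h3 : evalAt p (P.coeff 0) ≠ 0 := fun h => ha (by rw [← h2, h, zero_mul])
    rw [div_mul_eq_mul_div, div_eq_iff h3]
    field_simp
    linear_combination (-(conj (evalAt p (P.coeff 0)) * halfPhase a c p.1 p.2 ^ 2 *
      (c - 2 * Complex.I * evalAt p (R.coeff (2 * k - 1))))) * h2

end

end DNLS

namespace DNLS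

open Polynomial ComplexConjugate

noncomputable section

variable {a c : ℝ} {k : ℕ}

/-! ### The Darboux-transformed potential solves the equation -/

/-- The imaginary unit as a constant function. -/
def cI : smoothFn := algebraMap ℂ smoothFn Complex.I

/-- A real constant function. -/
def cR (r : ℝ) : smoothFn := algebraMap ℂ smoothFn r

lemma cI_mul_cI : cI * cI = -1 := by
  rw [cI, ← map_mul, Complex.I_mul_I, map_neg, map_one]

lemma star_algebraMap (z : ℂ) : star (algebraMap ℂ smoothFn z) = algebraMap ℂ smoothFn (conj z) :=
  smoothFn_ext fun p => by rw [evalAt_star, AlgHom.commutes, AlgHom.commutes]; rfl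

lemma star_cI : star cI = -cI := by
  rw [cI, star_algebraMap, Complex.conj_I, map_neg]

lemma star_cR (r : ℝ) : star (cR r) = cR r := by
  rw [cR, star_algebraMap, Complex.conj_ofReal]

lemma deriv_cI (D : Derivation ℂ smoothFn smoothFn) : D cI = 0 := D.map_algebraMap _

lemma deriv_cR (D : Derivation ℂ smoothFn smoothFn) (r : ℝ) : D (cR r) = 0 := D.map_algebraMap _

/-- The diagonal part of the spectral problem of the seed. -/
def diagL (a : ℝ) : smoothFn[X] := C cI * X ^ 2 - C (cI * cR (a / 2))

lemma quadP_smoothFn (a c : ℝ) :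
    quadP smoothFn a c = X ^ 2 + C (cI * cR c) * X - C (cR (a / 2)) := by
  rw [quadP, cI, cR, cR, ← map_mul]; push_cast; rfl

lemma quadM_smoothFn (a c : ℝ) :
    quadM smoothFn a c = X ^ 2 - C (cI * cR c) * X - C (cR (a / 2)) := by
  rw [quadM, cI, cR, cR, ← map_mul]; push_cast; rfl

/-- Together with `polyDeriv_snd_flow` this is the linear system of the seed with its phase removed:
i·`quadP` and i·`quadM` are `diagL` ∓ cX, so the flows of A and B combine to a matrix acting on (A +
B, A - B). -/
lemma polyDeriv_fst_flow (a c : ℝ) (K : ℕ) (v : ℝ × ℝ) :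
    quadP smoothFn a c ^ (K + 2) ∣ polyDeriv (dirDeriv v) (fnA a c (K + 1) + fnB a c (K + 1)) -
      flowFactor a c v * (diagL a * (fnA a c (K + 1) + fnB a c (K + 1)) +
        C (cR c) * X * (fnA a c (K + 1) - fnB a c (K + 1))) := by
  refine (polyDeriv_fnA a c K v).trans (dvd_of_eq ?_)
  have hI : (C cI * C cI : smoothFn[X]) = -1 := by rw [← C_mul, cI_mul_cI]; simp
  rw [map_add, polyDeriv_fnB, quadP_smoothFn, quadM_smoothFn, diagL, ← cI]
  simp only [C_mul]
  linear_combination flowFactor a c v * C (cR c) * X *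
    (fnB a c (K + 1) - fnA a c (K + 1)) * (-1) * hI

lemma polyDeriv_snd_flow (a c : ℝ) (K : ℕ) (v : ℝ × ℝ) :
    quadP smoothFn a c ^ (K + 2) ∣ polyDeriv (dirDeriv v) (fnA a c (K + 1) - fnB a c (K + 1)) -
      flowFactor a c v * (-(C (cR c) * X * (fnA a c (K + 1) + fnB a c (K + 1))) -
        diagL a * (fnA a c (K + 1) - fnB a c (K + 1))) := by
  refine (polyDeriv_fnA a c K v).trans (dvd_of_eq ?_)
  have hI : (C cI * C cI : smoothFn[X]) = -1 := by rw [← C_mul, cI_mul_cI]; simp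
  rw [map_sub, polyDeriv_fnB, quadP_smoothFn, quadM_smoothFn, diagL, ← cI]
  simp only [C_mul]
  linear_combination flowFactor a c v * C (cR c) * X *
    (fnB a c (K + 1) + fnA a c (K + 1)) * (-1) * hI

/-- Differentiated annihilation relation. -/
lemma dvd_polyDeriv {K : ℕ} {P R : smoothFn[X]} (hk : k ≤ K + 2)
    (h : quadP smoothFn a c ^ k ∣ P * (fnA a c (K + 1) + fnB a c (K + 1)) +
      R * (fnA a c (K + 1) - fnB a c (K + 1))) (v : ℝ × ℝ) :
    quadP smoothFn a c ^ k ∣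
      (polyDeriv (dirDeriv v) P + flowFactor a c v * (P * diagL a - C (cR c) * X * R)) *
        (fnA a c (K + 1) + fnB a c (K + 1)) +
      (polyDeriv (dirDeriv v) R + flowFactor a c v * (C (cR c) * X * P - R * diagL a)) *
        (fnA a c (K + 1) - fnB a c (K + 1)) := by
  have h1 : quadP smoothFn a c ^ k ∣ polyDeriv (dirDeriv v)
      (P * (fnA a c (K + 1) + fnB a c (K + 1)) + R * (fnA a c (K + 1) - fnB a c (K + 1))) := by
    obtain ⟨u, hu⟩ := h
    rw [hu, Derivation.leibniz, Derivation.leibniz_pow, polyDeriv_quadP]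
    simp
  have h2 := (pow_dvd_pow _ hk).trans (polyDeriv_fst_flow a c K v)
  have h3 := (pow_dvd_pow _ hk).trans (polyDeriv_snd_flow a c K v)
  refine (dvd_sub (dvd_sub h1 (h2.mul_left P)) (h3.mul_left R)).trans (dvd_of_eq ?_)
  rw [map_add, Derivation.leibniz, Derivation.leibniz]
  simp only [smul_eq_mul]
  ring

/-- The symmetry supplies a second annihilator (-R*, P*), of the opposite parities; it is what is
available to correct the odd powers of λ in the differentiated relation. -/
lemma IsNormalAnnihilator.dvd_star {K : ℕ} {P R : smoothFn[X]}
    (h : IsNormalAnnihilator a c K k P R) :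
    quadP smoothFn a c ^ k ∣ -starPoly R * (fnA a c K + fnB a c K) +
      starPoly P * (fnA a c K - fnB a c K) := by
  refine dvd_of_forall_map fun p => ?_
  have h1 := (annihilates_map h.dvd p).sharp
  rw [sharpP_of_even (reflP_map_of_even h.mem_fst.1 p),
    sharpP_of_odd (reflP_map_of_odd h.mem_snd.1 p), ← map_starPoly, ← map_starPoly] at h1
  rw [Polynomial.map_add, Polynomial.map_mul, Polynomial.map_mul, Polynomial.map_neg, map_fnA_add,
    map_fnA_sub]
  exact h1

end

end DNLS

/-! ### The Lax pair of the transformed potential -/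

namespace DNLS

open Polynomial ComplexConjugate

noncomputable section

variable {a c : ℝ} {k : ℕ}

/-- The derivative in `x`. -/
abbrev dX : Derivation ℂ smoothFn smoothFn := dirDeriv (1, 0)

/-- The derivative in `t`. -/
abbrev dT : Derivation ℂ smoothFn smoothFn := dirDeriv (0, 1)

lemma flowFactor_x (a c : ℝ) : flowFactor a c (1, 0) = 1 := by
  simp [flowFactor]

lemma flowFactor_t (a c : ℝ) : flowFactor a c (0, 1) = 2 * X ^ 2 + C (2 * cR (a / 2) - cR c ^ 2) := by
  have : algebraMap ℂ smoothFn (a - c ^ 2) = 2 * cR (a / 2) - cR c ^ 2 := by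
    rw [cR, cR, ← map_pow, two_mul, ← map_add, ← map_sub]
    congr 1; push_cast; ring
  simp [flowFactor, ← this]

/-- The transformed potential, with the phase of the seed removed, in terms of the leading
coefficients of the normalized annihilator. -/
def newAmp (a c : ℝ) (k : ℕ) (P R : smoothFn[X]) : smoothFn :=
  algebraMap ℂ smoothFn ((a / 2) ^ (2 * k)) * (P.coeff (2 * k) *
    (algebraMap ℂ smoothFn c * P.coeff (2 * k) -
      2 * algebraMap ℂ smoothFn Complex.I * R.coeff (2 * k - 1)))

variable {P R : smoothFn[X]}

/-- The prefactor in `newAmp` inverts the conjugate leading coefficient of P. This form is the one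
needed for cancelling top-degree terms. -/
lemma IsNormalAnnihilator.newAmp_mul {K : ℕ} (h : IsNormalAnnihilator a c K k P R) :
    newAmp a c k P R * star (P.coeff (2 * k)) =
      cR c * P.coeff (2 * k) - 2 * cI * R.coeff (2 * k - 1) := by
  rw [newAmp, cR, cI]
  linear_combination (algebraMap ℂ smoothFn c * P.coeff (2 * k) -
      2 * algebraMap ℂ smoothFn Complex.I * R.coeff (2 * k - 1)) * h.norm_coeff

/-- Evolution of the annihilator in `x`. -/
lemma IsNormalAnnihilator.flow_x (hc : c ≠ 0) (hac : c ^ 2 < 2 * a) (hk : 1 ≤ k)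
    (h : IsNormalAnnihilator a c (k + 1) k P R) :
    polyDeriv dX P + X * (C (newAmp a c k P R) * starPoly R - C (cR c) * R) + X ^ 2 * 0 = 0 ∧
    (polyDeriv dX R + C (2 * cI * cR (a / 2)) * R) +
      X * (C (cR c) * P - C (newAmp a c k P R) * starPoly P) + X ^ 2 * (C (-2 * cI) * R) = 0 := by
  set s := newAmp a c k P R with hs
  have h1 := dvd_polyDeriv (by omega) h.dvd (1, 0)
  rw [flowFactor_x] at h1
  have hsP := h.newAmp_mul
  have hP := h.mem_fst
  have hR := h.mem_snd
  refine eq_zero_of_dvd hc hac hk (K := k + 1) (polyDeriv_mem_evenPart dX hP)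
    (Submodule.sub_mem _ (C_mul_mem _ (starPoly_mem_oddPart hR)) (C_mul_mem _ hR))
    (Submodule.zero_mem _)
    (Submodule.add_mem _ (polyDeriv_mem_oddPart dX hR) (C_mul_mem _ hR))
    (Submodule.sub_mem _ (C_mul_mem _ hP) (C_mul_mem _ (starPoly_mem_evenPart hP)))
    (C_mul_mem _ hR) ?_ (Polynomial.coeff_zero _) ?_ ?_
  · rw [coeff_polyDeriv, h.coeff_zero, Derivation.map_one_eq_zero]
  -- The coefficient of degree 2k + 1 is cP₂ₖ - sP₂ₖ* - 2iR₂ₖ₋₁; its vanishing is what determines s.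
  · simp only [coeff_sub, coeff_C_mul, coeff_starPoly]
    linear_combination -hsP
  -- Subtracting `diagL`·(P, R) removes the diagonal term from the even component, and subtracting
  -- λs·(-R*, P*) removes the excess degree from the odd one.
  · refine (dvd_sub (dvd_sub h1 (h.dvd.mul_left (diagL a))) (h.dvd_star.mul_left
      (X * C s))).trans (dvd_of_eq ?_)
    simp only [diagL, C_mul, map_neg, C_ofNat]
    ring

lemma deriv_two (D : Derivation ℂ smoothFn smoothFn) : D 2 = 0 := by
  have := D.map_natCast 2
  rwa [Nat.cast_ofNat] at this

/-- The second component of the flux of the transformed potential. -/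
def newFlux (a : ℝ) (s : smoothFn) : smoothFn :=
  -cI * dX s + 2 * cR (a / 2) * s - s * star s * s

/-- Evolution of the annihilator in `t`. -/
lemma IsNormalAnnihilator.flow_t (hc : c ≠ 0) (hac : c ^ 2 < 2 * a) (hk : 1 ≤ k)
    (h : IsNormalAnnihilator a c (k + 1) k P R) {s : smoothFn} (hs : s = newAmp a c k P R) :
    polyDeriv dT P + X * (C (newFlux a s) * starPoly R -
        C ((2 * cR (a / 2) - cR c ^ 2) * cR c) * R) +
      X ^ 2 * (C (-2) * polyDeriv dX P + C (cI * (s * star s) - cI * cR c ^ 2) * P) = 0 ∧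
    (polyDeriv dT R + C (2 * cI * cR (a / 2) * (2 * cR (a / 2) - cR c ^ 2)) * R) +
      X * (C ((2 * cR (a / 2) - cR c ^ 2) * cR c) * P - C (newFlux a s) * starPoly P) +
      X ^ 2 * (C (-2) * polyDeriv dX R + C (cI * (s * star s) + cI * cR c ^ 2 -
        4 * cI * cR (a / 2)) * R) = 0 := by
  have h1 := dvd_polyDeriv (by omega) h.dvd (1, 0)
  have h2 := dvd_polyDeriv (by omega) h.dvd (0, 1)
  rw [flowFactor_x] at h1
  rw [flowFactor_t] at h2
  have hsP := h.newAmp_mul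
  obtain ⟨hx, -⟩ := h.flow_x hc hac hk
  rw [← hs] at hsP hx
  have hP := h.mem_fst
  have hR := h.mem_snd
  -- The top coefficients of the x-flow, their conjugates and the x-derivative of the relation
  -- defining s are the facts from which the top-degree cancellations in the t-flow follow.
  have hx' := congrArg (fun q => q.coeff (2 * k - 1 + 1)) hx
  simp only [coeff_add, coeff_X_mul, coeff_sub, coeff_C_mul, coeff_starPoly, mul_zero, add_zero,
    Polynomial.coeff_zero, coeff_polyDeriv] at hx'
  rw [show 2 * k - 1 + 1 = 2 * k by omega] at hx'
  have hsP' := congrArg star hsP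
  simp only [star_mul, star_sub, star_cI, star_cR, star_star, star_ofNat] at hsP'
  have hxs := congrArg star hx'
  simp only [star_add, star_sub, star_mul, star_star, star_cR, star_zero, ← dirDeriv_star] at hxs
  have hsx := congrArg dX hsP
  simp only [map_sub, Derivation.leibniz, smul_eq_mul, deriv_cI, deriv_cR, mul_zero, add_zero,
    deriv_two] at hsx
  have hI := cI_mul_cI
  refine eq_zero_of_dvd hc hac hk (K := k + 1) (polyDeriv_mem_evenPart dT hP)
    (Submodule.sub_mem _ (C_mul_mem _ (starPoly_mem_oddPart hR)) (C_mul_mem _ hR))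
    (Submodule.add_mem _ (C_mul_mem _ (polyDeriv_mem_evenPart dX hP)) (C_mul_mem _ hP))
    (Submodule.add_mem _ (polyDeriv_mem_oddPart dT hR) (C_mul_mem _ hR))
    (Submodule.sub_mem _ (C_mul_mem _ hP) (C_mul_mem _ (starPoly_mem_evenPart hP)))
    (Submodule.add_mem _ (C_mul_mem _ (polyDeriv_mem_oddPart dX hR)) (C_mul_mem _ hR)) ?_ ?_ ?_ ?_
  · rw [coeff_polyDeriv, h.coeff_zero, Derivation.map_one_eq_zero]
  · simp only [coeff_add, coeff_C_mul, coeff_polyDeriv]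
    linear_combination -2 * hx' + cI * s * hsP' + cI * cR c * hsP +
      (2 * s * star (R.coeff (2 * k - 1)) - 2 * cR c * R.coeff (2 * k - 1)) * hI
  · simp only [coeff_add, coeff_sub, coeff_C_mul, coeff_polyDeriv, coeff_starPoly, newFlux]
    linear_combination cI * hsx + cI * cR c * hx' - cI * s * hxs +
      (cR c ^ 2 + s * star s - 2 * cR (a / 2)) * hsP + s * cR c * hsP' -
      2 * dX (R.coeff (2 * k - 1)) * hI
  -- The t-flow is 2λ² + (a - c²) times the x-flow. Subtracting 2λ² times the differentiated
  -- x-relation lowers the degree; the other multiples of (P, R) and (-R*, P*) cancel what is left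
  -- of the top and diagonal terms.
  · refine (dvd_add (dvd_sub (dvd_sub h2 (h1.mul_left (2 * X ^ 2)))
      (h.dvd_star.mul_left (X * C (newFlux a s)))) (h.dvd.mul_left
      (C (cI * (s * star s) - cI * cR c ^ 2) * X ^ 2 -
        C (2 * cR (a / 2) - cR c ^ 2) * diagL a))).trans (dvd_of_eq ?_)
    simp only [diagL, C_mul, C_sub, C_add, map_neg, C_ofNat, map_pow]
    ring

end

end DNLS

/-! ### Compatibility of the flows and the DNLS equation -/

namespace DNLS

open Polynomial ComplexConjugate

noncomputable section

variable {a c : ℝ} {k : ℕ}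

/-- The equation for the amplitude of the transformed potential. -/
lemma IsNormalAnnihilator.deriv_newAmp {P R : smoothFn[X]} (hc : c ≠ 0) (hac : c ^ 2 < 2 * a)
    (hk : 1 ≤ k) (h : IsNormalAnnihilator a c (k + 1) k P R) :
    dT (newAmp a c k P R) + 2 * cI * cR (a / 2) * (2 * cR (a / 2) - cR c ^ 2) * newAmp a c k P R =
      dX (newFlux a (newAmp a c k P R)) + 2 * cI * cR (a / 2) * newFlux a (newAmp a c k P R) := by
  -- The coefficient of λ is taken because P(0) = P(0)* = 1 there: both equations become first-order
  -- equations for the single function r with source terms s and `newFlux`.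
  have h1 := congrArg (fun q => q.coeff (0 + 1)) (h.flow_x hc hac hk).2
  have h2 := congrArg (fun q => q.coeff (0 + 1)) (h.flow_t hc hac hk rfl).2
  simp only [coeff_add, coeff_X_mul, coeff_sub, coeff_C_mul, coeff_starPoly, coeff_polyDeriv,
    h.coeff_zero, star_one, mul_one, coeff_X_pow_mul', Polynomial.coeff_zero] at h1 h2
  norm_num at h1 h2
  set s := newAmp a c k P R
  set r := R.coeff 1
  have h3 := congrArg dT h1
  have h4 := congrArg dX h2
  have e : dT (dX r) = dX (dT r) := dirDeriv_comm _ _ _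
  simp only [map_sub, map_add, Derivation.leibniz, Derivation.leibniz_pow, smul_eq_mul, deriv_cI,
    deriv_cR, mul_zero, add_zero, deriv_two, map_zero, e, smul_zero, sub_zero, zero_sub]
    at h3 h4
  -- Equality of the mixed derivatives of r eliminates r entirely.
  linear_combination h4 - h3 + 2 * cI * cR (a / 2) * (h2 - (2 * cR (a / 2) - cR c ^ 2) * h1)

lemma hasDerivAt_fst (f : smoothFn) (x t : ℝ) :
    HasDerivAt (fun y : ℝ => evalAt (y, t) f) (evalAt (x, t) (dX f)) x := by
  have h := (differentiable_smoothFn f (x, t)).hasFDerivAt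
  have h2 : HasDerivAt (fun y : ℝ => (y, t)) ((1 : ℝ), (0 : ℝ)) x :=
    (hasDerivAt_id x).prodMk (hasDerivAt_const x t)
  exact h.comp_hasDerivAt x h2

lemma hasDerivAt_snd (f : smoothFn) (x t : ℝ) :
    HasDerivAt (fun s : ℝ => evalAt (x, s) f) (evalAt (x, t) (dT f)) t := by
  have h := (differentiable_smoothFn f (x, t)).hasFDerivAt
  have h2 : HasDerivAt (fun s : ℝ => (x, s)) ((0 : ℝ), (1 : ℝ)) t :=
    (hasDerivAt_const t x).prodMk (hasDerivAt_id t)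
  exact h.comp_hasDerivAt t h2

lemma isSolution_of_smoothFn {q : ℝ → ℝ → ℂ} (Q : smoothFn) (hq : ∀ x t, q x t = evalAt (x, t) Q)
    (h : dT Q = -cI * dX (dX Q) - dX (Q * star Q * Q)) : IsSolution q := by
  obtain rfl : q = fun x t => evalAt (x, t) Q := by
    ext x t; exact hq x t
  refine ⟨contDiff_smoothFn Q, fun x t => ?_⟩
  have e1 : deriv (fun z : ℝ => evalAt (z, t) Q) = fun y => evalAt (y, t) (dX Q) := by
    ext y; exact (hasDerivAt_fst Q y t).deriv
  have e2 : (fun y : ℝ => ((‖evalAt (y, t) Q‖ ^ 2 : ℝ) : ℂ) * evalAt (y, t) Q) =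
      fun y => evalAt (y, t) (Q * star Q * Q) := by
    ext y
    rw [map_mul, map_mul, evalAt_star, Complex.mul_conj, Complex.normSq_eq_norm_sq]
  have h3 := congrArg (evalAt (x, t)) h
  simp only [map_sub, map_neg, map_mul (evalAt (x, t))] at h3
  have hI : evalAt (x, t) cI = Complex.I := by rw [cI, AlgHom.commutes]; rfl
  beta_reduce
  rw [(hasDerivAt_snd Q x t).deriv, iteratedDeriv_succ, iteratedDeriv_one, e1,
    (hasDerivAt_fst (dX Q) x t).deriv, e2, (hasDerivAt_fst (Q * star Q * Q) x t).deriv, h3, hI]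
  linear_combination (-evalAt (x, t) (dX (dX Q))) * Complex.I_sq

/-- The equation is the conservation law q_t = (-iq_x - |q|²q)_x. Restoring the phase, q = e^{iθ}s,
turns e^{iθ}·`newFlux` into this flux and the amplitude equation into the law itself. -/
lemma isSolution_rogueWave (hc : c ≠ 0) (hac : c ^ 2 < 2 * a) (hk : 1 ≤ k) :
    IsSolution (rogueWave a c k) := by
  obtain ⟨P, R, h, hQ⟩ := exists_normal_annihilator hc hac hk (K := k + 1) (by omega)
  refine isSolution_of_smoothFn (halfPhaseFn a c ^ 2 * newAmp a c k P R) (fun x t => hQ (x, t)) ?_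
  have hs := h.deriv_newAmp hc hac hk
  set s := newAmp a c k P R
  set e := halfPhaseFn a c with he
  have ex : dX e = cI * cR (a / 2) * e := by
    rw [dirDeriv_halfPhaseFn, cI, cR, ← map_mul]; congr 2; push_cast; ring
  have et : dT e = cI * cR (a / 2) * (2 * cR (a / 2) - cR c ^ 2) * e := by
    have : (2 * cR (a / 2) - cR c ^ 2) = algebraMap ℂ smoothFn (a - c ^ 2) := by
      rw [cR, cR, ← map_pow, two_mul, ← map_add, ← map_sub]
      congr 1; push_cast; ring
    rw [dirDeriv_halfPhaseFn, this, cI, cR, ← map_mul, ← map_mul]; congr 2; push_cast; ring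
  have hee : star e * e = 1 := star_halfPhaseFn_mul a c
  have hI := cI_mul_cI
  have hQx : dX (e ^ 2 * s) = e ^ 2 * (dX s + 2 * cI * cR (a / 2) * s) := by
    rw [Derivation.leibniz, Derivation.leibniz_pow, ex]
    simp only [smul_eq_mul, nsmul_eq_mul, Nat.cast_ofNat, Nat.add_one_sub_one, pow_one]
    ring
  have hflux : e ^ 2 * newFlux a s = -cI * dX (e ^ 2 * s) - e ^ 2 * s * star (e ^ 2 * s) * (e ^ 2 * s) := by
    rw [hQx, newFlux, star_mul, star_pow]
    linear_combination (s * star s * s * e ^ 2 * (star e * e + 1)) * hee + 2 * e ^ 2 * cR (a / 2) * s * hI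
  have hfx : dX (e ^ 2 * newFlux a s) =
      e ^ 2 * (dX (newFlux a s) + 2 * cI * cR (a / 2) * newFlux a s) := by
    rw [Derivation.leibniz, Derivation.leibniz_pow, ex]
    simp only [smul_eq_mul, nsmul_eq_mul, Nat.cast_ofNat, Nat.add_one_sub_one, pow_one]
    ring
  have hQt : dT (e ^ 2 * s) = e ^ 2 * (dT s + 2 * cI * cR (a / 2) * (2 * cR (a / 2) - cR c ^ 2) * s) := by
    rw [Derivation.leibniz, Derivation.leibniz_pow, et]
    simp only [smul_eq_mul, nsmul_eq_mul, Nat.cast_ofNat, Nat.add_one_sub_one, pow_one]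
    ring
  have h5 := congrArg dX hflux
  rw [map_sub, Derivation.leibniz dX (-cI), map_neg, deriv_cI] at h5
  simp only [smul_eq_mul, neg_zero, mul_zero, add_zero] at h5
  rw [hQt, hs, ← hfx, h5]

end

end DNLS

namespace DNLS

open Polynomial ComplexConjugate

noncomputable section

variable {a c : ℝ} {K k : ℕ} {x t : ℝ}

/-! ### Bounds on the modulus of the transformed potential -/

/-- Level zero is the untransformed seed; a degree below 2k is impossible here, hence the
alternative R = 0 in the structure. -/
lemma isMonicAnnihilator_zero (a c : ℝ) (K : ℕ) (x t : ℝ) :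
    IsMonicAnnihilator a c K x t 0 1 0 where
  annihilates := by simp [Annihilates]
  evenOdd := ⟨map_one _, by simp⟩
  natDegree_fst := by simp
  natDegree_snd := Or.inr rfl
  coeff_fst := by simp

lemma exists_isMonicAnnihilator (hc : c ≠ 0) (hac : c ^ 2 < 2 * a) (K : ℕ) (x t : ℝ) (k : ℕ) :
    ∃ P R, IsMonicAnnihilator a c K x t k P R := by
  rcases Nat.eq_zero_or_pos k with rfl | hk
  · exact ⟨1, 0, isMonicAnnihilator_zero a c K x t⟩
  · obtain ⟨P, R, -, -, -, -, h⟩ := exists_smooth_annihilator hc hac hk K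
    exact ⟨_, _, h (x, t)⟩

lemma coeff_two_mul {p q : ℂ[X]} :
    (p * q).coeff 2 = p.coeff 0 * q.coeff 2 + p.coeff 1 * q.coeff 1 + p.coeff 2 * q.coeff 0 := by
  rw [coeff_mul, Finset.Nat.sum_antidiagonal_eq_sum_range_succ_mk]
  simp [Finset.sum_range_succ]

/-- The coefficients of a quadratic factor. -/
lemma quadratic_factor {U V : ℂ[X]} (h : EvenOdd U V) (hV : V.natDegree ≤ 1)
    (hU : U.coeff 2 = 1) (hn : U * conjP U + V * conjP V = quadP ℂ a c * quadM ℂ a c) :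
    U.coeff 0 * conj (U.coeff 0) = (a / 2) ^ 2 ∧
      U.coeff 0 + conj (U.coeff 0) + V.coeff 1 * conj (V.coeff 1) = c ^ 2 - a := by
  have h0 := congrArg (fun p => p.coeff 0) hn
  have h2 := congrArg (fun p => p.coeff 2) hn
  have hU1 : U.coeff 1 = 0 := coeff_of_even h.1 odd_one
  have hV0 : V.coeff 0 = 0 := coeff_zero_of_odd h.2
  have hV2 : V.coeff 2 = 0 := coeff_eq_zero_of_natDegree_lt (by omega)
  simp only [coeff_add, mul_coeff_zero, coeff_conjP, hV0, zero_mul, add_zero] at h0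
  simp only [coeff_add, coeff_two_mul, coeff_conjP, hU, hU1, hV0, hV2, add_zero, map_zero,
    mul_zero, map_one, mul_one, one_mul, zero_add] at h2
  have e0 : (quadP ℂ a c).coeff 0 = -(a / 2) := by simp [quadP]
  have e0' : (quadM ℂ a c).coeff 0 = -(a / 2) := by simp [quadM]
  have e1 : (quadP ℂ a c).coeff 1 = Complex.I * c := by
    simp [quadP, coeff_X_pow, coeff_C]
  have e1' : (quadM ℂ a c).coeff 1 = -(Complex.I * c) := by
    simp [quadM, coeff_X_pow, coeff_C]
  have e2 : (quadP ℂ a c).coeff 2 = 1 := by simp [quadP]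
  have e2' : (quadM ℂ a c).coeff 2 = 1 := by simp [quadM]
  rw [e0, e0'] at h0
  rw [e0, e0', e1, e1', e2, e2'] at h2
  exact ⟨by linear_combination h0, by linear_combination h2 - c ^ 2 * Complex.I_sq⟩

/-- |z| = a/2 gives Re z ≥ -a/2, so |w|² = c² - a - 2 Re z ≤ c²; equality pins z to the leftmost
point of the circle. -/
lemma norm_le_of_quadratic (ha : 0 < a) {z w : ℂ} (h0 : z * conj z = (a / 2) ^ 2)
    (h2 : z + conj z + w * conj w = c ^ 2 - a) :
    ‖w‖ ≤ |c| ∧ (‖w‖ = |c| → z = -(a / 2)) := by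
  rw [Complex.mul_conj] at h0
  rw [Complex.mul_conj, Complex.add_conj] at h2
  have h0' : Complex.normSq z = (a / 2) ^ 2 := by exact_mod_cast h0
  have h2' : 2 * z.re + Complex.normSq w = c ^ 2 - a := by exact_mod_cast h2
  rw [Complex.normSq_apply] at h0'
  rw [Complex.normSq_eq_norm_sq] at h2'
  have hre : -(a / 2) ≤ z.re := by nlinarith [sq_nonneg z.im]
  refine ⟨abs_le_of_sq_le_sq' ?_ (abs_nonneg c) |>.2, fun h => ?_⟩
  · rw [sq_abs]; linarith
  · rw [h, sq_abs] at h2'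
    have hre' : z.re = -(a / 2) := by linarith
    rw [hre'] at h0'
    have him : z.im = 0 := by nlinarith
    apply Complex.ext
    · simpa using hre'
    · simpa using him

lemma natDegree_fst_le_of_mul {M U : ℂ[X]} (hM : M.Monic) {m n : ℕ} (hm : M.natDegree = m)
    (h : (M * U).natDegree ≤ m + n) : U.natDegree ≤ n := by
  by_cases h0 : U = 0
  · simp [h0]
  rw [hM.natDegree_mul' h0, hm] at h
  omega

lemma reflP_quotient {M U : ℂ[X]} (hM : M.Monic) (hM' : reflP M = M) {s : ℂ[X]}
    (h : reflP (M * U) = s * (M * U)) : reflP U = s * U := by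
  rw [map_mul, hM'] at h
  exact mul_left_cancel₀ hM.ne_zero (h.trans (by ring))

lemma reflP_quad_pow (k : ℕ) :
    reflP ((quadP ℂ a c * quadM ℂ a c) ^ k) = (quadP ℂ a c * quadM ℂ a c) ^ k := by
  rw [map_pow, map_mul, reflP_quadP, reflP_quadM, mul_comm]

lemma conjP_quad_pow (k : ℕ) :
    conjP ((quadP ℂ a c * quadM ℂ a c) ^ k) = (quadP ℂ a c * quadM ℂ a c) ^ k := by
  rw [map_pow, map_mul, conjP_quadP, conjP_quadM, mul_comm]

variable {P R P' R' : ℂ[X]}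

lemma IsMonicAnnihilator.natDegree_snd_le (h : IsMonicAnnihilator a c K x t k P R) :
    R.natDegree ≤ 2 * k - 1 := by
  rcases h.natDegree_snd with h | h
  · omega
  · simp [h]

/-- Consecutive Darboux transformations differ by a factor of degree two. -/
lemma IsMonicAnnihilator.norm_coeff_sub_le (hc : c ≠ 0) (hac : c ^ 2 < 2 * a)
    (h : IsMonicAnnihilator a c K x t (k + 1) P R) (h' : IsMonicAnnihilator a c K x t k P' R') :
    ‖R.coeff (2 * k + 1) - R'.coeff (2 * k - 1)‖ ≤ |c| := by
  have ha := pos_of_lt hac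
  set M := (quadP ℂ a c * quadM ℂ a c) ^ k with hM
  have hMm : M.Monic := monic_quad_pow k
  have hMd : M.natDegree = 4 * k := natDegree_quad_pow k
  have hMr : reflP M = M := reflP_quad_pow k
  have hMc : conjP M = M := conjP_quad_pow k
  -- An annihilator of order k + 1 is in particular one of order k, so the order-k data (P', R') can
  -- be divided out of it.
  have g1 : Annihilates a c K x t k P R := (pow_dvd_pow _ (Nat.le_succ k)).trans h.annihilates
  have g2 := h'.annihilates
  have g3 := h'.annihilates.sharp
  rw [sharpP_of_even h'.evenOdd.1, sharpP_of_odd h'.evenOdd.2] at g3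
  have d1 : M ∣ P * conjP P' + R * conjP R' := by
    refine pow_mul_dvd_of_even hc ha.ne' (Or.inl ?_) (Annihilates.dvd_of_mul (K := K) (x := x)
      (t := t) ?_ ?_)
    · rw [map_add, map_mul, map_mul, reflP_conjP, reflP_conjP, h.evenOdd.1, h.evenOdd.2,
        h'.evenOdd.1, h'.evenOdd.2]
      simp
    · exact (dvd_sub (g1.mul_left (conjP P')) (g3.mul_left R)).trans (dvd_of_eq (by ring))
    · exact (dvd_add (g1.mul_left (conjP R')) (g3.mul_left P)).trans (dvd_of_eq (by ring))
  have d2 : M ∣ R * P' - P * R' := by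
    refine pow_mul_dvd_of_even hc ha.ne' (Or.inr ?_) (Annihilates.dvd_of_mul (K := K) (x := x)
      (t := t) ?_ ?_)
    · rw [map_sub, map_mul, map_mul, h.evenOdd.1, h.evenOdd.2, h'.evenOdd.1, h'.evenOdd.2]
      ring
    · exact (dvd_sub (g2.mul_left R) (g1.mul_left R')).trans (dvd_of_eq (by ring))
    · exact (dvd_sub (g1.mul_left P') (g2.mul_left P)).trans (dvd_of_eq (by ring))
  obtain ⟨U, hU⟩ := d1
  obtain ⟨V, hV⟩ := d2
  have hPd := h.natDegree_fst
  have hPd' := h'.natDegree_fst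
  have hRd := h.natDegree_snd_le
  have hRd' := h'.natDegree_snd_le
  have hR0 : k = 0 → R' = 0 := fun hk => by
    rcases h'.natDegree_snd with h1 | h1
    · omega
    · exact h1
  have dU : U.natDegree ≤ 2 := by
    refine natDegree_fst_le_of_mul hMm hMd (hU ▸ (natDegree_add_le _ _).trans (max_le ?_ ?_)) <;>
      refine natDegree_mul_le.trans ?_ <;> rw [natDegree_conjP] <;> omega
  have dV : V.natDegree ≤ 1 := by
    refine natDegree_fst_le_of_mul hMm hMd (hV ▸ (natDegree_sub_le _ _).trans (max_le ?_ ?_))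
    · refine natDegree_mul_le.trans ?_; omega
    · rcases Nat.eq_zero_or_pos k with h0 | h0
      · simp [hR0 h0]
      · refine natDegree_mul_le.trans ?_; omega
  have hM1 : M.coeff (4 * k) = 1 := by rw [← hMd]; exact hMm.coeff_natDegree
  have cU : U.coeff 2 = 1 := by
    have e := coeff_mul_add_eq_of_natDegree_le hMd.le dU
    rw [hM1, one_mul, ← hU, coeff_add] at e
    have e1 := coeff_mul_add_eq_of_natDegree_le hPd
      (show (conjP P').natDegree ≤ 2 * k by rwa [natDegree_conjP])
    have e2 : (R * conjP R').coeff (4 * k + 2) = 0 := by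
      rcases Nat.eq_zero_or_pos k with h0 | h0
      · simp [hR0 h0]
      · apply coeff_eq_zero_of_natDegree_lt
        refine natDegree_mul_le.trans_lt ?_
        rw [natDegree_conjP]; omega
    rw [h.coeff_fst, coeff_conjP, h'.coeff_fst, map_one, one_mul,
      show 2 * (k + 1) + 2 * k = 4 * k + 2 by ring] at e1
    rw [← e, e1, e2, add_zero]
  -- For k = 0 the truncated index 2k - 1 is 0, and the second term vanishes because R' = 0.
  have cV : V.coeff 1 = R.coeff (2 * k + 1) - R'.coeff (2 * k - 1) := by
    have e := coeff_mul_add_eq_of_natDegree_le hMd.le dV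
    rw [hM1, one_mul, ← hV, coeff_sub] at e
    have e1 := coeff_mul_add_eq_of_natDegree_le (show R.natDegree ≤ 2 * k + 1 by omega) hPd'
    rw [h'.coeff_fst, mul_one, show 2 * k + 1 + 2 * k = 4 * k + 1 by ring] at e1
    rw [← e, e1]
    rcases Nat.eq_zero_or_pos k with h0 | h0
    · simp [hR0 h0]
    · have e2 := coeff_mul_add_eq_of_natDegree_le hPd hRd'
      rw [h.coeff_fst, one_mul, show 2 * (k + 1) + (2 * k - 1) = 4 * k + 1 by omega] at e2
      rw [e2]
  have hUV : EvenOdd U V := by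
    constructor
    · refine (reflP_quotient hMm hMr (s := 1) ?_).trans (one_mul _)
      rw [← hU, map_add, map_mul, map_mul, reflP_conjP, reflP_conjP, h.evenOdd.1, h.evenOdd.2,
        h'.evenOdd.1, h'.evenOdd.2]
      simp
    · refine (reflP_quotient hMm hMr (s := -1) ?_).trans (neg_one_mul _)
      rw [← hV, map_sub, map_mul, map_mul, h.evenOdd.1, h.evenOdd.2, h'.evenOdd.1, h'.evenOdd.2]
      ring
  have hn : U * conjP U + V * conjP V = quadP ℂ a c * quadM ℂ a c := by
    have n1 := h.evenOdd.norm_eq hc ha.ne' h.annihilates h.natDegree_fst h.coeff_fst h.natDegree_snd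
    have n2 := h'.evenOdd.norm_eq hc ha.ne' h'.annihilates h'.natDegree_fst h'.coeff_fst
      h'.natDegree_snd
    rw [pow_succ, ← hM] at n1
    rw [← hM] at n2
    have hU' := congrArg conjP hU
    have hV' := congrArg conjP hV
    simp only [map_add, map_sub, map_mul, conjP_conjP, hMc] at hU' hV'
    -- Lagrange's identity: (PP* + RR*)(P'P'* + R'R'*) is the sum of the norms of PP'* + RR'* and
    -- RP' - PR'.
    apply mul_left_cancel₀ (mul_ne_zero hMm.ne_zero hMm.ne_zero)
    linear_combination (-(M * conjP U)) * hU - (P * conjP P' + R * conjP R') * hU' -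
      M * conjP V * hV - (R * P' - P * R') * hV' +
      (P' * conjP P' + R' * conjP R') * n1 + M * (quadP ℂ a c * quadM ℂ a c) * n2
  obtain ⟨q0, q2⟩ := quadratic_factor hUV dV cU hn
  rw [← cV]
  exact (norm_le_of_quadratic ha q0 q2).1

/-- The bound on the modulus. -/
lemma norm_amplitude_le (hc : c ≠ 0) (hac : c ^ 2 < 2 * a)
    (h : IsMonicAnnihilator a c K x t 1 P' R') : ∀ {k : ℕ} {P R : ℂ[X]},
    IsMonicAnnihilator a c K x t (k + 1) P R →
    ‖(c : ℂ) - 2 * Complex.I * R.coeff (2 * k + 1)‖ ≤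
      ‖(c : ℂ) - 2 * Complex.I * R'.coeff 1‖ + 2 * k * |c| := by
  intro k
  induction k with
  | zero =>
    intro P R hP
    -- Two monic annihilators of order 1 coincide: their leading terms cancel and an annihilator of
    -- degree at most 1 is zero.
    have e : R = R' := by
      have hd := h.natDegree_fst
      have hd' := hP.natDegree_fst
      have hr := h.natDegree_snd_le
      have hr' := hP.natDegree_snd_le
      have hPP : (P - P').natDegree ≤ 1 := by
        rw [natDegree_le_iff_coeff_eq_zero]
        intro N hN
        rcases (Nat.succ_le_of_lt hN).eq_or_lt with h2 | h2
        · have e1 := h.coeff_fst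
          have e2 := hP.coeff_fst
          norm_num at h2 e1 e2
          rw [← h2, coeff_sub, e1, e2, sub_self]
        · rw [coeff_sub, coeff_eq_zero_of_natDegree_lt (by omega),
            coeff_eq_zero_of_natDegree_lt (by omega), sub_self]
      have := eq_zero_of_natDegree_lt (m := 1) (k := 1) hPP
        ((natDegree_sub_le _ _).trans (max_le (by omega) (by omega))) (by norm_num)
        ((hP.evenOdd.sub h.evenOdd).dvd_norm hc (pos_of_lt hac).ne'
          (hP.annihilates.sub h.annihilates))
      exact sub_eq_zero.mp this.2
    simp [e]
  | succ k ih =>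
    intro P R hP
    obtain ⟨P₁, R₁, h₁⟩ := exists_isMonicAnnihilator hc hac K x t (k + 1)
    have h2 := hP.norm_coeff_sub_le hc hac h₁
    have h3 := ih h₁
    have e : (c : ℂ) - 2 * Complex.I * R.coeff (2 * (k + 1) + 1) =
        ((c : ℂ) - 2 * Complex.I * R₁.coeff (2 * k + 1)) -
          2 * Complex.I * (R.coeff (2 * (k + 1) + 1) - R₁.coeff (2 * (k + 1) - 1)) := by
      rw [show 2 * (k + 1) - 1 = 2 * k + 1 by omega]; ring
    rw [e]
    refine (norm_sub_le _ _).trans ?_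
    have h4 : ‖2 * Complex.I * (R.coeff (2 * (k + 1) + 1) - R₁.coeff (2 * (k + 1) - 1))‖ ≤
        2 * |c| := by
      rw [norm_mul, norm_mul, Complex.norm_I]
      simpa using h2
    push_cast
    linarith

/-- Equality in the triangle inequality |c - 2iw| ≤ |c| + 2|w| forces -2iw to point in the direction
of c. -/
lemma eq_of_norm_extremal {c : ℝ} {w : ℂ} (h1 : ‖w‖ ≤ |c|)
    (h2 : 3 * |c| ≤ ‖(c : ℂ) - 2 * Complex.I * w‖) : w = Complex.I * c := by
  have h1' : ‖w‖ ^ 2 ≤ c ^ 2 := by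
    rw [← sq_abs c]; gcongr
  have h2' : 9 * c ^ 2 ≤ ‖(c : ℂ) - 2 * Complex.I * w‖ ^ 2 := by
    rw [← sq_abs c]
    have := pow_le_pow_left₀ (by positivity) h2 2
    nlinarith
  rw [← Complex.normSq_eq_norm_sq, Complex.normSq_apply] at h1' h2'
  simp at h2'
  have h3 : w.re ^ 2 + (w.im - c) ^ 2 ≤ 0 := by nlinarith
  have hre : w.re = 0 := by nlinarith [sq_nonneg w.re, sq_nonneg (w.im - c)]
  have him : w.im = c := by
    have : (w.im - c) ^ 2 = 0 := by nlinarith [sq_nonneg w.re, sq_nonneg (w.im - c)]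
    linarith [pow_eq_zero_iff (two_ne_zero) |>.mp this]
  apply Complex.ext <;> simp [hre, him]

/-- At the first level the extremal value is attained at the origin only. -/
lemma eq_zero_of_extremal (hc : c ≠ 0) (hac : c ^ 2 < 2 * a)
    (h : IsMonicAnnihilator a c K x t 1 P R)
    (h3 : 3 * |c| ≤ ‖(c : ℂ) - 2 * Complex.I * R.coeff 1‖) : x = 0 ∧ t = 0 := by
  have ha := pos_of_lt hac
  have hd := h.natDegree_fst
  have hr := h.natDegree_snd_le
  have hn := h.evenOdd.norm_eq hc ha.ne' h.annihilates h.natDegree_fst h.coeff_fst h.natDegree_snd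
  rw [pow_one] at hn
  obtain ⟨q0, q2⟩ := quadratic_factor h.evenOdd hr h.coeff_fst hn
  obtain ⟨b1, b2⟩ := norm_le_of_quadratic ha q0 q2
  have hR1 := eq_of_norm_extremal b1 h3
  have hP0 := b2 (by rw [hR1]; simp)
  have hP : P = X ^ 2 - C (a / 2 : ℂ) := by
    ext j
    rcases j with _ | _ | _ | j
    · simp [hP0]
    · rw [zero_add, coeff_of_even h.evenOdd.1 odd_one]; simp [coeff_X_pow]
    · have := h.coeff_fst
      simp only [mul_one] at this
      simp [this]
    · rw [coeff_eq_zero_of_natDegree_lt (by omega)]; simp [coeff_X_pow]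
  have hR : R = C (Complex.I * c) * X := by
    ext j
    rcases j with _ | _ | j
    · simp [coeff_zero_of_odd h.evenOdd.2]
    · simp [hR1]
    · rw [coeff_eq_zero_of_natDegree_lt (by omega)]; simp
  have hsum : P + R = quadP ℂ a c := by rw [hP, hR, quadP]; simp; ring
  have hdif : P - R = quadM ℂ a c := by rw [hP, hR, quadM]; simp; ring
  have hann := h.annihilates
  rw [Annihilates, pow_one] at hann
  -- The annihilation relation equals (P + R)A + (P - R)B = `quadP`·A + `quadM`·B.
  have d1 : quadP ℂ a c ∣ quadM ℂ a c * partB a c K (x : ℂ) (t : ℂ) := by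
    have := dvd_sub hann (Dvd.intro (partA a c K (x : ℂ) (t : ℂ)) rfl)
    refine this.trans (dvd_of_eq ?_)
    rw [← hdif, ← hsum]; ring
  have hcop := isCoprime_quadP_quadM hc ha.ne'
  have d2 := hcop.dvd_of_dvd_mul_left d1
  rw [partB, mul_assoc, mul_assoc] at d2
  have d3 : quadP ℂ a c ∣ phase a c (x : ℂ) (t : ℂ) * sinhcTrunc K (sqExp a c (x : ℂ) (t : ℂ)) := by
    have := (dvd_C_mul (by simp : algebraMap ℂ ℂ Complex.I ≠ 0)).mp d2
    exact hcop.dvd_of_dvd_mul_left this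
  have d4 : quadP ℂ a c ∣ phase a c (x : ℂ) (t : ℂ) := by
    have e := ((quadP_dvd_sqExp a c (x : ℂ) (t : ℂ)).trans (dvd_sinhcTrunc_sub_one K _)).mul_left
      (phase a c (x : ℂ) (t : ℂ))
    refine (dvd_sub d3 e).trans (dvd_of_eq (by ring))
  obtain ⟨α, β, hα, hβ, e⟩ : ∃ α β : ℂ, α = 2 * t ∧ β = x + (a - c ^ 2) * t ∧
      phase a c (x : ℂ) (t : ℂ) = C α * X ^ 2 + C β := by
    refine ⟨_, _, rfl, rfl, ?_⟩
    rw [phase, C_mul, C_add, C_mul, C_ofNat]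
    simp only [Algebra.algebraMap_self, RingHom.id_apply]
    ring
  have hq2 : (quadP ℂ a c).coeff 2 = 1 := by simp [quadP]
  have hq1 : (quadP ℂ a c).coeff 1 = Complex.I * c := by simp [quadP, coeff_X_pow, coeff_C]
  have hq0 : (quadP ℂ a c).coeff 0 = -(a / 2) := by simp [quadP]
  rw [e] at d4
  -- The phase has no linear term while `quadP` has the nonzero one icX; a multiple of `quadP` of
  -- degree at most 2 without linear term is zero.
  have d5 : C α * X ^ 2 + C β - C α * quadP ℂ a c = 0 := by
    by_contra h0
    have h6 := natDegree_le_of_dvd (dvd_sub d4 (Dvd.intro_left (C α) rfl)) h0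
    rw [natDegree_quadP] at h6
    have h7 : (C α * X ^ 2 + C β - C α * quadP ℂ a c).natDegree ≤ 1 := by
      rw [natDegree_le_iff_coeff_eq_zero]
      intro N hN
      obtain ⟨n, rfl⟩ := Nat.exists_eq_add_of_le' (show 2 ≤ N from hN)
      rw [coeff_sub, coeff_C_mul]
      rcases n with _ | n
      · simp [hq2]
      · rw [coeff_eq_zero_of_natDegree_lt (p := quadP ℂ a c) (by rw [natDegree_quadP]; omega)]
        simp
    omega
  have c1 := congrArg (fun p => p.coeff 1) d5
  have c0 := congrArg (fun p => p.coeff 0) d5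
  have hcC : (c : ℂ) ≠ 0 := by exact_mod_cast hc
  have hα0 : α = 0 := by simpa [hq1, coeff_X_pow, coeff_C, hc] using c1
  have hβ0 : β = 0 := by simpa [hα0] using c0
  have ht : t = 0 := by
    rw [hα0] at hα
    have : (t : ℂ) = 0 := by linear_combination -hα / 2
    exact_mod_cast this
  rw [hβ0, ht] at hβ
  refine ⟨?_, ht⟩
  have : (x : ℂ) = 0 := by
    push_cast at hβ
    linear_combination -hβ
  exact_mod_cast this

/-- At the origin A = 1 and B = 0, so P + R is divisible by `quadP`^k and, being monic of degree 2k,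
equals it. -/
lemma IsMonicAnnihilator.coeff_origin (h : IsMonicAnnihilator a c K 0 0 k P R) (hk : 1 ≤ k) :
    R.coeff (2 * k - 1) = k * (Complex.I * c) := by
  have hann := h.annihilates
  have hph : phase a c ((0 : ℝ) : ℂ) ((0 : ℝ) : ℂ) = 0 := by simp [phase]
  have hA : partA a c K ((0 : ℝ) : ℂ) ((0 : ℝ) : ℂ) = 1 := by
    rw [partA, coshTrunc, sqExp, hph, Finset.sum_range_succ']
    simp
  have hB : partB a c K ((0 : ℝ) : ℂ) ((0 : ℝ) : ℂ) = 0 := by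
    rw [partB, hph]; simp
  rw [Annihilates, hA, hB] at hann
  simp only [add_zero, sub_zero, mul_one] at hann
  have hd := h.natDegree_fst
  have hr := h.natDegree_snd_le
  have hmon := monic_quadP_pow (A := ℂ) a c k
  have hq : (quadP ℂ a c ^ k).natDegree = 2 * k := by
    rw [(monic_quadP a c).natDegree_pow, natDegree_quadP, mul_comm]
  have hsum : P + R = quadP ℂ a c ^ k := by
    have hc1 : (P + R).coeff (2 * k) = 1 := by
      rw [coeff_add, h.coeff_fst, coeff_eq_zero_of_natDegree_lt (by omega), add_zero]
    refine eq_of_monic_of_dvd_of_natDegree_le hmon ?_ hann ?_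
    · exact monic_of_natDegree_le_of_coeff_eq_one (2 * k)
        ((natDegree_add_le _ _).trans (max_le hd (by omega))) hc1
    · rw [hq]; exact (natDegree_add_le _ _).trans (max_le hd (by omega))
  have h1 := (monic_quadP (R := ℂ) a c).nextCoeff_pow k
  rw [nextCoeff_of_natDegree_pos (by omega), nextCoeff_of_natDegree_pos (by simp [natDegree_quadP]),
    hq, ← hsum, coeff_add, natDegree_quadP,
    coeff_of_even h.evenOdd.1 (⟨k - 1, by omega⟩ : Odd (2 * k - 1)), zero_add] at h1
  rw [h1]
  simp [quadP, coeff_X_pow, coeff_C]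

/-- The maximum at the origin. -/
lemma dominant_peak (hc : c ≠ 0) (hac : c ^ 2 < 2 * a) (hk : 1 ≤ k) :
    |c| < ‖rogueWave a c k 0 0‖ ∧
      ∀ p : ℝ × ℝ, p ≠ (0, 0) → ‖rogueWave a c k p.1 p.2‖ < ‖rogueWave a c k 0 0‖ := by
  have hcp : 0 < |c| := abs_pos.mpr hc
  have h0 : ‖rogueWave a c k 0 0‖ = (2 * k + 1) * |c| := by
    obtain ⟨P, R, h⟩ := exists_isMonicAnnihilator hc hac k 0 0 k
    rw [h.norm_rogueWave hc hac hk (Nat.le_succ k), h.coeff_origin hk]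
    have : (c : ℂ) - 2 * Complex.I * (k * (Complex.I * c)) = (((2 * k + 1) * c : ℝ) : ℂ) := by
      push_cast
      linear_combination (-2 * k * c) * Complex.I_sq
    rw [this, Complex.norm_real, Real.norm_eq_abs, abs_mul, abs_of_pos (by positivity)]
  have hk' : (1 : ℝ) ≤ k := by exact_mod_cast hk
  refine ⟨by rw [h0]; nlinarith, fun p hp => ?_⟩
  rw [h0]
  obtain ⟨P, R, h⟩ := exists_isMonicAnnihilator hc hac k p.1 p.2 k
  obtain ⟨P', R', h'⟩ := exists_isMonicAnnihilator hc hac k p.1 p.2 1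
  obtain ⟨m, rfl⟩ := Nat.exists_eq_add_of_le' hk
  have h1 := norm_amplitude_le hc hac h' h
  rw [h.norm_rogueWave hc hac hk (Nat.le_succ _), show 2 * (m + 1) - 1 = 2 * m + 1 by omega]
  -- Strictness is needed only at the first level: the later levels add at most 2|c| each.
  have h2 : ‖(c : ℂ) - 2 * Complex.I * R'.coeff 1‖ < 3 * |c| := by
    by_contra! h3
    obtain ⟨e1, e2⟩ := eq_zero_of_extremal hc hac h' h3
    exact hp (Prod.ext e1 e2)
  push_cast
  linarith

end

end DNLS

namespace DNLS

open Polynomial ComplexConjugate Filter Topology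

noncomputable section

/-! ### Linear independence behind the Padé approximants of the exponential function -/

section Pade

/-- `p ↦ p' + 2 p`. -/
def shiftDeriv (p : ℂ[X]) : ℂ[X] := derivative p + C 2 * p

lemma coeff_shiftDeriv (p : ℂ[X]) (j : ℕ) :
    (shiftDeriv p).coeff j = p.coeff (j + 1) * (j + 1) + 2 * p.coeff j := by
  rw [shiftDeriv, coeff_add, coeff_derivative, coeff_C_mul]

lemma shiftDeriv_eq_zero {p : ℂ[X]} (h : shiftDeriv p = 0) : p = 0 := by
  have h1 := congrArg (fun q => q.coeff p.natDegree) h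
  simp only [coeff_shiftDeriv, coeff_eq_zero_of_natDegree_lt (Nat.lt_succ_self p.natDegree),
    zero_mul, zero_add, coeff_zero] at h1
  exact leadingCoeff_eq_zero.mp (by simpa using h1)

lemma X_pow_dvd_derivative {φ : PowerSeries ℂ} {n : ℕ} (h : PowerSeries.X ^ (n + 1) ∣ φ) :
    PowerSeries.X ^ n ∣ PowerSeries.derivative ℂ φ := by
  rw [PowerSeries.X_pow_dvd_iff] at h ⊢
  intro m hm
  rw [PowerSeries.coeff_derivative, h (m + 1) (by omega), zero_mul]

/-- For E = e^{2y} one has (pE)' = (p' + 2p)E, and n derivatives kill q while costing n orders of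
vanishing. -/
lemma X_pow_dvd_iterate_shiftDeriv {E : PowerSeries ℂ} (hE : IsUnit E)
    (hE' : PowerSeries.derivative ℂ E = 2 * E) (m : ℕ) : ∀ (n : ℕ) (p q : ℂ[X]),
    (∀ j, n ≤ j → q.coeff j = 0) → PowerSeries.X ^ (m + n) ∣ (p : PowerSeries ℂ) * E + (q : PowerSeries ℂ) →
    PowerSeries.X ^ m ∣ ((shiftDeriv^[n] p : ℂ[X]) : PowerSeries ℂ) := by
  intro n
  induction n with
  | zero =>
    intro p q hq h
    have : q = 0 := by ext j; simp [hq j (Nat.zero_le j)]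
    rw [this, Polynomial.coe_zero, add_zero, add_zero] at h
    exact (hE.dvd_mul_right).mp h
  | succ n ih =>
    intro p q hq h
    refine ih (shiftDeriv p) (derivative q) (fun j hj => ?_) ?_
    · rw [coeff_derivative, hq (j + 1) (by omega), zero_mul]
    · refine (X_pow_dvd_derivative h).trans (dvd_of_eq ?_)
      rw [map_add, Derivation.leibniz, hE', PowerSeries.derivative_coe, PowerSeries.derivative_coe,
        shiftDeriv, Polynomial.coe_add, Polynomial.coe_mul, Polynomial.coe_C]
      simp only [smul_eq_mul, map_ofNat]
      ring

/-- After k derivatives a polynomial of degree below k vanishes to order k, hence is zero, and p ↦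
p' + 2p is injective. -/
lemma eq_zero_of_X_pow_dvd {E : PowerSeries ℂ} (hE : IsUnit E)
    (hE' : PowerSeries.derivative ℂ E = 2 * E) {k : ℕ} {p q : ℂ[X]}
    (hp : ∀ j, k ≤ j → p.coeff j = 0) (hq : ∀ j, k ≤ j → q.coeff j = 0)
    (h : PowerSeries.X ^ (k + k) ∣ (p : PowerSeries ℂ) * E + (q : PowerSeries ℂ)) : p = 0 := by
  have h1 := X_pow_dvd_iterate_shiftDeriv hE hE' k k p q hq h
  rw [PowerSeries.X_pow_dvd_iff] at h1
  have h2 : ∀ n, ∀ j, k ≤ j → (shiftDeriv^[n] p).coeff j = 0 := fun n => by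
    induction n with
    | zero => exact hp
    | succ n ih =>
      intro j hj
      rw [Function.iterate_succ_apply', coeff_shiftDeriv, ih j hj, ih (j + 1) (by omega)]
      simp
  have h3 : shiftDeriv^[k] p = 0 := by
    ext j
    rcases lt_or_ge j k with hj | hj
    · simpa using h1 j hj
    · simpa using h2 k j hj
  have h4 : ∀ n, shiftDeriv^[n] p = 0 → p = 0 := fun n => by
    induction n with
    | zero => exact id
    | succ n ih =>
      intro hn
      rw [Function.iterate_succ_apply'] at hn
      exact ih (shiftDeriv_eq_zero hn)
  exact h4 k h3

lemma coshTrunc_add_sinhcTrunc {s : ℂ} (hs : s ^ 2 = 1) (K : ℕ) :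
    coshTrunc K (X ^ 2) + C s * (X * sinhcTrunc K (X ^ 2)) =
      ∑ j ∈ Finset.range (2 * (K + 1)), C (s ^ j / (j.factorial : ℂ)) * X ^ j := by
  induction K with
  | zero => simp [coshTrunc, sinhcTrunc, Finset.sum_range_succ]
  | succ K ih =>
    rw [show 2 * (K + 1 + 1) = 2 * (K + 1) + 1 + 1 by ring, Finset.sum_range_succ,
      Finset.sum_range_succ, ← ih, coshTrunc, sinhcTrunc, Finset.sum_range_succ _ (K + 1),
      Finset.sum_range_succ _ (K + 1), ← coshTrunc, ← sinhcTrunc]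
    have e1 : s ^ (2 * (K + 1)) = 1 := by rw [pow_mul, hs, one_pow]
    have e2 : s ^ (2 * (K + 1) + 1) = s := by rw [pow_succ, e1, one_mul]
    rw [e1, e2, div_eq_mul_one_div s, C_mul]
    simp only [Algebra.algebraMap_self, RingHom.id_apply]
    ring

lemma X_pow_dvd_sub_exp {s : ℂ} (hs : s ^ 2 = 1) (K : ℕ) :
    (PowerSeries.X : PowerSeries ℂ) ^ (2 * (K + 1)) ∣
      ((coshTrunc K (X ^ 2) + C s * (X * sinhcTrunc K (X ^ 2)) : ℂ[X]) : PowerSeries ℂ) -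
        PowerSeries.rescale s (PowerSeries.exp ℂ) := by
  rw [PowerSeries.X_pow_dvd_iff, coshTrunc_add_sinhcTrunc hs]
  intro m hm
  rw [map_sub, Polynomial.coeff_coe, finsetSum_coeff, PowerSeries.coeff_rescale,
    PowerSeries.coeff_exp, Finset.sum_eq_single m]
  · rw [coeff_C_mul_X_pow, if_pos rfl]; simp [div_eq_mul_inv]
  · intro j _ hj
    rw [coeff_C_mul_X_pow, if_neg (Ne.symm hj)]
  · intro h
    exact absurd (Finset.mem_range.mpr hm) h

/-- Vanishing of a combination of `sinh` and `cosh` to the maximal order. -/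
lemma eq_zero_of_sinh_cosh {K k : ℕ} (hK : k ≤ K) {γ : ℕ → ℂ}
    (h : X ^ (2 * k + 1) ∣ ∑ d ∈ Finset.range k, C (γ d) * X ^ d *
      (if Even d then X * sinhcTrunc K (X ^ 2) else coshTrunc K (X ^ 2))) :
    ∀ d < k, γ d = 0 := by
  set f : ℂ[X] := ∑ d ∈ Finset.range k, C (γ d) * X ^ d with hf
  set g : ℂ[X] := ∑ d ∈ Finset.range k, C ((-1) ^ d * γ d) * X ^ d with hg
  have cf : ∀ j, f.coeff j = if j < k then γ j else 0 := fun j => by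
    rw [hf, finsetSum_coeff]
    simp [coeff_X_pow]
  have cg : ∀ j, g.coeff j = if j < k then (-1) ^ j * γ j else 0 := fun j => by
    rw [hg, finsetSum_coeff]
    simp [coeff_C_mul, coeff_X_pow, -map_mul]
  set ch : ℂ[X] := coshTrunc K (X ^ 2)
  set sh : ℂ[X] := X * sinhcTrunc K (X ^ 2)
  -- With the hyperbolic functions written in exponentials, the sum becomes f(y)e^y - f(-y)e^{-y}; g
  -- is the reflection of f.
  have e : C 2 * ∑ d ∈ Finset.range k, C (γ d) * X ^ d * (if Even d then sh else ch) =
      f * (ch + C 1 * sh) - g * (ch + C (-1) * sh) := by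
    rw [hf, hg, Finset.sum_mul, Finset.sum_mul, ← Finset.sum_sub_distrib, Finset.mul_sum]
    refine Finset.sum_congr rfl fun d _ => ?_
    rw [C_ofNat]
    rcases Nat.even_or_odd d with hd | hd
    · rw [if_pos hd, hd.neg_one_pow]; simp; ring
    · rw [if_neg (Nat.not_even_iff_odd.mpr hd), hd.neg_one_pow]; simp; ring
  have h1 : (PowerSeries.X : PowerSeries ℂ) ^ (2 * k + 1) ∣
      ((f * (ch + C 1 * sh) - g * (ch + C (-1) * sh) : ℂ[X]) : PowerSeries ℂ) := by
    rw [← e]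
    obtain ⟨u, hu⟩ := h
    rw [hu, ← mul_assoc, mul_comm (C 2), mul_assoc, Polynomial.coe_mul, Polynomial.coe_pow,
      Polynomial.coe_X]
    exact dvd_mul_right _ _
  have hle : 2 * k + 1 ≤ 2 * (K + 1) := by omega
  have h2 := (pow_dvd_pow PowerSeries.X hle).trans (X_pow_dvd_sub_exp (s := 1) (by norm_num) K)
  have h3 := (pow_dvd_pow PowerSeries.X hle).trans (X_pow_dvd_sub_exp (s := -1) (by norm_num) K)
  set E₁ := PowerSeries.rescale (1 : ℂ) (PowerSeries.exp ℂ) with hE₁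
  set E₂ := PowerSeries.rescale (-1 : ℂ) (PowerSeries.exp ℂ) with hE₂
  have hE : E₁ * E₂ = 1 := by
    rw [hE₁, hE₂, PowerSeries.rescale_one]
    exact PowerSeries.exp_mul_exp_neg_eq_one
  have hd : PowerSeries.derivative ℂ E₁ = E₁ := by
    rw [hE₁, PowerSeries.rescale_one]
    exact PowerSeries.derivative_exp ℂ
  -- Multiplication by e^y leaves f e^{2y} - g with f and g of degree below k, to which the Padé
  -- argument applies.
  have h4 : (PowerSeries.X : PowerSeries ℂ) ^ (2 * k + 1) ∣
      (f : PowerSeries ℂ) * (E₁ * E₁) + ((-g : ℂ[X]) : PowerSeries ℂ) := by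
    have := (dvd_add (dvd_sub h1 (h2.mul_left (f : PowerSeries ℂ)))
      (h3.mul_left (g : PowerSeries ℂ))).mul_right E₁
    refine this.trans (dvd_of_eq ?_)
    rw [Polynomial.coe_sub, Polynomial.coe_mul, Polynomial.coe_mul, Polynomial.coe_neg]
    linear_combination (-(g : PowerSeries ℂ)) * hE
  have hf0 : f = 0 := by
    refine eq_zero_of_X_pow_dvd (E := E₁ * E₁) (k := k) (q := -g) ?_ ?_ (fun j hj => ?_)
      (fun j hj => ?_) ((pow_dvd_pow _ (by omega)).trans h4)
    · have := IsUnit.of_mul_eq_one E₂ hE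
      exact this.mul this
    · rw [Derivation.leibniz, hd, smul_eq_mul]; ring
    · rw [cf, if_neg (by omega)]
    · rw [coeff_neg, cg, if_neg (by omega), neg_zero]
  intro d hd
  have := cf d
  rw [hf0, coeff_zero, if_pos hd] at this
  exact this.symm

end Pade

end

end DNLS

namespace DNLS

open Polynomial ComplexConjugate Filter Topology

noncomputable section

/-! ### Coefficientwise convergence of polynomials -/

/-- Convergence of all coefficients. -/
def CoeffTendsto {α : Type*} (l : Filter α) (F : α → ℂ[X]) (G : ℂ[X]) : Prop :=
  ∀ j, Tendsto (fun i => (F i).coeff j) l (𝓝 (G.coeff j))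

namespace CoeffTendsto

variable {α : Type*} {l : Filter α} {F F' : α → ℂ[X]} {G G' : ℂ[X]}

lemma const (G : ℂ[X]) : CoeffTendsto l (fun _ => G) G := fun _ => tendsto_const_nhds

lemma C {f : α → ℂ} {z : ℂ} (h : Tendsto f l (𝓝 z)) :
    CoeffTendsto l (fun i => Polynomial.C (f i)) (Polynomial.C z) := fun j => by
  simp only [coeff_C]
  split_ifs
  · exact h
  · exact tendsto_const_nhds

lemma add (h : CoeffTendsto l F G) (h' : CoeffTendsto l F' G') :
    CoeffTendsto l (fun i => F i + F' i) (G + G') := fun j => by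
  simpa only [coeff_add] using (h j).add (h' j)

lemma neg (h : CoeffTendsto l F G) : CoeffTendsto l (fun i => -F i) (-G) := fun j => by
  simpa only [coeff_neg] using (h j).neg

lemma sub (h : CoeffTendsto l F G) (h' : CoeffTendsto l F' G') :
    CoeffTendsto l (fun i => F i - F' i) (G - G') := fun j => by
  simpa only [coeff_sub] using (h j).sub (h' j)

lemma mul (h : CoeffTendsto l F G) (h' : CoeffTendsto l F' G') :
    CoeffTendsto l (fun i => F i * F' i) (G * G') := fun j => by
  simp only [coeff_mul]
  exact tendsto_finsetSum _ fun p _ => (h p.1).mul (h' p.2)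

lemma pow (h : CoeffTendsto l F G) (n : ℕ) : CoeffTendsto l (fun i => F i ^ n) (G ^ n) := by
  induction n with
  | zero => simpa using const (1 : ℂ[X])
  | succ n ih => simpa only [pow_succ] using ih.mul h

lemma sum {ι : Type*} (s : Finset ι) {F : ι → α → ℂ[X]} {G : ι → ℂ[X]}
    (h : ∀ n ∈ s, CoeffTendsto l (F n) (G n)) :
    CoeffTendsto l (fun i => ∑ n ∈ s, F n i) (∑ n ∈ s, G n) := fun j => by
  simp only [finsetSum_coeff]
  exact tendsto_finsetSum _ fun n hn => h n hn j

lemma coshTrunc (h : CoeffTendsto l F G) (K : ℕ) :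
    CoeffTendsto l (fun i => DNLS.coshTrunc K (F i)) (DNLS.coshTrunc K G) :=
  sum _ fun m _ => (const _).mul (h.pow m)

lemma sinhcTrunc (h : CoeffTendsto l F G) (K : ℕ) :
    CoeffTendsto l (fun i => DNLS.sinhcTrunc K (F i)) (DNLS.sinhcTrunc K G) :=
  sum _ fun m _ => (const _).mul (h.pow m)

lemma taylor_coeff {N : ℕ} (h : CoeffTendsto l F G) (hF : ∀ i, (F i).natDegree < N)
    (hG : G.natDegree < N) (z : ℂ) (m : ℕ) :
    Tendsto (fun i => (taylor z (F i)).coeff m) l (𝓝 ((taylor z G).coeff m)) := by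
  have e : ∀ p : ℂ[X], p.natDegree < N → (taylor z p).coeff m =
      ∑ j ∈ Finset.range N, p.coeff j * (taylor z (X ^ j)).coeff m := fun p hp => by
    conv_lhs => rw [as_sum_range_C_mul_X_pow' p hp]
    rw [map_sum, finsetSum_coeff]
    refine Finset.sum_congr rfl fun j _ => ?_
    rw [← smul_eq_C_mul, map_smul, coeff_smul, smul_eq_mul]
  simp only [e _ (hF _), e _ hG]
  exact tendsto_finsetSum _ fun j _ => (h j).mul tendsto_const_nhds

end CoeffTendsto

/-! ### Solutions of linear systems with a small right-hand side -/

/-- By Cramer's rule τ^d ρ_d equals τ^k times a convergent quantity, and d < k leaves a positive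
power of τ. -/
lemma tendsto_zero_of_system {α : Type*} {l : Filter α} {k : ℕ}
    {N : α → Matrix (Fin k) (Fin k) ℂ} {N₀ : Matrix (Fin k) (Fin k) ℂ}
    (hN : Tendsto N l (𝓝 N₀)) (h0 : N₀.det ≠ 0) {τ : α → ℂ} (hτ : Tendsto τ l (𝓝 0))
    {ρ : α → ℕ → ℂ} {r : α → Fin k → ℂ} {r₀ : Fin k → ℂ} (hr : Tendsto r l (𝓝 r₀))
    (hs : ∀ᶠ i in l, τ i ≠ 0 ∧
      (N i).mulVec (fun d => τ i ^ (d : ℕ) * ρ i d) = τ i ^ k • r i) :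
    ∀ d < k, Tendsto (fun i => ρ i d) l (𝓝 0) := by
  intro d hd
  have hdet : Tendsto (fun i => (N i).det) l (𝓝 N₀.det) :=
    (continuous_id.matrix_det.tendsto N₀).comp hN
  have hadj : Tendsto (fun i => (N i).adjugate) l (𝓝 N₀.adjugate) :=
    (continuous_id.matrix_adjugate.tendsto N₀).comp hN
  have hv : Tendsto (fun i => (N i).adjugate.mulVec (r i) ⟨d, hd⟩) l
      (𝓝 (N₀.adjugate.mulVec r₀ ⟨d, hd⟩)) := by
    simp only [Matrix.mulVec, dotProduct]
    refine tendsto_finsetSum _ fun j _ => Tendsto.mul ?_ (tendsto_pi_nhds.mp hr j)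
    exact tendsto_pi_nhds.mp (tendsto_pi_nhds.mp hadj _) j
  have hlim : Tendsto (fun i => ((N i).det)⁻¹ * (τ i ^ (k - d) *
      (N i).adjugate.mulVec (r i) ⟨d, hd⟩)) l (𝓝 0) := by
    have := (hdet.inv₀ h0).mul ((hτ.pow (k - d)).mul hv)
    rwa [zero_pow (by omega), zero_mul, mul_zero] at this
  refine hlim.congr' ?_
  filter_upwards [hs, hdet.eventually_ne h0] with i hi hi0
  obtain ⟨hτ0, e⟩ := hi
  have h1 := congrArg (fun v => (N i).adjugate.mulVec v ⟨d, hd⟩) e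
  simp only [Matrix.mulVec_mulVec, Matrix.adjugate_mul, Matrix.smul_mulVec, Matrix.one_mulVec,
    Matrix.mulVec_smul, Pi.smul_apply, smul_eq_mul] at h1
  have h2 : τ i ^ k = τ i ^ d * τ i ^ (k - d) := by rw [← pow_add]; congr 1; omega
  rw [h2] at h1
  rw [inv_mul_eq_iff_eq_mul₀ hi0]
  apply mul_left_cancel₀ (pow_ne_zero d hτ0)
  linear_combination -h1

/-! ### Blow-up at a double root of the exponent -/

section BlowUp

variable (a c : ℝ)

/-- The rescaled coordinate `z + τ² X`. -/
def blowUp (z τ : ℂ) : ℂ[X] →+* ℂ[X] := compRingHom (C z + C (τ ^ 2) * X)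

lemma blowUp_C (z τ w : ℂ) : blowUp z τ (C w) = C w := by simp [blowUp]
lemma blowUp_X (z τ : ℂ) : blowUp z τ X = C z + C (τ ^ 2) * X := by simp [blowUp]

/-- The rescaled phase divided by its value at the centre. -/
def blowUpPhase (z τ β : ℂ) : ℂ[X] :=
  1 + C β * (C (4 * z * τ ^ 2) * X + C (2 * τ ^ 4) * X ^ 2)

/-- The rescaled squared exponent. -/
def blowUpExp (z τ β : ℂ) : ℂ[X] :=
  -(X * (C (2 * z + Complex.I * c) + C (τ ^ 2) * X) * blowUp z τ (quadM ℂ a c)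
    * blowUpPhase z τ β ^ 2)

/-- The rescaled odd part. -/
def blowUpOdd (K : ℕ) (z τ β : ℂ) : ℂ[X] :=
  C Complex.I * blowUp z τ (quadM ℂ a c) * blowUpPhase z τ β *
    sinhcTrunc K (blowUpExp a c z τ β)

variable {a c} {K : ℕ} {x t : ℝ} {z T : ℂ}

/-- z is a root, so exactly one factor τ² can be extracted. With τ = 1/T it cancels the T² from the
squared phase, which is why the scale τ² is chosen. -/
lemma blowUp_quadP (hz : (quadP ℂ a c).eval z = 0) (τ : ℂ) :
    blowUp z τ (quadP ℂ a c) = C (τ ^ 2) * (X * (C (2 * z + Complex.I * c) + C (τ ^ 2) * X)) := by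
  have h : C z ^ 2 + C (Complex.I * c) * C z - C (a / 2 : ℂ) = 0 := by
    rw [← C_pow, ← C_mul, ← C_add, ← C_sub]
    simp only [quadP, eval_add, eval_sub, eval_mul, eval_pow, eval_X, eval_C,
      Algebra.algebraMap_self, RingHom.id_apply] at hz
    rw [hz, C_0]
  rw [quadP]
  simp only [map_add, map_sub, map_mul, map_pow, blowUp_X, blowUp_C, C_ofNat,
    Algebra.algebraMap_self, RingHom.id_apply] at h ⊢
  linear_combination h

lemma blowUp_phase (hT : T = x + 2 * z ^ 2 * t + (a - c ^ 2) * t) (hT0 : T ≠ 0) :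
    blowUp z T⁻¹ (phase a c (x : ℂ) (t : ℂ)) = C T * blowUpPhase z T⁻¹ (t / T) := by
  have h1 : C T * C (t / T : ℂ) = C (t : ℂ) := by
    rw [← C_mul]; congr 1; field_simp
  rw [phase, blowUpPhase]
  have h2 : C T = C (x : ℂ) + 2 * C z ^ 2 * C (t : ℂ) + C (a - c ^ 2 : ℂ) * C (t : ℂ) := by
    rw [hT]; simp only [C_add, C_mul, C_pow, C_ofNat]
  simp only [map_add, map_sub, map_mul, map_pow, blowUp_X, blowUp_C, map_ofNat,
    Algebra.algebraMap_self, RingHom.id_apply] at h1 h2 ⊢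
  linear_combination -h2 - (4 * C z * C T⁻¹ ^ 2 * X + 2 * C T⁻¹ ^ 4 * X ^ 2) * h1

lemma blowUp_sqExp (hz : (quadP ℂ a c).eval z = 0)
    (hT : T = x + 2 * z ^ 2 * t + (a - c ^ 2) * t) (hT0 : T ≠ 0) :
    blowUp z T⁻¹ (sqExp a c (x : ℂ) (t : ℂ)) = blowUpExp a c z T⁻¹ (t / T) := by
  have h1 : C (T⁻¹ ^ 2) * C T ^ 2 = (1 : ℂ[X]) := by
    rw [← C_pow, ← C_mul, ← C_1]; congr 1; field_simp
  rw [sqExp, map_neg, map_mul, map_mul, map_pow, blowUp_phase hT hT0, blowUp_quadP hz, blowUpExp]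
  linear_combination (-(X * (C (2 * z + Complex.I * c) + C (T⁻¹ ^ 2) * X) *
    blowUp z T⁻¹ (quadM ℂ a c) * blowUpPhase z T⁻¹ (t / T) ^ 2)) * h1

lemma blowUp_partA (hz : (quadP ℂ a c).eval z = 0)
    (hT : T = x + 2 * z ^ 2 * t + (a - c ^ 2) * t) (hT0 : T ≠ 0) :
    blowUp z T⁻¹ (partA a c K (x : ℂ) (t : ℂ)) = coshTrunc K (blowUpExp a c z T⁻¹ (t / T)) := by
  rw [partA, coshTrunc, coshTrunc, map_sum]
  simp only [map_mul, map_pow, blowUp_C, blowUp_sqExp hz hT hT0]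

lemma blowUp_partB (hz : (quadP ℂ a c).eval z = 0)
    (hT : T = x + 2 * z ^ 2 * t + (a - c ^ 2) * t) (hT0 : T ≠ 0) :
    blowUp z T⁻¹ (partB a c K (x : ℂ) (t : ℂ)) = C T * blowUpOdd a c K z T⁻¹ (t / T) := by
  have e : blowUp z T⁻¹ (sinhcTrunc K (sqExp a c (x : ℂ) (t : ℂ))) =
      sinhcTrunc K (blowUpExp a c z T⁻¹ (t / T)) := by
    rw [sinhcTrunc, sinhcTrunc, map_sum]
    simp only [map_mul, map_pow, blowUp_C, blowUp_sqExp hz hT hT0]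
  rw [partB, map_mul, map_mul, map_mul, e, blowUp_phase hT hT0, blowUp_C, blowUpOdd]
  simp only [Algebra.algebraMap_self, RingHom.id_apply]
  ring

section Limits

variable {α : Type*} {l : Filter α} {τ β : α → ℂ} {β₀ : ℂ}

lemma tendsto_blowUp_quadM (hτ : Tendsto τ l (𝓝 0)) :
    CoeffTendsto l (fun i => blowUp z (τ i) (quadM ℂ a c)) (C ((quadM ℂ a c).eval z)) := by
  have h1 : CoeffTendsto l (fun i => blowUp z (τ i) X) (C z) := by
    simp only [blowUp_X]
    have := (CoeffTendsto.const (l := l) (C z)).add ((CoeffTendsto.C (hτ.pow 2)).mul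
      (CoeffTendsto.const X))
    simpa using this
  have h2 := ((h1.pow 2).sub ((CoeffTendsto.const (C (Complex.I * c))).mul h1)).sub
    (CoeffTendsto.const (C (a / 2 : ℂ)))
  simpa [quadM, blowUp_C] using h2

lemma tendsto_blowUpPhase (hτ : Tendsto τ l (𝓝 0)) (hβ : Tendsto β l (𝓝 β₀)) :
    CoeffTendsto l (fun i => blowUpPhase z (τ i) (β i)) 1 := by
  have h1 : Tendsto (fun i => 4 * z * τ i ^ 2) l (𝓝 0) := by
    simpa using (hτ.pow 2).const_mul (4 * z)
  have h2 : Tendsto (fun i => 2 * τ i ^ 4) l (𝓝 0) := by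
    simpa using (hτ.pow 4).const_mul 2
  have := (CoeffTendsto.const (l := l) 1).add ((CoeffTendsto.C hβ).mul
    (((CoeffTendsto.C h1).mul (CoeffTendsto.const X)).add
      ((CoeffTendsto.C h2).mul (CoeffTendsto.const (X ^ 2)))))
  simpa only [blowUpPhase, C_0, zero_mul, add_zero, mul_zero] using this

lemma tendsto_blowUpExp (hτ : Tendsto τ l (𝓝 0)) (hβ : Tendsto β l (𝓝 β₀)) :
    CoeffTendsto l (fun i => blowUpExp a c z (τ i) (β i))
      (C (-((2 * z + Complex.I * c) * (quadM ℂ a c).eval z)) * X) := by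
  have := ((((CoeffTendsto.const (l := l) X).mul
    ((CoeffTendsto.const (C (2 * z + Complex.I * c))).add ((CoeffTendsto.C (hτ.pow 2)).mul
      (CoeffTendsto.const X)))).mul (tendsto_blowUp_quadM (a := a) (c := c) (z := z) hτ)).mul
    ((tendsto_blowUpPhase (z := z) hτ hβ).pow 2)).neg
  have e : -(X * (C (2 * z + Complex.I * c) + C (0 ^ 2) * X) * C ((quadM ℂ a c).eval z) * 1 ^ 2) =
      C (-((2 * z + Complex.I * c) * (quadM ℂ a c).eval z)) * X := by
    rw [C_neg, C_mul]; simp; ring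
  rw [← e]
  exact this

lemma tendsto_blowUpOdd (hτ : Tendsto τ l (𝓝 0)) (hβ : Tendsto β l (𝓝 β₀)) :
    CoeffTendsto l (fun i => blowUpOdd a c K z (τ i) (β i))
      (C (Complex.I * (quadM ℂ a c).eval z) *
        sinhcTrunc K (C (-((2 * z + Complex.I * c) * (quadM ℂ a c).eval z)) * X)) := by
  have := (((CoeffTendsto.const (l := l) (C Complex.I)).mul
    (tendsto_blowUp_quadM (a := a) (c := c) (z := z) hτ)).mul
    (tendsto_blowUpPhase (z := z) hτ hβ)).mul
    ((tendsto_blowUpExp (a := a) (c := c) (z := z) hτ hβ).sinhcTrunc K)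
  rw [mul_one, ← C_mul] at this
  exact this

end Limits

end BlowUp

end

end DNLS

namespace DNLS

open Polynomial ComplexConjugate Filter Topology

noncomputable section

/-! ### Decay of the Taylor coefficients of the annihilator -/

/-- Taylor coefficients at `z` of `v` and `u`, alternatingly. -/
def taylorPair (z : ℂ) (u v : ℂ[X]) (d : ℕ) : ℂ :=
  if Even d then (taylor z v).coeff (d / 2) else (taylor z u).coeff (d / 2)

/-- `B, A, X B, X A, …`. -/
def pairBasis (A B : ℂ[X]) (d : ℕ) : ℂ[X] := X ^ (d / 2) * if Even d then B else A

lemma blowUp_expand {u : ℂ[X]} {N : ℕ} (hu : u.natDegree < N) (z τ : ℂ) :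
    blowUp z τ u = ∑ m ∈ Finset.range N, C (τ ^ (2 * m) * (taylor z u).coeff m) * X ^ m := by
  have e : blowUp z τ u = (taylor z u).comp (C (τ ^ 2) * X) := by
    rw [taylor_apply, comp_assoc, blowUp, coe_compRingHom_apply]
    congr 1
    simp [add_comm]
  rw [e, as_sum_range_C_mul_X_pow' (taylor z u) (by rwa [natDegree_taylor]), ← coe_compRingHom_apply,
    map_sum]
  refine Finset.sum_congr rfl fun m _ => ?_
  rw [← as_sum_range_C_mul_X_pow' (taylor z u) (by rwa [natDegree_taylor]), coe_compRingHom_apply,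
    mul_comp, C_comp, X_pow_comp, mul_pow, ← C_pow, C_mul, pow_mul]
  ring

/-- B comes with an extra factor T, so the m-th Taylor coefficient of v weighs as τ^{2m-1} and that
of u as τ^{2m}; hence the alternating order v, u, v, u, …. -/
lemma blowUp_combination {u v A B : ℂ[X]} {N : ℕ} (hu : u.natDegree < N) (hv : v.natDegree < N)
    {z T τ : ℂ} (hT : T * τ = 1) :
    blowUp z τ u * A + blowUp z τ v * (C T * B) =
      C T * ∑ d ∈ Finset.range (2 * N), C (τ ^ d * taylorPair z u v d) * pairBasis A B d := by
  have hT' : C T * C τ = (1 : ℂ[X]) := by rw [← C_mul, hT, C_1]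
  rw [blowUp_expand hu, blowUp_expand hv, sum_range_two_mul, Finset.sum_mul, Finset.sum_mul,
    Finset.mul_sum, ← Finset.sum_add_distrib]
  refine Finset.sum_congr rfl fun m _ => ?_
  have h1 : (2 * m + 1) / 2 = m := by omega
  have h2 : 2 * m / 2 = m := by omega
  have h3 : ¬Even (2 * m + 1) := by simp
  rw [taylorPair, taylorPair, pairBasis, pairBasis, if_pos (even_two_mul m),
    if_pos (even_two_mul m), if_neg h3, if_neg h3, h1, h2]
  simp only [C_mul, C_pow]
  rw [pow_succ]
  linear_combination (-(C τ ^ (2 * m) * C ((taylor z u).coeff m) * X ^ m * A)) * hT'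

variable {a c : ℝ} {K k : ℕ}

/-- The limiting linear system. -/
def limitMatrix (k K : ℕ) (h g : ℂ) : Matrix (Fin k) (Fin k) ℂ :=
  Matrix.of fun j d => (pairBasis (coshTrunc K (C g * X)) (C h * sinhcTrunc K (C g * X)) d).coeff j

lemma limitMatrix_det_ne_zero (hk : k ≤ K) {h g : ℂ} (hh : h ≠ 0) (hg : g ≠ 0) :
    (limitMatrix k K h g).det ≠ 0 := by
  intro h0
  obtain ⟨y, hy, hy0⟩ := Matrix.exists_mulVec_eq_zero_iff.mpr h0
  apply hy
  set y' : ℕ → ℂ := fun d => if hd : d < k then y ⟨d, hd⟩ else 0 with hy'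
  set W : ℂ[X] := ∑ d ∈ Finset.range k, C (y' d) *
    pairBasis (coshTrunc K (C g * X)) (C h * sinhcTrunc K (C g * X)) d with hW
  have hdvd : X ^ k ∣ W := by
    rw [X_pow_dvd_iff]
    intro j hj
    have := congrFun hy0 ⟨j, hj⟩
    rw [Matrix.mulVec, dotProduct] at this
    rw [hW, finsetSum_coeff, ← Fin.sum_univ_eq_sum_range (fun d => (C (y' d) *
      pairBasis (coshTrunc K (C g * X)) (C h * sinhcTrunc K (C g * X)) d).coeff j)]
    refine Eq.trans (Finset.sum_congr rfl fun d _ => ?_) this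
    rw [coeff_C_mul, limitMatrix, Matrix.of_apply, mul_comm]
    simp [hy']
  -- Substituting y²/g for the variable removes the square roots: the series become cosh y and (sinh
  -- y)/y.
  set σ : ℂ[X] →+* ℂ[X] := compRingHom (C g⁻¹ * X ^ 2) with hσ
  have σX : σ X = C g⁻¹ * X ^ 2 := by simp [hσ]
  have σC : ∀ w, σ (C w) = C w := fun w => by simp [hσ]
  have hgg : C g * C g⁻¹ = (1 : ℂ[X]) := by rw [← C_mul, mul_inv_cancel₀ hg, C_1]
  have hgX : C g * (C g⁻¹ * X ^ 2) = (X ^ 2 : ℂ[X]) := by rw [← mul_assoc, hgg, one_mul]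
  have σA : σ (coshTrunc K (C g * X)) = coshTrunc K (X ^ 2) := by
    simp only [coshTrunc, map_sum, map_mul, map_pow, σC, σX, hgX]
  have σB : σ (sinhcTrunc K (C g * X)) = sinhcTrunc K (X ^ 2) := by
    simp only [sinhcTrunc, map_sum, map_mul, map_pow, σC, σX, hgX]
  have h1 : X ^ (2 * k + 1) ∣ ∑ d ∈ Finset.range k,
      C (y' d * (g⁻¹ ^ (d / 2) * if Even d then h else 1)) * X ^ d *
      (if Even d then X * sinhcTrunc K (X ^ 2) else coshTrunc K (X ^ 2)) := by
    have h2 : X ^ (2 * k) ∣ σ W := by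
      refine dvd_trans ?_ (map_dvd σ hdvd)
      rw [map_pow, σX, mul_pow, ← pow_mul]
      exact dvd_mul_left _ _
    -- The extra factor y turns (sinh y)/y into sinh y and makes the d-th basis element y^d times
    -- sinh y or cosh y.
    rw [pow_succ]
    refine (mul_dvd_mul_right h2 X).trans (dvd_of_eq ?_)
    rw [hW, map_sum, Finset.sum_mul]
    refine Finset.sum_congr rfl fun d _ => ?_
    rw [map_mul, σC, pairBasis, map_mul, map_pow, σX]
    rcases Nat.even_or_odd' d with ⟨m, rfl | rfl⟩
    · rw [if_pos (even_two_mul m), if_pos (even_two_mul m), if_pos (even_two_mul m), map_mul, σC, σB,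
        show 2 * m / 2 = m by omega]
      simp only [C_mul, C_pow]
      ring
    · have h3 : ¬Even (2 * m + 1) := by simp
      rw [if_neg h3, if_neg h3, if_neg h3, σA, show (2 * m + 1) / 2 = m by omega]
      simp only [C_mul, C_pow, C_1]
      ring
  have h4 := eq_zero_of_sinh_cosh hk h1
  ext d
  have h5 := h4 d d.isLt
  have h6 : g⁻¹ ^ ((d : ℕ) / 2) * (if Even (d : ℕ) then h else 1) ≠ 0 := by
    refine mul_ne_zero (pow_ne_zero _ (inv_ne_zero hg)) ?_
    split_ifs
    · exact hh
    · exact one_ne_zero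
  simpa [hy'] using (mul_eq_zero.mp h5).resolve_right h6

lemma CoeffTendsto.pairBasis {α : Type*} {l : Filter α} {A B : α → ℂ[X]} {A₀ B₀ : ℂ[X]}
    (hA : CoeffTendsto l A A₀) (hB : CoeffTendsto l B B₀) (d : ℕ) :
    CoeffTendsto l (fun i => DNLS.pairBasis (A i) (B i) d) (DNLS.pairBasis A₀ B₀ d) := by
  unfold DNLS.pairBasis
  split_ifs
  · exact (CoeffTendsto.const _).mul hB
  · exact (CoeffTendsto.const _).mul hA

lemma tendsto_taylorPair {α : Type*} {l : Filter α} {u v : α → ℂ[X]} {u₀ v₀ : ℂ[X]} {N : ℕ}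
    (hu : CoeffTendsto l u u₀) (hv : CoeffTendsto l v v₀) (hud : ∀ i, (u i).natDegree < N)
    (hvd : ∀ i, (v i).natDegree < N) (hud₀ : u₀.natDegree < N) (hvd₀ : v₀.natDegree < N) (z : ℂ)
    (d : ℕ) :
    Tendsto (fun i => taylorPair z (u i) (v i) d) l (𝓝 (taylorPair z u₀ v₀ d)) := by
  unfold taylorPair
  split_ifs
  · exact hv.taylor_coeff hvd hvd₀ z _
  · exact hu.taylor_coeff hud hud₀ z _

/-- In the coordinate z + X/T² the divisibility gives k linear equations for the interleaved Taylor
coefficients weighted by τ^d. The block of the first k unknowns converges to an invertible matrix,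
and the remaining ones contribute O(τ^k). -/
lemma tendsto_taylorPair_zero (hk : k ≤ K) {z : ℂ} (hz : (quadP ℂ a c).eval z = 0)
    (hM : (quadM ℂ a c).eval z ≠ 0) (hz' : 2 * z + Complex.I * c ≠ 0) {α : Type*} {l : Filter α}
    {x t : α → ℝ} {T : α → ℂ} (hT : ∀ i, T i = x i + 2 * z ^ 2 * t i + (a - c ^ 2) * t i)
    (hT0 : ∀ᶠ i in l, T i ≠ 0) (hτ : Tendsto (fun i => (T i)⁻¹) l (𝓝 0)) {β₀ : ℂ}
    (hβ : Tendsto (fun i => t i / T i) l (𝓝 β₀)) {u v : α → ℂ[X]} {u₀ v₀ : ℂ[X]} {N : ℕ}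
    (hN : k ≤ 2 * N) (hu : CoeffTendsto l u u₀) (hv : CoeffTendsto l v v₀)
    (hud : ∀ i, (u i).natDegree < N) (hvd : ∀ i, (v i).natDegree < N) (hud₀ : u₀.natDegree < N)
    (hvd₀ : v₀.natDegree < N)
    (h : ∀ i, (X - C z) ^ k ∣ u i * partA a c K (x i : ℂ) (t i : ℂ) +
      v i * partB a c K (x i : ℂ) (t i : ℂ)) :
    ∀ d < k, Tendsto (fun i => taylorPair z (u i) (v i) d) l (𝓝 0) := by
  obtain ⟨M, hM2⟩ := Nat.exists_eq_add_of_le hN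
  set g : ℂ := -((2 * z + Complex.I * c) * (quadM ℂ a c).eval z) with hg
  set A : α → ℂ[X] := fun i => coshTrunc K (blowUpExp a c z (T i)⁻¹ (t i / T i)) with hA
  set B : α → ℂ[X] := fun i => blowUpOdd a c K z (T i)⁻¹ (t i / T i) with hB
  have hAt : CoeffTendsto l A (coshTrunc K (C g * X)) := (tendsto_blowUpExp hτ hβ).coshTrunc K
  have hBt : CoeffTendsto l B (C (Complex.I * (quadM ℂ a c).eval z) * sinhcTrunc K (C g * X)) :=
    tendsto_blowUpOdd hτ hβ
  have hE := fun d => hAt.pairBasis hBt d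
  refine tendsto_zero_of_system (N := fun i => Matrix.of fun j d : Fin k =>
      (pairBasis (A i) (B i) d).coeff j)
    (N₀ := limitMatrix k K (Complex.I * (quadM ℂ a c).eval z) g)
    (r := fun i j => -∑ e ∈ Finset.range M, (T i)⁻¹ ^ e * taylorPair z (u i) (v i) (k + e) *
      (pairBasis (A i) (B i) (k + e)).coeff j)
    (r₀ := fun j => -∑ e ∈ Finset.range M, 0 ^ e * taylorPair z u₀ v₀ (k + e) *
      (pairBasis (coshTrunc K (C g * X))
        (C (Complex.I * (quadM ℂ a c).eval z) * sinhcTrunc K (C g * X)) (k + e)).coeff j)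
    ?_ (limitMatrix_det_ne_zero hk (mul_ne_zero Complex.I_ne_zero hM)
      (neg_ne_zero.mpr (mul_ne_zero hz' hM))) hτ ?_ ?_
  · exact tendsto_pi_nhds.mpr fun j => tendsto_pi_nhds.mpr fun d => hE d j
  · exact tendsto_pi_nhds.mpr fun j => (tendsto_finsetSum _ fun e _ =>
      ((hτ.pow e).mul (tendsto_taylorPair hu hv hud hvd hud₀ hvd₀ z (k + e))).mul
        (hE (k + e) j)).neg
  · filter_upwards [hT0] with i hi
    refine ⟨inv_ne_zero hi, ?_⟩
    ext j
    have h1 := map_dvd (blowUp z (T i)⁻¹) (h i)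
    rw [map_add, map_mul, map_mul, blowUp_partA hz (hT i) hi, blowUp_partB hz (hT i) hi,
      blowUp_combination (hud i) (hvd i) (mul_inv_cancel₀ hi), map_pow, map_sub, blowUp_X, blowUp_C,
      add_sub_cancel_left, mul_pow] at h1
    have h2 := (dvd_C_mul hi).mp ((dvd_mul_left _ _).trans h1)
    rw [X_pow_dvd_iff] at h2
    have h3 := h2 j j.isLt
    rw [finsetSum_coeff, hM2, Finset.sum_range_add] at h3
    simp only [coeff_C_mul] at h3
    rw [Matrix.mulVec, dotProduct]
    simp only [Matrix.of_apply, Pi.smul_apply, smul_eq_mul]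
    rw [Fin.sum_univ_eq_sum_range (fun d => (pairBasis (A i) (B i) d).coeff j *
      ((T i)⁻¹ ^ d * taylorPair z (u i) (v i) d)) k, mul_neg, Finset.mul_sum, eq_neg_iff_add_eq_zero,
      ← h3]
    congr 1
    · exact Finset.sum_congr rfl fun d _ => mul_comm _ _
    · refine Finset.sum_congr rfl fun d _ => ?_
      rw [pow_add]; ring

end

end DNLS

namespace DNLS

open Polynomial ComplexConjugate Filter Topology

noncomputable section

variable {a c : ℝ} {k : ℕ}

/-! ### Localization -/

lemma exists_tendsto_of_bounded {α : Type*} (U : Ultrafilter α) {f : α → ℂ} {B : ℝ}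
    (h : ∀ i, ‖f i‖ ≤ B) : ∃ z, Tendsto f U (𝓝 z) := by
  obtain ⟨z, -, hz⟩ := (isCompact_closedBall (0 : ℂ) B).ultrafilter_le_nhds' (U.map f)
    (mem_map.mpr (univ_mem' fun i => by simpa using h i))
  exact ⟨z, hz⟩

/-- Polynomials of bounded degree which are bounded at every real number converge along
ultrafilters. -/
lemma exists_coeffTendsto {α : Type*} (U : Ultrafilter α) {F : α → ℂ[X]} {n : ℕ}
    (hF : ∀ i, (F i).natDegree ≤ n) (hb : ∀ r : ℝ, ∃ B : ℝ, ∀ i, ‖(F i).eval (r : ℂ)‖ ≤ B) :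
    ∃ G : ℂ[X], G.natDegree ≤ n ∧ CoeffTendsto U F G := by
  have hlim : ∀ m : ℕ, ∃ z, Tendsto (fun i => (F i).eval ((m : ℝ) : ℂ)) U (𝓝 z) := fun m => by
    obtain ⟨B, hB⟩ := hb m
    exact exists_tendsto_of_bounded U hB
  choose z hz using hlim
  set v : ℕ → ℂ := fun m => ((m : ℝ) : ℂ) with hv
  have hinj : Set.InjOn v (Finset.range (n + 1)) := fun i _ j _ hij => by
    simpa [hv] using hij
  have hdeg : ∀ p : ℂ[X], p.degree < ((Finset.range (n + 1)).card : WithBot ℕ) ↔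
      p.natDegree ≤ n := fun p => by
    rw [Finset.card_range, degree_lt_iff_coeff_zero, natDegree_le_iff_coeff_eq_zero]
    rfl
  refine ⟨Lagrange.interpolate (Finset.range (n + 1)) v z, ?_, ?_⟩
  · exact (hdeg _).mp (Lagrange.degree_interpolate_lt _ hinj)
  · have e : F = fun i => Lagrange.interpolate (Finset.range (n + 1)) v
        fun m => (F i).eval (v m) := by
      ext1 i
      exact Lagrange.eq_interpolate hinj ((hdeg _).mpr (hF i))
    rw [e]
    simp only [Lagrange.interpolate_apply]
    exact CoeffTendsto.sum _ fun m _ => (CoeffTendsto.C (hz m)).mul (CoeffTendsto.const _)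

lemma norm_eval_le {P R : ℂ[X]} (r : ℝ) :
    ‖P.eval (r : ℂ)‖ ≤ Real.sqrt ‖(P * conjP P + R * conjP R).eval (r : ℂ)‖ ∧
      ‖R.eval (r : ℂ)‖ ≤ Real.sqrt ‖(P * conjP P + R * conjP R).eval (r : ℂ)‖ := by
  have e : (P * conjP P + R * conjP R).eval (r : ℂ) =
      ((‖P.eval (r : ℂ)‖ ^ 2 + ‖R.eval (r : ℂ)‖ ^ 2 : ℝ) : ℂ) := by
    rw [eval_add, eval_mul, eval_mul, eval_conjP_ofReal, eval_conjP_ofReal, Complex.mul_conj,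
      Complex.mul_conj, Complex.normSq_eq_norm_sq, Complex.normSq_eq_norm_sq]
    push_cast; rfl
  rw [e, Complex.norm_real, Real.norm_of_nonneg (by positivity)]
  constructor <;> apply Real.le_sqrt_of_sq_le <;> nlinarith [sq_nonneg ‖P.eval (r : ℂ)‖,
    sq_nonneg ‖R.eval (r : ℂ)‖]

lemma two_mul_lamRow_add (a c : ℝ) (r : ℕ) :
    2 * lamRow a c r + Complex.I * c = if Even r then (Real.sqrt (2 * a - c ^ 2) : ℂ)
      else -(Real.sqrt (2 * a - c ^ 2) : ℂ) := by
  rw [lamRow]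
  split_ifs
  · rw [lam1]; ring
  · rw [lam2, lam1]
    simp [map_ofNat]
    ring

lemma quadM_eval_lamRow (hc : c ≠ 0) (hac : c ^ 2 < 2 * a) (r : ℕ) :
    (quadM ℂ a c).eval (lamRow a c r) ≠ 0 := by
  intro h
  obtain ⟨u, v, huv⟩ := isCoprime_quadP_quadM hc (pos_of_lt hac).ne'
  have := congrArg (eval (lamRow a c r)) huv
  rw [eval_add, eval_mul, eval_mul, h, quadP_eval_lamRow hac] at this
  simp at this

lemma sqrt_ne_zero_of_lt (hac : c ^ 2 < 2 * a) : (Real.sqrt (2 * a - c ^ 2) : ℂ) ≠ 0 := by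
  exact_mod_cast (Real.sqrt_pos.mpr (by linarith)).ne'

lemma two_mul_lamRow_add_ne_zero (hac : c ^ 2 < 2 * a) (r : ℕ) :
    2 * lamRow a c r + Complex.I * c ≠ 0 := by
  rw [two_mul_lamRow_add]
  split_ifs
  · exact sqrt_ne_zero_of_lt hac
  · exact neg_ne_zero.mpr (sqrt_ne_zero_of_lt hac)

/-- The imaginary part is ∓c√(2a - c²). Its nonvanishing makes (x, t) ↦ T(λᵢ) injective, so T goes
to infinity in every direction of the plane. -/
lemma im_lamRow_sq (hc : c ≠ 0) (hac : c ^ 2 < 2 * a) (r : ℕ) :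
    (2 * lamRow a c r ^ 2 + (a - c ^ 2)).im ≠ 0 := by
  have hs := (Real.sqrt_pos.mpr (show (0 : ℝ) < 2 * a - c ^ 2 by linarith)).ne'
  have h1 := two_mul_lamRow_add a c r
  have h2 : lamRow a c r = ((if Even r then Real.sqrt (2 * a - c ^ 2) else
      -Real.sqrt (2 * a - c ^ 2) : ℝ) : ℂ) / 2 - Complex.I * c / 2 := by
    split_ifs at h1 ⊢
    · linear_combination h1 / 2
    · push_cast; linear_combination h1 / 2
  set s : ℝ := if Even r then Real.sqrt (2 * a - c ^ 2) else -Real.sqrt (2 * a - c ^ 2) with hsdef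
  have hs' : s ≠ 0 := by
    rw [hsdef]; split_ifs
    · exact hs
    · exact neg_ne_zero.mpr hs
  have e : 2 * lamRow a c r ^ 2 + (a - c ^ 2) =
      (((s ^ 2 - c ^ 2) / 2 + (a - c ^ 2) : ℝ) : ℂ) + ((-(s * c) : ℝ) : ℂ) * Complex.I := by
    rw [h2]; push_cast; linear_combination (c ^ 2 / 2 : ℂ) * Complex.I_sq
  rw [e, Complex.add_im, Complex.ofReal_im, Complex.im_ofReal_mul, Complex.I_im, mul_one, zero_add]
  exact neg_ne_zero.mpr (mul_ne_zero hs' hc)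

/-- The phase at a double root of the exponent as a linear map. -/
def centralPhase (w : ℂ) : ℝ × ℝ →ₗ[ℝ] ℂ :=
  Complex.ofRealCLM.toLinearMap ∘ₗ LinearMap.fst ℝ ℝ ℝ +
    (LinearMap.mulLeft ℝ w) ∘ₗ Complex.ofRealCLM.toLinearMap ∘ₗ LinearMap.snd ℝ ℝ ℝ

lemma centralPhase_apply (w : ℂ) (p : ℝ × ℝ) : centralPhase w p = p.1 + w * p.2 := rfl

lemma centralPhase_ker {w : ℂ} (hw : w.im ≠ 0) : LinearMap.ker (centralPhase w) = ⊥ := by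
  rw [LinearMap.ker_eq_bot']
  intro p hp
  rw [centralPhase_apply] at hp
  have h1 := congrArg Complex.im hp
  have h2 := congrArg Complex.re hp
  simp [hw] at h1
  simp [h1] at h2
  exact Prod.ext h2 h1

/-- An injective linear map on a finite-dimensional space is bounded below, so both coordinates are
controlled by the phase. -/
lemma tendsto_centralPhase {w : ℂ} (hw : w.im ≠ 0) :
    Tendsto (fun p : ℝ × ℝ => (centralPhase w p)⁻¹) (cocompact (ℝ × ℝ)) (𝓝 0) ∧
      (∀ᶠ p in cocompact (ℝ × ℝ), centralPhase w p ≠ 0) ∧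
      ∃ B : ℝ, ∀ p : ℝ × ℝ, ‖(p.2 : ℂ) / centralPhase w p‖ ≤ B := by
  obtain ⟨B, hB, hanti⟩ := LinearMap.exists_antilipschitzWith (centralPhase w) (centralPhase_ker hw)
  have hcoc : Tendsto (centralPhase w) (cocompact (ℝ × ℝ)) (cocompact ℂ) := by
    rw [← Metric.cobounded_eq_cocompact, ← Metric.cobounded_eq_cocompact]
    exact hanti.tendsto_cobounded
  refine ⟨?_, ?_, B, fun p => ?_⟩
  · have : Tendsto (fun z : ℂ => z⁻¹) (cocompact ℂ) (𝓝 0) := by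
      rw [← Metric.cobounded_eq_cocompact]
      exact tendsto_inv₀_cobounded
    exact this.comp hcoc
  · exact hcoc.eventually (isCompact_singleton.compl_mem_cocompact)
  · have h1 := hanti.le_mul_dist p 0
    rw [dist_zero_right, map_zero, dist_zero_right] at h1
    rcases eq_or_ne (centralPhase w p) 0 with h0 | h0
    · simp [h0]
    · rw [norm_div, div_le_iff₀ (norm_pos_iff.mpr h0), Complex.norm_real]
      exact (norm_snd_le p).trans h1

lemma X_sub_C_pow_dvd_of_taylor {p : ℂ[X]} {z : ℂ} {n : ℕ}
    (h : ∀ m < n, (taylor z p).coeff m = 0) : (X - C z) ^ n ∣ p := by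
  rw [X_sub_C_pow_dvd_iff, X_pow_dvd_iff]
  exact h

lemma tendsto_norm_rogueWave (hc : c ≠ 0) (hac : c ^ 2 < 2 * a) (hk : 1 ≤ k) :
    Tendsto (fun p : ℝ × ℝ => ‖rogueWave a c k p.1 p.2‖) (cocompact (ℝ × ℝ)) (𝓝 |c|) := by
  -- Along an ultrafilter every bounded family converges, so limits of the annihilators exist
  -- without passing to subsequences.
  rw [tendsto_iff_ultrafilter]
  intro U hU
  have hex := fun p : ℝ × ℝ => exists_isMonicAnnihilator hc hac k p.1 p.2 k
  choose P R h using hex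
  have ha := pos_of_lt hac
  have hRd : ∀ p, (R p).natDegree ≤ 2 * k := fun p => (h p).natDegree_snd_le.trans (Nat.sub_le _ _)
  have hbd : ∀ p (r : ℝ), _ := fun p r => norm_eval_le (P := P p) (R := R p) r
  have hnorm := fun p => (h p).evenOdd.norm_eq hc ha.ne' (h p).annihilates (h p).natDegree_fst
    (h p).coeff_fst (h p).natDegree_snd
  simp only [hnorm] at hbd
  obtain ⟨P₀, hP₀, hP⟩ := exists_coeffTendsto U (fun p => (h p).natDegree_fst)
    fun r => ⟨_, fun p => (hbd p r).1⟩
  obtain ⟨R₀, hR₀, hR⟩ := exists_coeffTendsto U hRd fun r => ⟨_, fun p => (hbd p r).2⟩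
  have hu := hP.add hR
  have hv := hP.sub hR
  have hrefl : reflP (P₀ + R₀) = P₀ - R₀ := by
    ext j
    rw [coeff_reflP]
    refine tendsto_nhds_unique ((hu j).const_mul ((-1) ^ j)) ((hv j).congr fun p => ?_)
    rw [← coeff_reflP, map_add, (h p).evenOdd.1, (h p).evenOdd.2, ← sub_eq_add_neg]
  have hzero : ∀ r, ∀ d < k, taylorPair (lamRow a c r) (P₀ + R₀) (P₀ - R₀) d = 0 := by
    intro r d hd
    obtain ⟨h1, h2, B, h3⟩ := tendsto_centralPhase (im_lamRow_sq hc hac r)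
    obtain ⟨β₀, hβ⟩ := exists_tendsto_of_bounded U h3
    have hud : ∀ p, (P p + R p).natDegree < 2 * k + 1 := fun p =>
      (natDegree_add_le _ _).trans_lt (max_lt (Nat.lt_succ_of_le (h p).natDegree_fst)
        (Nat.lt_succ_of_le (hRd p)))
    have hvd : ∀ p, (P p - R p).natDegree < 2 * k + 1 := fun p =>
      (natDegree_sub_le _ _).trans_lt (max_lt (Nat.lt_succ_of_le (h p).natDegree_fst)
        (Nat.lt_succ_of_le (hRd p)))
    have hud₀ : (P₀ + R₀).natDegree < 2 * k + 1 :=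
      (natDegree_add_le _ _).trans_lt (max_lt (Nat.lt_succ_of_le hP₀) (Nat.lt_succ_of_le hR₀))
    have hvd₀ : (P₀ - R₀).natDegree < 2 * k + 1 :=
      (natDegree_sub_le _ _).trans_lt (max_lt (Nat.lt_succ_of_le hP₀) (Nat.lt_succ_of_le hR₀))
    refine tendsto_nhds_unique (tendsto_taylorPair hu hv hud hvd hud₀ hvd₀ _ d)
      (tendsto_taylorPair_zero (K := k) (a := a) (c := c) (x := Prod.fst) (t := Prod.snd) le_rfl
        (quadP_eval_lamRow hac r)
        (quadM_eval_lamRow hc hac r) (two_mul_lamRow_add_ne_zero hac r) (fun p => ?_) (hU h2)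
        (h1.mono_left hU) hβ (by omega) hu hv hud hvd hud₀ hvd₀ (fun p => ?_) d hd)
    · rw [centralPhase_apply]; ring
    · refine ((quadP_pow_dvd_iff hac _).mp (h p).annihilates r).trans (dvd_of_eq ?_)
      ring
  -- Among the k vanishing interleaved coefficients ⌈k/2⌉ belong to P - R and ⌊k/2⌋ to P + R.
  have hvdvd : quadP ℂ a c ^ ((k + 1) / 2) ∣ P₀ - R₀ := by
    refine (quadP_pow_dvd_iff hac _).mpr fun r => X_sub_C_pow_dvd_of_taylor fun m hm => ?_
    have := hzero r (2 * m) (by omega)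
    rwa [taylorPair, if_pos (even_two_mul m), show 2 * m / 2 = m by omega] at this
  have hudvd : quadP ℂ a c ^ (k / 2) ∣ P₀ + R₀ := by
    refine (quadP_pow_dvd_iff hac _).mpr fun r => X_sub_C_pow_dvd_of_taylor fun m hm => ?_
    have := hzero r (2 * m + 1) (by omega)
    rwa [taylorPair, if_neg (by simp), show (2 * m + 1) / 2 = m by omega] at this
  -- Reflection exchanges P + R with P - R and `quadP` with `quadM`, so both divisibilities meet on
  -- P - R and exhaust its degree 2k.
  have hvdvd' : quadM ℂ a c ^ (k / 2) ∣ P₀ - R₀ := by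
    have := map_dvd reflP hudvd
    rwa [map_pow, reflP_quadP, hrefl] at this
  have hdvd := (isCoprime_quadP_quadM hc ha.ne').pow.mul_dvd hvdvd hvdvd'
  have hmP := (monic_quadP (R := ℂ) a c).pow ((k + 1) / 2)
  have hmM := (monic_quadM (R := ℂ) a c).pow (k / 2)
  have hlead : (P₀ - R₀).coeff (2 * k) = 1 := by
    refine tendsto_nhds_unique (hv (2 * k)) (tendsto_const_nhds.congr fun p => ?_)
    have := (h p).natDegree_snd_le
    rw [coeff_sub, (h p).coeff_fst, coeff_eq_zero_of_natDegree_lt (by omega), sub_zero]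
  have hdeg : (P₀ - R₀).natDegree ≤ 2 * k := (natDegree_sub_le _ _).trans (max_le hP₀ hR₀)
  have hdeg' : (quadP ℂ a c ^ ((k + 1) / 2) * quadM ℂ a c ^ (k / 2)).natDegree = 2 * k := by
    rw [hmP.natDegree_mul hmM, (monic_quadP a c).natDegree_pow, (monic_quadM a c).natDegree_pow,
      natDegree_quadP, natDegree_quadM]
    omega
  have heq : P₀ - R₀ = quadP ℂ a c ^ ((k + 1) / 2) * quadM ℂ a c ^ (k / 2) :=
    eq_of_monic_of_dvd_of_natDegree_le (hmP.mul hmM)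
      (monic_of_natDegree_le_of_coeff_eq_one (2 * k) hdeg hlead) hdvd (hdeg'.symm ▸ hdeg)
  have hnext := hmP.nextCoeff_mul hmM
  have nP : (quadP ℂ a c).nextCoeff = Complex.I * c := by
    rw [nextCoeff_of_natDegree_pos (by simp [natDegree_quadP]), natDegree_quadP]
    simp [quadP, coeff_X_pow, coeff_C]
  have nM : (quadM ℂ a c).nextCoeff = -(Complex.I * c) := by
    rw [nextCoeff_of_natDegree_pos (by simp [natDegree_quadM]), natDegree_quadM]
    simp [quadM, coeff_X_pow, coeff_C]
  rw [(monic_quadP a c).nextCoeff_pow, (monic_quadM a c).nextCoeff_pow, nP, nM,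
    nextCoeff_of_natDegree_pos (by omega), hdeg', ← heq] at hnext
  have hlim : Tendsto (fun p => (c : ℂ) - 2 * Complex.I * (R p).coeff (2 * k - 1)) U
      (𝓝 ((c : ℂ) + 2 * Complex.I * (P₀ - R₀).coeff (2 * k - 1))) := by
    refine ((hv (2 * k - 1)).const_mul (2 * Complex.I)).const_add (c : ℂ) |>.congr fun p => ?_
    rw [coeff_sub, coeff_of_even (h p).evenOdd.1 ⟨k - 1, by omega⟩]
    ring
  have hfin := hlim.norm
  -- The next-to-leading coefficient is (⌈k/2⌉ - ⌊k/2⌋)ic, so the limiting amplitude is c for even k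
  -- and -c for odd k.
  have hval : ‖(c : ℂ) + 2 * Complex.I * (P₀ - R₀).coeff (2 * k - 1)‖ = |c| := by
    rw [hnext]
    rcases Nat.even_or_odd' k with ⟨m, rfl | rfl⟩
    · rw [show (2 * m + 1) / 2 = m by omega, show 2 * m / 2 = m by omega]
      have e : (c : ℂ) + 2 * Complex.I * (m • (Complex.I * c) + m • -(Complex.I * c)) = c := by
        simp only [nsmul_eq_mul]; ring
      rw [e, Complex.norm_real, Real.norm_eq_abs]
    · rw [show (2 * m + 1 + 1) / 2 = m + 1 by omega, show (2 * m + 1) / 2 = m by omega]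
      have e : (c : ℂ) + 2 * Complex.I * ((m + 1) • (Complex.I * c) + m • -(Complex.I * c)) = -c := by
        simp only [nsmul_eq_mul]; push_cast
        linear_combination 2 * c * Complex.I_sq
      rw [e, norm_neg, Complex.norm_real, Real.norm_eq_abs]
  rw [hval] at hfin
  refine hfin.congr fun p => ?_
  rw [(h p).norm_rogueWave hc hac hk (Nat.le_succ k)]

end

end DNLS
theorem proposition2 (a c : ℝ) (hc : c ≠ 0) (hac : c ^ 2 < 2 * a) (k : ℕ) (hk : 1 ≤ k) :
    -- the order-0 Taylor terms vanish at both eigenvalues, where `c₁ = 0`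
    (DNLS.c1 a c (DNLS.lam1 a c) = 0 ∧ DNLS.c1 a c (DNLS.lam2 a c) = 0 ∧
      ∀ (x t : ℝ) (j : ℕ),
        DNLS.taylorCoeff (DNLS.eigF a c x t) (DNLS.lam1 a c) j 0 = 0 ∧
        DNLS.taylorCoeff (DNLS.eigG a c x t) (DNLS.lam1 a c) j 0 = 0 ∧
        DNLS.taylorCoeff (DNLS.eigF a c x t) (DNLS.lam2 a c) j 0 = 0 ∧
        DNLS.taylorCoeff (DNLS.eigG a c x t) (DNLS.lam2 a c) j 0 = 0) ∧
    -- the formula is well defined on the whole plane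
    (∀ x t : ℝ, DNLS.delta21 a c k x t ≠ 0) ∧
    -- it is a rogue wave solution on the background of the seed
    DNLS.IsRogueWave |c| (DNLS.rogueWave a c k) ∧
    -- of order `k`: it is the limit of the `k`-fold Darboux transform of the seed as the `k`
    -- distinct eigenvalues `λ₁ + d l * ε` merge at `λ₁`
    (∀ d : ℕ → ℂ, Set.InjOn d (Set.Iio k) → (∀ l < k, d l ≠ 0) → ∀ x t : ℝ,
      Filter.Tendsto
        (fun ε : ℂ => DNLS.darbouxSolution a c k (fun l => DNLS.lam1 a c + d l * ε) x t)
        (nhdsWithin 0 {0}ᶜ) (nhds (DNLS.rogueWave a c k x t))) := by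
  refine ⟨⟨DNLS.c1_eq_zero hac 0, DNLS.c1_eq_zero hac 1, fun x t j => ?_⟩,
    fun x t => DNLS.delta21_ne_zero x t hc hac hk,
    ⟨DNLS.isSolution_rogueWave hc hac hk, DNLS.tendsto_norm_rogueWave hc hac hk,
      (0, 0), DNLS.dominant_peak hc hac hk⟩,
    fun d hd hd0 x t => DNLS.tendsto_darbouxSolution x t hc hac hk hd hd0⟩
  have h : ∀ {φ : ℂ → ℂ} {l : ℂ}, φ l = 0 → DNLS.taylorCoeff φ l j 0 = 0 := fun h0 => by
    rw [DNLS.taylorCoeff_zero, h0, mul_zero]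
  exact ⟨h (DNLS.eigF_eq_zero x t hc hac 0), h (DNLS.eigG_eq_zero x t hc hac 0),
    h (DNLS.eigF_eq_zero x t hc hac 1), h (DNLS.eigG_eq_zero x t hc hac 1)⟩
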